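/- **Setting.** There are $n\ge 2$ users; user $k$ holds $m_k$ records. Let $\ell_z:\mathbb R^d\to\mathbb R$ be a differentiable loss for every record $z$ (strongly convex and smooth losses and non-convex losses are both covered), $\mathcal K\subseteq\mathbb R^d$ closed and convex (possibly $\mathcal K=\mathbb R^d$) with nearest-point projection $\Pi_{\mathcal K}$, $\theta_0\in\mathcal K$, $\eta,\sigma>0$, $K\ge1$, $1\le b\le\min_k m_k$. Let $W$ be a symmetric, irreducible and aperiodic stochastic $n\times n$ matrix, $\lambda_2$ its second-largest eigenvalue and $\pi$ its stationary distribution. *Decentralized DP-SGD* on $D=(D_1,\dots,D_n)$: $i_0\sim\pi$, and $\theta_0$ is the initial model. In round $t=0,\dots,T-1$ the active user $i_t$ makes $K$ local steps $\theta\leftarrow\Pi_{\mathcal K}(\theta-\eta(g+Z))$, where $g$ is the average of $\nabla\ell_z(\theta)$ over a fresh uniformly random subset of $b$ of its $m_{i_t}$ records, and $Z\sim\mathcal N(0,\sigma^2I_d)$. It then sends the model to a random user $i_{t+1}\sim W_{i_t\cdot}$. The view $\mathcal A_j(D)$ of user $j$ consists of the models received by $j$, with their times $t\in\{1,\dots,T\}$.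 Write $D\approx_iD'$ if $D,D'$ differ in exactly one record, held by user $i$. *Trade-off functions.* $T(P,Q)(\alpha)=\inf\{1-\mathbb E_Q\phi:\ 0\le\phi\le1,\ \mathbb E_P\phi\le\alpha\}$ for $\alpha\in[0,1]$; a trade-off function is a function of the form $T(P,Q)$ with probability measures $P,Q$; inequalities between such functions are pointwise. For $f=T(P,Q)$, $f^{\otimes N}=T(P^{N},Q^{N})$ with product measures. *Per-visit trade-off.* Let $D\approx_iD'$. Let $w_{ij}^t=\mathbb P[\tau_{ij}=t]$, where $\tau_{ij}\ge1$ is the first time $\geq 1$ at which the walk started at $i$ is at $j$, and $w_{ij}^{T+1}=1-\sum_{t\le T}w_{ij}^t$. For $\theta\in\mathcal K$ let $\mathcal A_j^{t}(D)$, started at $\theta$, be the model received by $j$ at time $t$ when the algorithm starts at user $i$ with the model $\theta$, conditionally on $\tau_{ij}=t$. Let $\widetilde f_{ij}^t$ be the greatest trade-off function such that $T(\mathcal A_j^t(D),\mathcal A_j^t(D'))\ge\widetilde f_{ij}^t$ for all starting models $\theta\in\mathcal K$ (so the amplification by subsampling $b$ of the $m_i$ records is part of $\widetilde f_{ij}^t$).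 Let $\widetilde f_{ij}^{\mathrm{single}}$ be a trade-off function with $$\widetilde f_{ij}^{\mathrm{single}}(\alpha(s))=\sum_{t=1}^Tw_{ij}^t\,\widetilde f_{ij}^t(\alpha_t(s))+w_{ij}^{T+1}\bigl(1-\alpha_{T+1}(s)\bigr)\qquad\text{for all }s\in[0,\infty),$$ where $\alpha_t(s)=P_t[\,dQ_t/dP_t>s\,]$ for a pair $P_t,Q_t$ with $\widetilde f_{ij}^t=T(P_t,Q_t)$, $\alpha_{T+1}(s)=\mathbf 1_{[s<1]}$, and $\alpha(s)=\sum_{t=1}^{T+1}w_{ij}^t\alpha_t(s)$. **Theorem.** Such a function $\widetilde f_{ij}^{\mathrm{single}}$ exists. For all $i,j$, all $D\approx_iD'$, all $T$ and all $\zeta>0$, $$T(\mathcal A_j(D),\mathcal A_j(D'))\ \ge\ \bigl(\widetilde f_{ij}^{\mathrm{single}}\bigr)^{\otimes N},\qquad N=\lceil(1+\zeta)T/n\rceil,$$ with probability at least $1-\delta'_{T,n}$ over the random walk, where $$\delta'_{T,n}=\exp\Bigl(-\frac{1-\lambda}{1+\lambda}\cdot\frac{2\zeta^2T}{n^2}\Bigr),\qquad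 \lambda=\max\{\lambda_2,0\}.$$ This means: the event $G$ that the walk visits $j$ at most $N$ times during $\{1,\dots,T\}$ has probability at least $1-\delta'_{T,n}$; the inequality holds for the views on $G$ (the view being replaced by a fixed symbol $\bot$ outside $G$); and consequently $T(\mathcal A_j(D),\mathcal A_j(D'))(\alpha)\ge(\widetilde f_{ij}^{\mathrm{single}})^{\otimes N}(\alpha)-\delta'_{T,n}$ for the full views and all $\alpha\in[0,1]$. -/

import Mathlib

open MeasureTheory ProbabilityTheory

noncomputable section

namespace DecSGD

/-! ### Trade-off functions -/

/-- The trade-off function `T(P, Q)`: the least type II error `1 - E_Q[φ]` among the rejection rules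
`φ` with values in `[0,1]` and type I error `E_P[φ] ≤ α`. It is used for `α ∈ [0,1]`. -/
def tradeoff {X : Type*} [MeasurableSpace X] (P Q : Measure X) (α : ℝ) : ℝ :=
  sInf {β : ℝ | ∃ φ : X → ℝ, Measurable φ ∧ (∀ x, 0 ≤ φ x ∧ φ x ≤ 1) ∧
    ∫ x, φ x ∂P ≤ α ∧ β = 1 - ∫ x, φ x ∂Q}

/-- `f ≥ g` for trade-off functions, that is, pointwise on `[0,1]`. -/
def Dominates (f g : ℝ → ℝ) : Prop := ∀ α ∈ Set.Icc (0 : ℝ) 1, g α ≤ f α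

/-- `P`, `Q` are probability measures with `f = T(P, Q)` on `[0,1]`. -/
def Represents {X : Type} [MeasurableSpace X] (P Q : Measure X) (f : ℝ → ℝ) : Prop :=
  IsProbabilityMeasure P ∧ IsProbabilityMeasure Q ∧
    ∀ α ∈ Set.Icc (0 : ℝ) 1, f α = tradeoff P Q α

/-- `f` is a trade-off function. -/
def IsTradeoff (f : ℝ → ℝ) : Prop :=
  ∃ (X : Type) (_ : MeasurableSpace X) (P Q : Measure X), Represents P Q f

/-- `h` is the `N`-fold tensor product `f^{⊗N} = T(P × ⋯ × P, Q × ⋯ × Q)`, where `f = T(P, Q)`. -/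
def IsTensorPow (f : ℝ → ℝ) (N : ℕ) (h : ℝ → ℝ) : Prop :=
  ∃ (X : Type) (_ : MeasurableSpace X) (P Q : Measure X), Represents P Q f ∧
    ∀ α ∈ Set.Icc (0 : ℝ) 1,
      h α = tradeoff (Measure.pi fun _ : Fin N => P) (Measure.pi fun _ : Fin N => Q) α

/-- `a` is the type I error `P[q/p > s]` of the likelihood ratio test with threshold `s`, for a pair
`P`, `Q` with trade-off function `f`. -/
def IsTypeIError (f : ℝ → ℝ) (s a : ℝ) : Prop :=
  ∃ (X : Type) (_ : MeasurableSpace X) (P Q : Measure X), Represents P Q f ∧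
    a = P.real {x | ENNReal.ofReal s < Q.rnDeriv P x}

/-- `g` is the mixture, with weights `w 1, …, w T` and the remaining weight `w^{T+1}` on perfect
privacy, of the trade-off functions `f 1, …, f T`: for every threshold `s ≥ 0`,
`g(α(s)) = ∑_{t ≤ T} w_t f_t(α_t(s)) + w_{T+1} (1 - α_{T+1}(s))`, where `α_{T+1}(s) = 1_{s < 1}` and
`α(s) = ∑_{t ≤ T+1} w_t α_t(s)`. -/
def IsSingle (T : ℕ) (w : ℕ → ℝ) (f : ℕ → ℝ → ℝ) (g : ℝ → ℝ) : Prop :=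
  IsTradeoff g ∧ ∀ s : ℝ, 0 ≤ s → ∀ a : ℕ → ℝ,
    (∀ t ∈ Finset.Icc 1 T, IsTypeIError (f t) s (a t)) →
    a (T + 1) = (if s < 1 then 1 else 0) →
    g ((∑ t ∈ Finset.Icc 1 T, w t * a t) + (1 - ∑ t ∈ Finset.Icc 1 T, w t) * a (T + 1)) =
      (∑ t ∈ Finset.Icc 1 T, w t * f t (a t)) +
        (1 - ∑ t ∈ Finset.Icc 1 T, w t) * (1 - a (T + 1))

/-! ### Markov chains -/

/-- The law of the first `T + 1` states of the Markov chain that starts at `x` and moves according to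
`step`. -/
def pathLaw {S : Type*} [MeasurableSpace S] (step : S → Measure S) :
    (T : ℕ) → S → Measure (Fin (T + 1) → S)
  | 0, x => Measure.dirac fun _ => x
  | T + 1, x => (step x).bind fun x' => (pathLaw step T x').map fun y => Fin.cons x y

/-- The law of the next user, for the transition matrix `W` and the present user `k`. -/
def walkStep {n : ℕ} (W : Matrix (Fin n) (Fin n) ℝ) (k : Fin n) : Measure (Fin n) :=
  ∑ l, ENNReal.ofReal (W k l) • Measure.dirac l

/-- The law of the random walk `i_0, …, i_T` whose start has the law `π`. -/
def walkLaw {n : ℕ} (W : Matrix (Fin n) (Fin n) ℝ) (π : Fin n → ℝ) (T : ℕ) :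
    Measure (Fin (T + 1) → Fin n) :=
  ∑ k, ENNReal.ofReal (π k) • pathLaw (walkStep W) T k

/-- Every entry is nonnegative and the rows sum to one. -/
def IsStochastic {n : ℕ} (W : Matrix (Fin n) (Fin n) ℝ) : Prop :=
  (∀ i j, 0 ≤ W i j) ∧ ∀ i, ∑ j, W i j = 1

def IsIrreducibleChain {n : ℕ} (W : Matrix (Fin n) (Fin n) ℝ) : Prop :=
  ∀ i j, ∃ t : ℕ, 0 < t ∧ 0 < (W ^ t) i j

/-- For every `i`, the greatest common divisor of `{t ≥ 1 | (W ^ t) i i > 0}` is one. -/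
def IsAperiodicChain {n : ℕ} (W : Matrix (Fin n) (Fin n) ℝ) : Prop :=
  ∀ (i : Fin n) (d : ℕ), (∀ t : ℕ, 1 ≤ t → 0 < (W ^ t) i i → d ∣ t) → d = 1

def IsStationaryDist {n : ℕ} (W : Matrix (Fin n) (Fin n) ℝ) (π : Fin n → ℝ) : Prop :=
  (∀ i, 0 ≤ π i) ∧ ∑ i, π i = 1 ∧ ∀ j, ∑ i, π i * W i j = π j

/-- The second-largest eigenvalue, with multiplicity, of a symmetric matrix. -/
def lambda2 {n : ℕ} (hn : 2 ≤ n) (W : Matrix (Fin n) (Fin n) ℝ) (hW : W.IsSymm) : ℝ :=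
  Matrix.IsHermitian.eigenvalues₀ (A := W)
    ((Matrix.conjTranspose_eq_transpose_of_trivial W).trans hW)
    ⟨1, by rw [Fintype.card_fin]; omega⟩

/-- The number of times `t ∈ {1, …, T}` with `i_t = j`. -/
def visits {n T : ℕ} (j : Fin n) (y : Fin (T + 1) → Fin n) : ℕ :=
  (Finset.univ.filter fun t : Fin T => y t.succ = j).card

/-- The paths `i_0, …, i_t` that visit `j` at time `t` and at none of the times `1, …, t - 1`. -/
def firstVisit {n : ℕ} (j : Fin n) (t : ℕ) : Set (Fin (t + 1) → Fin n) :=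
  {y | y (Fin.last t) = j ∧ ∀ s : Fin (t + 1), 0 < s → s < Fin.last t → y s ≠ j}

/-- `w_{ij}^t`, the probability that the walk started at `i` hits `j` for the first time at time
`t ≥ 1`. -/
def hitProb {n : ℕ} (W : Matrix (Fin n) (Fin n) ℝ) (i j : Fin n) (t : ℕ) : ℝ :=
  (pathLaw (walkStep W) t i).real (firstVisit j t)

/-! ### Decentralized DP-SGD -/

/-- The space of models. -/
abbrev Model (d : ℕ) : Type := EuclideanSpace ℝ (Fin d)

/-- The parameters of decentralized DP-SGD with `n` users, models in `ℝ^d` and records in `Z`. -/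
structure Params (n d : ℕ) (Z : Type*) where
  /-- the transition matrix -/
  W : Matrix (Fin n) (Fin n) ℝ
  /-- the loss `loss z` of a record `z`, as a function of the model -/
  loss : Z → Model d → ℝ
  /-- the constraint set; the whole space when there is no projection -/
  domain : Set (Model d)
  /-- the stepsize -/
  η : ℝ
  /-- the standard deviation of the noise in each coordinate -/
  σ : ℝ
  /-- the batch size -/
  b : ℕ
  /-- the number of local steps in a round -/
  K : ℕ

/-- A family of local datasets: user `k` holds `m k` records. -/
abbrev Data (n : ℕ) (m : Fin n → ℕ) (Z : Type*) : Type _ := (k : Fin n) → Fin (m k) → Z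

/-- `D ≈_i D'`: the datasets differ in exactly one record, which is held by user `i`. -/
def RecordAdjacent {n : ℕ} {m : Fin n → ℕ} {Z : Type*} (i : Fin n) (D D' : Data n m Z) : Prop :=
  ∃ r : Fin (m i), D i r ≠ D' i r ∧ (∀ r', r' ≠ r → D i r' = D' i r') ∧ ∀ k, k ≠ i → D k = D' k

/-- A nearest point of `C` to `x`. -/
def proj {d : ℕ} (C : Set (Model d)) (x : Model d) : Model d :=
  Classical.epsilon fun y => y ∈ C ∧ ∀ z ∈ C, dist x y ≤ dist x z

variable {n d : ℕ} {Z : Type*} {m : Fin n → ℕ}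

/-- The mini-batch gradient of user `k` at `θ`, for the batch with the indices `B`. -/
def batchGrad (p : Params n d Z) (D : Data n m Z) (k : Fin n) (B : Finset (Fin (m k)))
    (θ : Model d) : Model d :=
  (p.b : ℝ)⁻¹ • ∑ r ∈ B, gradient (p.loss (D k r)) θ

/-- The law of the model after one local step `θ ↦ Π(θ - η (g + Z))` of user `k`, where the batch is
uniform among the `b`-element subsets of the data of user `k` and `Z ~ N(0, σ² I)`. -/
def localStep (p : Params n d Z) (D : Data n m Z) (k : Fin n) (θ : Model d) : Measure (Model d) :=
  ∑ B ∈ (Finset.univ : Finset (Fin (m k))).powersetCard p.b,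
    (((m k).choose p.b : ℕ) : ENNReal)⁻¹ •
      (stdGaussian (Model d)).map fun z =>
        proj p.domain (θ - p.η • (batchGrad p D k B θ + p.σ • z))

/-- The law of the model after the given number of local steps of user `k`. -/
def localRun (p : Params n d Z) (D : Data n m Z) (k : Fin n) : ℕ → Model d → Measure (Model d)
  | 0, θ => Measure.dirac θ
  | K + 1, θ => (localStep p D k θ).bind (localRun p D k K)

/-- One communication round: the active user `x.1` makes `K` local steps from the model `x.2` and
sends the result to a random neighbour, who becomes active. -/
def roundStep (p : Params n d Z) (D : Data n m Z) (x : Fin n × Model d) : Measure (Fin n × Model d) :=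
  (walkStep p.W x.1).prod (localRun p D x.1 p.K x.2)

/-- The law of the run of length `T`: the active users `i_0, …, i_T` together with the models that
they have on becoming active, from a random first user with law `π` and the model `θ₀`. -/
def runLaw (p : Params n d Z) (D : Data n m Z) (π : Fin n → ℝ) (θ₀ : Model d) (T : ℕ) :
    Measure (Fin (T + 1) → Fin n × Model d) :=
  ∑ k, ENNReal.ofReal (π k) • pathLaw (roundStep p D) T (k, θ₀)

/-- What user `j` sees of a run: for each of the times `1, …, T`, the model received at that time, if
the message went to `j`. -/
def received {T : ℕ} (j : Fin n) (y : Fin (T + 1) → Fin n × Model d) : Fin T → Model d ⊕ Unit :=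
  fun t => if (y t.succ).1 = j then Sum.inl (y t.succ).2 else Sum.inr ()

/-- The law of the view `A_j(D)` of user `j`. -/
def viewLaw (p : Params n d Z) (D : Data n m Z) (π : Fin n → ℝ) (θ₀ : Model d) (T : ℕ)
    (j : Fin n) : Measure (Fin T → Model d ⊕ Unit) :=
  (runLaw p D π θ₀ T).map (received j)

open Classical in
/-- The law of the view of user `j` on the event `G` about the random walk: outside `G` the view is
replaced by a fixed symbol. -/
def viewLawOn (p : Params n d Z) (D : Data n m Z) (π : Fin n → ℝ) (θ₀ : Model d) (T : ℕ)
    (j : Fin n) (G : Set (Fin (T + 1) → Fin n)) : Measure ((Fin T → Model d ⊕ Unit) ⊕ Unit) :=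
  (runLaw p D π θ₀ T).map fun y =>
    if (fun t => (y t).1) ∈ G then Sum.inl (received j y) else Sum.inr ()

/-- The law of `A_j^t(D)`: the model received by `j` at time `t`, when user `i` is active at time `0`
with the model `θ`, conditionally on the event that `j` is visited for the first time at `t`. -/
def firstModelLaw (p : Params n d Z) (D : Data n m Z) (i j : Fin n) (t : ℕ) (θ : Model d) :
    Measure (Model d) :=
  (cond (pathLaw (roundStep p D) t (i, θ)) {y | (fun s => (y s).1) ∈ firstVisit j t}).map
    fun y => (y (Fin.last t)).2

/-- The per-visit trade-off function `T(A_j^t(D), A_j^t(D'))` of the mechanism that takes a model `θ`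
to the model first seen by `j`, at time `t`: the greatest trade-off function that is below
`T(A_j^t(D), A_j^t(D'))` whatever model `θ` the user `i` starts from. -/
def perVisit (p : Params n d Z) (D D' : Data n m Z) (i j : Fin n) (t : ℕ) (α : ℝ) : ℝ :=
  sSup {β : ℝ | ∃ h : ℝ → ℝ, IsTradeoff h ∧
    (∀ θ ∈ p.domain, Dominates (tradeoff (firstModelLaw p D i j t θ) (firstModelLaw p D' i j t θ)) h) ∧
    β = h α}

end DecSGD

end

open DecSGD

/-! The proof has two independent halves: adaptive composition over the receipts of `j`, and a
concentration bound for the number of visits to `j`.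

Composition is carried out with the two-parameter divergences `∫ (b q - a p)⁺` instead of trade-off
functions. They are Legendre duals of each other: `T(P, Q)(α)` is the supremum over `s ≥ 0` of `1 -
s α` minus the divergence at `(s, 1)`. So an order between trade-off functions is the reverse order
between divergences (`hockey_le_of_dominates`, `dominates_of_forall_test`). The divergence is the
least constant `c` with `b E_Q φ ≤ a E_P φ + c` for all tests `φ`, it is homogeneous in `(a, b)`,
and it composes: conditioning on one output multiplies `a` and `b` by the densities of that output
(`lintegral_comp_le`, `lintegral_hockey_le_hockey_prod`). The defining equation of the single-visit
function evaluates all components at one threshold `s`, hence at supporting lines of one slope;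
dually, mixing trade-off functions is averaging divergences (`IsSingle.mixture_le_hockeyOf`).

The privacy bound `Params.Regular.viewInt_le` is an induction on the number of receipts that a test
may use, with an inner induction on the horizon. Until the walk reaches user `i`, the run has the
same law for both datasets. From `i`, the run is split at the first passage to `j`: the passage
times have the same probabilities for both datasets, the model received at time `t` is controlled by
the per-visit function from any starting model in the constraint set, and after the receipt the run
restarts at `j` with one receipt fewer. The passages add up to one single-visit divergence, and
composition with the remaining receipts gives one more factor of the product.

The number of visits to `j` is treated by the exponential moment method with the symmetric matrix
`W` tilted at `j`. As a quadratic form, `W` is at most `l + (1 - l) J / n`, with `l` a bound on the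
second eigenvalue and `J` the all-ones matrix. This reduces the norm of the tilted matrix to a
two-state chain whose top eigenvalue is at most `exp (θ / n + (1 + l) / (1 - l) θ² / 8)`, by a
hyperbolic inequality (`cosh_mul_add_le_cosh`). Optimizing `θ` gives `walkLaw_visits_gt_le`.

The halves meet because the number of visits is the number of receipts, so the event on the walk can
be read off the view. A test on the full view becomes a test on the truncated view by never
rejecting at the extra symbol, at the cost of the probability of the complement. -/

open scoped ENNReal

open MeasureTheory ProbabilityTheory

noncomputable section

namespace DecSGD

/-! ### Hockey-stick divergences -/

section HockeyStick

variable {X Y : Type*} [MeasurableSpace X] [MeasurableSpace Y]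

/-- A randomized test: a measurable function with values in `[0,1]`. -/
def IsTest (φ : X → ℝ≥0∞) : Prop := Measurable φ ∧ ∀ x, φ x ≤ 1

/-- The two-parameter hockey-stick divergence `∫ (b q - a p)⁺`. -/
def hockey (P Q : Measure X) (a b : ℝ≥0∞) : ℝ≥0∞ :=
  ∫⁻ x, (b * Q.rnDeriv (P + Q) x - a * P.rnDeriv (P + Q) x) ∂(P + Q)

lemma withDensity_rnDeriv_add_left (P Q : Measure X) [SigmaFinite P] [SigmaFinite Q] :
    (P + Q).withDensity (P.rnDeriv (P + Q)) = P :=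
  Measure.withDensity_rnDeriv_eq _ _ (Measure.absolutelyContinuous_of_le (Measure.le_add_right le_rfl))

lemma withDensity_rnDeriv_add_right (P Q : Measure X) [SigmaFinite P] [SigmaFinite Q] :
    (P + Q).withDensity (Q.rnDeriv (P + Q)) = Q :=
  Measure.withDensity_rnDeriv_eq _ _ (Measure.absolutelyContinuous_of_le (Measure.le_add_left le_rfl))

/-- Pointwise `b q ≤ a p + (b q - a p)⁺`, with truncated subtraction as the positive part, and `φ ≤
1` on the excess. With the next lemma this makes the integral a maximum over tests, for any
dominating measure `μ`. -/
lemma test_le_add_lintegral_tsub (μ : Measure X) {p q : X → ℝ≥0∞} (hp : Measurable p)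
    (hq : Measurable q) {φ : X → ℝ≥0∞} (hφ : IsTest φ) (a b : ℝ≥0∞) :
    b * ∫⁻ x, φ x ∂μ.withDensity q ≤
      a * ∫⁻ x, φ x ∂μ.withDensity p + ∫⁻ x, (b * q x - a * p x) ∂μ := by
  rw [lintegral_withDensity_eq_lintegral_mul _ hq hφ.1,
    lintegral_withDensity_eq_lintegral_mul _ hp hφ.1,
    ← lintegral_const_mul _ (hq.mul hφ.1), ← lintegral_const_mul _ (hp.mul hφ.1),
    ← lintegral_add_left ((hp.mul hφ.1).const_mul a)]
  refine lintegral_mono fun x => ?_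
  calc b * (q x * φ x) = (b * q x) * φ x := by ring
    _ ≤ (a * p x + (b * q x - a * p x)) * φ x := by gcongr; exact le_add_tsub
    _ = a * (p x * φ x) + (b * q x - a * p x) * φ x := by ring
    _ ≤ a * (p x * φ x) + (b * q x - a * p x) * 1 := by gcongr; exact hφ.2 x
    _ = _ := by rw [mul_one]; rfl

/-- The Neyman–Pearson test, which rejects where `a p < b q`, turns the pointwise inequality into an
equality. -/
lemma exists_test_eq_add_lintegral_tsub (μ : Measure X) {p q : X → ℝ≥0∞} (hp : Measurable p)
    (hq : Measurable q) (a b : ℝ≥0∞) :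
    ∃ φ : X → ℝ≥0∞, IsTest φ ∧ b * ∫⁻ x, φ x ∂μ.withDensity q =
      a * ∫⁻ x, φ x ∂μ.withDensity p + ∫⁻ x, (b * q x - a * p x) ∂μ := by
  have hs : MeasurableSet {x | a * p x < b * q x} :=
    measurableSet_lt (hp.const_mul a) (hq.const_mul b)
  have hφ : IsTest (Set.indicator {x | a * p x < b * q x} (1 : X → ℝ≥0∞)) :=
    ⟨measurable_one.indicator hs, fun x => Set.indicator_le_self' (by simp) x⟩
  refine ⟨_, hφ, ?_⟩
  rw [lintegral_withDensity_eq_lintegral_mul _ hq hφ.1,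
    lintegral_withDensity_eq_lintegral_mul _ hp hφ.1,
    ← lintegral_const_mul _ (hq.mul hφ.1), ← lintegral_const_mul _ (hp.mul hφ.1),
    ← lintegral_add_left ((hp.mul hφ.1).const_mul a)]
  refine lintegral_congr fun x => ?_
  by_cases h : a * p x < b * q x
  · simp [h, add_tsub_cancel_of_le h.le]
  · simp [h, tsub_eq_zero_of_le (not_lt.1 h)]

lemma test_le_add_hockey (P Q : Measure X) [SigmaFinite P] [SigmaFinite Q] {φ : X → ℝ≥0∞}
    (hφ : IsTest φ) (a b : ℝ≥0∞) :
    b * ∫⁻ x, φ x ∂Q ≤ a * ∫⁻ x, φ x ∂P + hockey P Q a b := by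
  have := test_le_add_lintegral_tsub (P + Q) (Measure.measurable_rnDeriv P (P + Q))
    (Measure.measurable_rnDeriv Q (P + Q)) hφ a b
  rwa [withDensity_rnDeriv_add_left, withDensity_rnDeriv_add_right] at this

lemma lintegral_test_ne_top (P : Measure X) [IsFiniteMeasure P] {φ : X → ℝ≥0∞} (hφ : IsTest φ) :
    ∫⁻ x, φ x ∂P ≠ ∞ :=
  ((lintegral_mono hφ.2).trans_lt (by simp)).ne

lemma lintegral_test_le_one (P : Measure X) [IsProbabilityMeasure P] {φ : X → ℝ≥0∞}
    (hφ : IsTest φ) : ∫⁻ x, φ x ∂P ≤ 1 :=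
  (lintegral_mono hφ.2).trans (by simp)

lemma lintegral_tsub_le_of_forall_test (μ : Measure X) {p q : X → ℝ≥0∞} (hp : Measurable p)
    (hq : Measurable q) [IsFiniteMeasure (μ.withDensity p)] {a b c : ℝ≥0∞} (ha : a ≠ ∞)
    (h : ∀ φ : X → ℝ≥0∞, IsTest φ →
      b * ∫⁻ x, φ x ∂μ.withDensity q ≤ a * ∫⁻ x, φ x ∂μ.withDensity p + c) :
    ∫⁻ x, (b * q x - a * p x) ∂μ ≤ c := by
  obtain ⟨φ, hφ, he⟩ := exists_test_eq_add_lintegral_tsub μ hp hq a b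
  have := h φ hφ
  rw [he] at this
  exact (ENNReal.add_le_add_iff_left
    (ENNReal.mul_ne_top ha (lintegral_test_ne_top _ hφ))).1 this

/-- Together with `test_le_add_hockey` this describes the divergence by tests alone, and later upper
bounds on divergences are proved through it. Finiteness of `a` permits cancelling the type I term of
the optimal test. -/
lemma hockey_le_of_forall_test (P Q : Measure X) [IsFiniteMeasure P] [IsFiniteMeasure Q]
    {a b c : ℝ≥0∞} (ha : a ≠ ∞)
    (h : ∀ φ : X → ℝ≥0∞, IsTest φ → b * ∫⁻ x, φ x ∂Q ≤ a * ∫⁻ x, φ x ∂P + c) :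
    hockey P Q a b ≤ c := by
  have hP := withDensity_rnDeriv_add_left P Q
  have hQ := withDensity_rnDeriv_add_right P Q
  have : IsFiniteMeasure ((P + Q).withDensity (P.rnDeriv (P + Q))) := by rw [hP]; infer_instance
  refine lintegral_tsub_le_of_forall_test (P + Q) (Measure.measurable_rnDeriv P (P + Q))
    (Measure.measurable_rnDeriv Q (P + Q)) ha ?_
  rwa [hP, hQ]

/-- The reference measure `P + Q` may be replaced by any `μ` with densities, since tests do not see
the reference measure. This is needed for products, whose natural reference is a product measure. -/
lemma lintegral_tsub_le_hockey (μ : Measure X) {p q : X → ℝ≥0∞} (hp : Measurable p)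
    (hq : Measurable q) [IsFiniteMeasure (μ.withDensity p)] [IsFiniteMeasure (μ.withDensity q)]
    {a : ℝ≥0∞} (ha : a ≠ ∞) (b : ℝ≥0∞) :
    ∫⁻ x, (b * q x - a * p x) ∂μ ≤ hockey (μ.withDensity p) (μ.withDensity q) a b :=
  lintegral_tsub_le_of_forall_test μ hp hq ha fun _ hφ => test_le_add_hockey _ _ hφ a b

lemma tsub_le_hockey (P Q : Measure X) [IsProbabilityMeasure P] [IsProbabilityMeasure Q]
    (a b : ℝ≥0∞) : b - a ≤ hockey P Q a b := by
  have := test_le_add_hockey P Q (φ := 1) ⟨measurable_one, fun _ => le_rfl⟩ a b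
  simp only [Pi.one_apply, lintegral_one, measure_univ, mul_one] at this
  exact tsub_le_iff_left.2 this

/-- Data processing: a test on the image pulls back to a test on the source. -/
lemma hockey_map_le (P Q : Measure X) [IsFiniteMeasure P] [IsFiniteMeasure Q] {f : X → Y}
    (hf : Measurable f) {a : ℝ≥0∞} (ha : a ≠ ∞) (b : ℝ≥0∞) :
    hockey (P.map f) (Q.map f) a b ≤ hockey P Q a b := by
  refine hockey_le_of_forall_test _ _ ha fun φ hφ => ?_
  rw [lintegral_map hφ.1 hf, lintegral_map hφ.1 hf]
  exact test_le_add_hockey P Q ⟨hφ.1.comp hf, fun x => hφ.2 _⟩ a b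

lemma hockey_le (P Q : Measure X) [IsFiniteMeasure P] [IsProbabilityMeasure Q]
    {a : ℝ≥0∞} (ha : a ≠ ∞) (b : ℝ≥0∞) : hockey P Q a b ≤ b := by
  refine hockey_le_of_forall_test _ _ ha fun φ hφ => ?_
  calc b * ∫⁻ x, φ x ∂Q ≤ b * 1 := by gcongr; exact lintegral_test_le_one Q hφ
    _ ≤ _ := by rw [mul_one]; exact le_add_self

end HockeyStick

/-! ### Trade-off functions through tests -/

section Tests

variable {X Y : Type*} [MeasurableSpace X] [MeasurableSpace Y]

lemma integral_eq_toReal_lintegral_test (P : Measure X) {φ : X → ℝ} (hm : Measurable φ)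
    (h0 : ∀ x, 0 ≤ φ x) : ∫ x, φ x ∂P = (∫⁻ x, ENNReal.ofReal (φ x) ∂P).toReal :=
  integral_eq_lintegral_of_nonneg_ae (Filter.Eventually.of_forall h0) hm.aestronglyMeasurable

lemma isTest_ofReal {φ : X → ℝ} (hm : Measurable φ) (h1 : ∀ x, φ x ≤ 1) :
    IsTest fun x => ENNReal.ofReal (φ x) :=
  ⟨hm.ennreal_ofReal, fun x => by simpa using h1 x⟩

lemma bddBelow_tradeoff (P Q : Measure X) [IsFiniteMeasure Q] (α : ℝ) :
    BddBelow {β : ℝ | ∃ φ : X → ℝ, Measurable φ ∧ (∀ x, 0 ≤ φ x ∧ φ x ≤ 1) ∧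
      ∫ x, φ x ∂P ≤ α ∧ β = 1 - ∫ x, φ x ∂Q} := by
  refine ⟨1 - Q.real Set.univ, ?_⟩
  rintro _ ⟨φ, hm, h01, -, rfl⟩
  have hi : Integrable φ Q := Integrable.of_bound hm.aestronglyMeasurable 1
    (Filter.Eventually.of_forall fun x => by
      rw [Real.norm_eq_abs, abs_le]; constructor <;> linarith [(h01 x).1, (h01 x).2])
  have : ∫ x, φ x ∂Q ≤ ∫ x, (1 : ℝ) ∂Q :=
    integral_mono hi (integrable_const _) fun x => (h01 x).2
  simp at this
  linarith

lemma tradeoff_le_of_integral (P Q : Measure X) [IsFiniteMeasure Q] {α : ℝ} {φ : X → ℝ}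
    (hm : Measurable φ) (h01 : ∀ x, 0 ≤ φ x ∧ φ x ≤ 1) (h : ∫ x, φ x ∂P ≤ α) :
    tradeoff P Q α ≤ 1 - ∫ x, φ x ∂Q :=
  csInf_le (bddBelow_tradeoff P Q α) ⟨φ, hm, h01, h, rfl⟩

lemma le_tradeoff_of_integral (P Q : Measure X) {α c : ℝ} (hα : 0 ≤ α)
    (h : ∀ φ : X → ℝ, Measurable φ → (∀ x, 0 ≤ φ x ∧ φ x ≤ 1) → ∫ x, φ x ∂P ≤ α →
      c ≤ 1 - ∫ x, φ x ∂Q) : c ≤ tradeoff P Q α := by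
  refine le_csInf ⟨1, fun _ => 0, measurable_const, by simp, by simpa using hα, by simp⟩ ?_
  rintro _ ⟨φ, hm, h01, hφ, rfl⟩
  exact h φ hm h01 hφ

lemma exists_integral_lt_of_tradeoff_lt (P Q : Measure X) {α c : ℝ} (hα : 0 ≤ α)
    (h : tradeoff P Q α < c) :
    ∃ φ : X → ℝ, Measurable φ ∧ (∀ x, 0 ≤ φ x ∧ φ x ≤ 1) ∧ ∫ x, φ x ∂P ≤ α ∧
      1 - ∫ x, φ x ∂Q < c := by
  by_contra! hc
  exact absurd (le_tradeoff_of_integral P Q hα hc) (not_le.2 h)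

lemma IsTest.toReal_mem {φ : X → ℝ≥0∞} (hφ : IsTest φ) (x : X) :
    0 ≤ (φ x).toReal ∧ (φ x).toReal ≤ 1 :=
  ⟨ENNReal.toReal_nonneg, by simpa using ENNReal.toReal_mono ENNReal.one_ne_top (hφ.2 x)⟩

lemma IsTest.ofReal_toReal {φ : X → ℝ≥0∞} (hφ : IsTest φ) (x : X) :
    ENNReal.ofReal (φ x).toReal = φ x :=
  ENNReal.ofReal_toReal ((hφ.2 x).trans_lt ENNReal.one_lt_top).ne

lemma IsTest.integral_toReal (P : Measure X) {φ : X → ℝ≥0∞} (hφ : IsTest φ) :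
    ∫ x, (φ x).toReal ∂P = (∫⁻ x, φ x ∂P).toReal := by
  rw [integral_eq_toReal_lintegral_test P hφ.1.ennreal_toReal fun x => (hφ.toReal_mem x).1]
  simp_rw [hφ.ofReal_toReal]

lemma tradeoff_le_of_test (P Q : Measure X) [IsFiniteMeasure Q] {α : ℝ} {φ : X → ℝ≥0∞}
    (hφ : IsTest φ) (h : (∫⁻ x, φ x ∂P).toReal ≤ α) :
    tradeoff P Q α ≤ 1 - (∫⁻ x, φ x ∂Q).toReal := by
  rw [← hφ.integral_toReal] at h ⊢
  exact tradeoff_le_of_integral P Q hφ.1.ennreal_toReal hφ.toReal_mem h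

lemma le_tradeoff_of_test (P Q : Measure X) {α c : ℝ} (hα : 0 ≤ α)
    (h : ∀ φ : X → ℝ≥0∞, IsTest φ → (∫⁻ x, φ x ∂P).toReal ≤ α →
      c ≤ 1 - (∫⁻ x, φ x ∂Q).toReal) : c ≤ tradeoff P Q α := by
  refine le_tradeoff_of_integral P Q hα fun φ hm h01 hφ => ?_
  rw [integral_eq_toReal_lintegral_test _ hm fun x => (h01 x).1] at hφ ⊢
  exact h _ (isTest_ofReal hm fun x => (h01 x).2) hφ

lemma exists_test_of_tradeoff_lt (P Q : Measure X) {α c : ℝ} (hα : 0 ≤ α)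
    (h : tradeoff P Q α < c) :
    ∃ φ : X → ℝ≥0∞, IsTest φ ∧ (∫⁻ x, φ x ∂P).toReal ≤ α ∧ 1 - (∫⁻ x, φ x ∂Q).toReal < c := by
  by_contra! hc
  exact absurd (le_tradeoff_of_test P Q hα hc) (not_le.2 h)

/-- A lower bound `T(P₀, Q₀) ≤ T(P, Q)` bounds the hockey-stick divergences of `(P, Q)`. -/
lemma hockey_le_of_dominates (P Q : Measure X) [IsProbabilityMeasure P] [IsProbabilityMeasure Q]
    (P₀ Q₀ : Measure Y) [IsProbabilityMeasure P₀] [IsProbabilityMeasure Q₀]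
    (h : Dominates (tradeoff P Q) (tradeoff P₀ Q₀)) {a b : ℝ≥0∞} (ha : a ≠ ∞) (hb : b ≠ ∞) :
    hockey P Q a b ≤ hockey P₀ Q₀ a b := by
  refine hockey_le_of_forall_test P Q ha fun φ hφ => ?_
  set α := (∫⁻ x, φ x ∂P).toReal with hα
  have hPt := lintegral_test_ne_top P hφ
  have hQt := lintegral_test_ne_top Q hφ
  have hα0 : 0 ≤ α := ENNReal.toReal_nonneg
  have hα1 : α ≤ 1 := by
    simpa using ENNReal.toReal_mono ENNReal.one_ne_top (lintegral_test_le_one P hφ)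
  have h1 := (h α ⟨hα0, hα1⟩).trans (tradeoff_le_of_test P Q hφ hα.symm.le)
  refine ENNReal.le_of_forall_pos_le_add fun ε hε _ => ?_
  -- The infimum defining the trade-off function is not known here to be attained, so a test within
  -- `δ` of it is used; `b * δ ≤ ε` absorbs the loss.
  obtain ⟨δ, hδ, hδε⟩ : ∃ δ : NNReal, 0 < δ ∧ b * δ ≤ ε := by
    lift b to NNReal using hb
    refine ⟨ε / (b + 1), by positivity, ?_⟩
    norm_cast
    rw [mul_div_assoc', div_le_iff₀ (by positivity)]
    nlinarith [mul_nonneg hε.le b.2, hε.le]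
  obtain ⟨ψ, hψ, hψP, hψQ⟩ := exists_test_of_tradeoff_lt P₀ Q₀ hα0
    (c := 1 - (∫⁻ x, φ x ∂Q).toReal + δ) (by
      have : (0 : ℝ) < δ := hδ
      linarith)
  have hψPt := lintegral_test_ne_top P₀ hψ
  have hψQt := lintegral_test_ne_top Q₀ hψ
  have h2 : ∫⁻ x, φ x ∂Q ≤ ∫⁻ x, ψ x ∂Q₀ + δ := by
    rw [← ENNReal.toReal_le_toReal hQt (by simp [hψQt]), ENNReal.toReal_add hψQt (by simp)]
    simp only [ENNReal.coe_toReal]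
    linarith
  have h3 : ∫⁻ x, ψ x ∂P₀ ≤ ∫⁻ x, φ x ∂P := (ENNReal.toReal_le_toReal hψPt hPt).1 hψP
  calc b * ∫⁻ x, φ x ∂Q ≤ b * (∫⁻ x, ψ x ∂Q₀ + δ) := by gcongr
    _ = b * ∫⁻ x, ψ x ∂Q₀ + b * δ := by ring
    _ ≤ a * ∫⁻ x, ψ x ∂P₀ + hockey P₀ Q₀ a b + ε := by
      gcongr; exact test_le_add_hockey P₀ Q₀ hψ a b
    _ ≤ _ := by gcongr

end Tests

/-! ### The shape of trade-off functions -/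

/-- The functions on `[0,1]` between `0` and `1 - x` that are suprema of nonincreasing affine
functions; these are the trade-off functions. -/
def TradeoffShape (f : ℝ → ℝ) : Prop :=
  (∀ x ∈ Set.Icc (0 : ℝ) 1, 0 ≤ f x ∧ f x ≤ 1 - x) ∧
  ∀ α ∈ Set.Icc (0 : ℝ) 1, ∀ ε > 0, ∃ s u : ℝ, 0 ≤ s ∧ f α - ε ≤ u - s * α ∧
    ∀ x ∈ Set.Icc (0 : ℝ) 1, u - s * x ≤ f x

section Shape

variable {X : Type*} [MeasurableSpace X]

lemma tradeoff_nonneg (P Q : Measure X) [IsProbabilityMeasure Q] {α : ℝ}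
    (hα : 0 ≤ α) : 0 ≤ tradeoff P Q α := by
  refine le_tradeoff_of_test P Q hα fun φ hφ _ => ?_
  have := ENNReal.toReal_mono ENNReal.one_ne_top (lintegral_test_le_one Q hφ)
  simp at this
  linarith

lemma tradeoff_le_one_sub (P Q : Measure X) [IsProbabilityMeasure P] [IsProbabilityMeasure Q]
    {α : ℝ} (hα : α ∈ Set.Icc (0 : ℝ) 1) : tradeoff P Q α ≤ 1 - α := by
  simpa using tradeoff_le_of_integral P Q (α := α) (φ := fun _ => α) measurable_const
    (fun _ => hα) (by simp)

/-- Near-optimal tests at two levels are mixed with the convex weights. -/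
lemma convexOn_tradeoff (P Q : Measure X) [IsProbabilityMeasure P] [IsProbabilityMeasure Q] :
    ConvexOn ℝ (Set.Icc 0 1) (tradeoff P Q) := by
  refine ⟨convex_Icc 0 1, fun x hx y hy s t hs ht hst => ?_⟩
  simp only [smul_eq_mul]
  refine le_of_forall_pos_le_add fun ε hε => ?_
  obtain ⟨φ, hφm, hφ, hφP, hφQ⟩ := exists_integral_lt_of_tradeoff_lt P Q hx.1
    (c := tradeoff P Q x + ε) (by linarith)
  obtain ⟨ψ, hψm, hψ, hψP, hψQ⟩ := exists_integral_lt_of_tradeoff_lt P Q hy.1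
    (c := tradeoff P Q y + ε) (by linarith)
  have hi : ∀ (ν : Measure X) [IsProbabilityMeasure ν], Integrable φ ν := fun ν _ =>
    Integrable.of_bound hφm.aestronglyMeasurable 1 (Filter.Eventually.of_forall fun x => by
      rw [Real.norm_eq_abs, abs_le]; constructor <;> linarith [(hφ x).1, (hφ x).2])
  have hj : ∀ (ν : Measure X) [IsProbabilityMeasure ν], Integrable ψ ν := fun ν _ =>
    Integrable.of_bound hψm.aestronglyMeasurable 1 (Filter.Eventually.of_forall fun x => by
      rw [Real.norm_eq_abs, abs_le]; constructor <;> linarith [(hψ x).1, (hψ x).2])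
  have hmix : ∀ (ν : Measure X) [IsProbabilityMeasure ν],
      ∫ z, (s * φ z + t * ψ z) ∂ν = s * ∫ z, φ z ∂ν + t * ∫ z, ψ z ∂ν := fun ν _ => by
    rw [integral_add ((hi ν).const_mul s) ((hj ν).const_mul t), integral_const_mul,
      integral_const_mul]
  have := tradeoff_le_of_integral P Q (α := s * x + t * y) (φ := fun z => s * φ z + t * ψ z)
    ((hφm.const_mul s).add (hψm.const_mul t))
    (fun z => ⟨by nlinarith [(hφ z).1, (hψ z).1], by nlinarith [(hφ z).2, (hψ z).2]⟩)
    (by rw [hmix]; nlinarith)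
  rw [hmix] at this
  nlinarith

/-- Convexity alone permits a downward jump immediately to the right of `0`; this lemma excludes it.
As `k → ∞`, the divergence at `(k, 1)` tends to `Q {p = 0}` by dominated convergence, and rejecting
on the `P`-null set `{p = 0}` shows `T(P, Q)(0) ≤ 1 - Q {p = 0}`. So a line of steep enough slope
`-k` is a minorant with nearly the right intercept. -/
lemma exists_tradeoff_zero_lower (P Q : Measure X) [IsProbabilityMeasure P]
    [IsProbabilityMeasure Q] {ε : ℝ} (hε : 0 < ε) :
    ∃ s : ℝ, 0 ≤ s ∧ ∀ x ∈ Set.Icc (0 : ℝ) 1, tradeoff P Q 0 - ε - s * x ≤ tradeoff P Q x := by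
  set p := P.rnDeriv (P + Q)
  set q := Q.rnDeriv (P + Q)
  have hp : Measurable p := Measure.measurable_rnDeriv _ _
  have hq : Measurable q := Measure.measurable_rnDeriv _ _
  have hPd : (P + Q).withDensity p = P := withDensity_rnDeriv_add_left P Q
  have hQd : (P + Q).withDensity q = Q := withDensity_rnDeriv_add_right P Q
  have hqi : ∫⁻ x, q x ∂(P + Q) = 1 := by
    rw [← setLIntegral_univ, ← withDensity_apply _ MeasurableSet.univ, hQd, measure_univ]
  let A : Set X := {x | p x = 0}
  have hA : MeasurableSet A := hp (measurableSet_singleton 0)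
  have hlim : Filter.Tendsto (fun k : ℕ => hockey P Q (k : ℝ≥0∞) 1) Filter.atTop
      (nhds (∫⁻ x, A.indicator q x ∂(P + Q))) := by
    refine tendsto_lintegral_of_dominated_convergence q (fun k => ?_) (fun k => ?_) (by simp [hqi])
      ?_
    · exact ((hq.const_mul _).sub (hp.const_mul _))
    · exact Filter.Eventually.of_forall fun x => by simp [q]
    · have hfin : ∀ᵐ x ∂(P + Q), q x < ∞ := ae_lt_top hq (by simp [hqi])
      filter_upwards [hfin] with x hx
      by_cases hxA : x ∈ A
      · have : p x = 0 := hxA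
        simp only [Set.indicator_of_mem hxA]
        change Filter.Tendsto (fun k : ℕ => 1 * q x - k * p x) _ _
        simp [this]
      · simp only [Set.indicator_of_notMem hxA]
        have hpx : p x ≠ 0 := hxA
        refine tendsto_const_nhds.congr' ?_
        obtain ⟨k, hk⟩ := ENNReal.exists_nat_mul_gt hpx hx.ne
        filter_upwards [Filter.eventually_ge_atTop k] with m hm
        refine (tsub_eq_zero_of_le ?_).symm
        change 1 * q x ≤ m * p x
        rw [one_mul]
        exact hk.le.trans (by gcongr)
  have hQA : ∫⁻ x, A.indicator q x ∂(P + Q) = Q A := by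
    rw [lintegral_indicator hA, ← withDensity_apply _ hA, hQd]
  have hPA : P A = 0 := by
    rw [← hPd, withDensity_apply _ hA]
    exact (setLIntegral_congr_fun hA fun x hx => hx).trans (by simp)
  rw [hQA] at hlim
  have hT0 : tradeoff P Q 0 ≤ 1 - (Q A).toReal := by
    have := tradeoff_le_of_test P Q (α := 0) (φ := A.indicator 1)
      ⟨measurable_one.indicator hA, fun x => Set.indicator_le_self' (by simp) x⟩
      (by simp [lintegral_indicator_one hA, hPA])
    simpa [lintegral_indicator_one hA] using this
  have hev := hlim.eventually_lt_const (u := Q A + ENNReal.ofReal ε)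
    (ENNReal.lt_add_right (measure_ne_top _ _) (by simpa using hε))
  obtain ⟨k, hk⟩ := hev.exists
  refine ⟨k, by positivity, fun x hx => le_tradeoff_of_test P Q hx.1 fun φ hφ hφP => ?_⟩
  have h1 := (test_le_add_hockey P Q hφ k 1).trans (add_le_add_right hk.le _)
  have h2 := ENNReal.toReal_mono (by
    simp [ENNReal.mul_eq_top, lintegral_test_ne_top P hφ]) h1
  rw [one_mul, ENNReal.toReal_add (by simp [ENNReal.mul_eq_top, lintegral_test_ne_top P hφ])
    (by simp), ENNReal.toReal_add (by simp) (by simp), ENNReal.toReal_mul,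
    ENNReal.toReal_ofReal hε.le, ENNReal.toReal_natCast] at h2
  have : (k : ℝ) * (∫⁻ x, φ x ∂P).toReal ≤ k * x := by gcongr
  linarith

lemma tradeoffShape_tradeoff (P Q : Measure X) [IsProbabilityMeasure P]
    [IsProbabilityMeasure Q] : TradeoffShape (tradeoff P Q) := by
  have hbd : ∀ x ∈ Set.Icc (0 : ℝ) 1, 0 ≤ tradeoff P Q x ∧ tradeoff P Q x ≤ 1 - x :=
    fun x hx => ⟨tradeoff_nonneg P Q hx.1, tradeoff_le_one_sub P Q hx⟩
  refine ⟨hbd, fun α hα ε hε => ?_⟩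
  -- At `0` this is the preceding lemma, at `1` the value is the minimum, and inside a convex
  -- function is continuous. A convex lower semicontinuous function is then a supremum of affine
  -- functions.
  have hlsc : LowerSemicontinuousOn (tradeoff P Q) (Set.Icc 0 1) := by
    intro x hx
    rcases eq_or_lt_of_le hx.1 with rfl | h0
    · intro y hy
      obtain ⟨s, hs, h⟩ := exists_tradeoff_zero_lower P Q (ε := (tradeoff P Q 0 - y) / 2)
        (by linarith)
      have hc : Filter.Tendsto (fun x : ℝ => tradeoff P Q 0 - (tradeoff P Q 0 - y) / 2 - s * x)
          (nhdsWithin 0 (Set.Icc 0 1)) (nhds (tradeoff P Q 0 - (tradeoff P Q 0 - y) / 2 - s * 0)) :=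
        (Continuous.tendsto (by fun_prop) 0).mono_left nhdsWithin_le_nhds
      filter_upwards [hc.eventually_const_lt (u := y) (by linarith), self_mem_nhdsWithin]
        with z hz hz1
      exact hz.trans_le (h z hz1)
    rcases eq_or_lt_of_le hx.2 with rfl | h1
    · intro y hy
      filter_upwards [self_mem_nhdsWithin] with z hz
      have := (hbd 1 hx).2
      linarith [(hbd z hz).1]
    · have hc : ContinuousOn (tradeoff P Q) (interior (Set.Icc 0 1)) :=
        (convexOn_tradeoff P Q).continuousOn_interior
      rw [interior_Icc] at hc
      exact ((hc.continuousAt (Ioo_mem_nhds h0 h1)).lowerSemicontinuousAt).lowerSemicontinuousWithinAt _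
  obtain ⟨c, c', hle, he⟩ := ConvexOn.exists_affine_le_of_lt_real hα
    (show tradeoff P Q α - ε < tradeoff P Q α by linarith) isClosed_Icc hlsc
    (convexOn_tradeoff P Q)
  rcases le_or_gt c 0 with hc | hc
  · exact ⟨-c, c', by linarith, by linarith, fun x hx => by linarith [hle x hx]⟩
  -- An increasing minorant is at most its value at `1`, which is at most `0`. Hence `tradeoff P Q α
  -- - ε ≤ 0`, and this constant is a minorant.
  · refine ⟨0, tradeoff P Q α - ε, le_rfl, by simp, fun x hx => ?_⟩
    have h1 := hle 1 ⟨zero_le_one, le_rfl⟩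
    have h2 := (hbd 1 ⟨zero_le_one, le_rfl⟩).2
    have : c * α ≤ c * 1 := by gcongr; exact hα.2
    linarith [(hbd x hx).1]

/-- Legendre duality. A nearly supporting line `u - s x` at `α` says `E_Q φ ≤ s E_P φ + (1 - u)` for
every test, so `1 - u` bounds the divergence at `(s, 1)`. -/
lemma exists_hockey_le_of_tradeoff (P Q : Measure X) [IsProbabilityMeasure P]
    [IsProbabilityMeasure Q] {α : ℝ} (hα : α ∈ Set.Icc (0 : ℝ) 1) {ε : ℝ} (hε : 0 < ε) :
    ∃ s : ℝ, 0 ≤ s ∧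
      tradeoff P Q α ≤ 1 - (hockey P Q (ENNReal.ofReal s) 1).toReal - s * α + ε := by
  obtain ⟨hbd, hsh⟩ := tradeoffShape_tradeoff P Q
  obtain ⟨s, u, hs, h1, h2⟩ := hsh α hα ε hε
  refine ⟨s, hs, ?_⟩
  have hu : u ≤ 1 := by
    have := h2 0 ⟨le_rfl, zero_le_one⟩
    have := (hbd 0 ⟨le_rfl, zero_le_one⟩).2
    linarith
  have : hockey P Q (ENNReal.ofReal s) 1 ≤ ENNReal.ofReal (1 - u) := by
    refine hockey_le_of_forall_test P Q (by simp) fun φ hφ => ?_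
    have hPt := lintegral_test_ne_top P hφ
    have hQt := lintegral_test_ne_top Q hφ
    have hle : (∫⁻ x, φ x ∂P).toReal ∈ Set.Icc (0 : ℝ) 1 := ⟨ENNReal.toReal_nonneg, by
      simpa using ENNReal.toReal_mono ENNReal.one_ne_top (lintegral_test_le_one P hφ)⟩
    have h3 := (h2 _ hle).trans (tradeoff_le_of_test P Q hφ le_rfl)
    rw [one_mul, ← ENNReal.toReal_le_toReal hQt (by simp [ENNReal.mul_eq_top, hPt]),
      ENNReal.toReal_add (by simp [ENNReal.mul_eq_top, hPt]) (by simp), ENNReal.toReal_mul,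
      ENNReal.toReal_ofReal hs, ENNReal.toReal_ofReal (by linarith)]
    linarith
  have := ENNReal.toReal_mono (by simp) this
  rw [ENNReal.toReal_ofReal (by linarith)] at this
  linarith

/-- Bounds on tests by the hockey-stick divergences of `(P₀, Q₀)` give `T(P₀, Q₀) ≤ T(P, Q)`. -/
lemma dominates_of_forall_test {Y : Type*} [MeasurableSpace Y] (P Q : Measure Y)
    [IsFiniteMeasure P] [IsFiniteMeasure Q] (P₀ Q₀ : Measure X)
    [IsProbabilityMeasure P₀] [IsProbabilityMeasure Q₀]
    (h : ∀ φ : Y → ℝ≥0∞, IsTest φ → ∀ a : ℝ≥0∞, a ≠ ∞ →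
      ∫⁻ x, φ x ∂Q ≤ a * ∫⁻ x, φ x ∂P + hockey P₀ Q₀ a 1) :
    Dominates (tradeoff P Q) (tradeoff P₀ Q₀) := by
  refine fun α hα => le_tradeoff_of_test P Q hα.1 fun φ hφ hφP => ?_
  refine le_of_forall_pos_le_add fun ε hε => ?_
  obtain ⟨s, hs, hs'⟩ := exists_hockey_le_of_tradeoff P₀ Q₀ hα hε
  have hPt := lintegral_test_ne_top P hφ
  have hht : hockey P₀ Q₀ (ENNReal.ofReal s) 1 ≠ ∞ :=
    ((hockey_le P₀ Q₀ ENNReal.ofReal_ne_top 1).trans_lt ENNReal.one_lt_top).ne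
  have h1 := ENNReal.toReal_mono (by simp [ENNReal.mul_eq_top, hPt, hht])
    (h φ hφ (ENNReal.ofReal s) (by simp))
  rw [ENNReal.toReal_add (by simp [ENNReal.mul_eq_top, hPt]) hht, ENNReal.toReal_mul,
      ENNReal.toReal_ofReal hs] at h1
  have : s * (∫⁻ x, φ x ∂P).toReal ≤ s * α := by gcongr
  linarith

end Shape

/-! ### Every function of trade-off shape is a trade-off function -/

namespace TradeoffShape

variable {f : ℝ → ℝ}

lemma convexOn (hf : TradeoffShape f) : ConvexOn ℝ (Set.Icc 0 1) f := by
  refine ⟨convex_Icc 0 1, fun x hx y hy s t hs ht hst => ?_⟩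
  have hz := convex_Icc (0 : ℝ) 1 hx hy hs ht hst
  simp only [smul_eq_mul] at hz ⊢
  refine le_of_forall_pos_le_add fun ε hε => ?_
  obtain ⟨c, u, -, h1, h2⟩ := hf.2 _ hz ε hε
  have hx' := h2 x hx
  have hy' := h2 y hy
  have : u = s * u + t * u := by rw [← add_mul, hst, one_mul]
  nlinarith [mul_le_mul_of_nonneg_left hx' hs, mul_le_mul_of_nonneg_left hy' ht]

lemma antitoneOn (hf : TradeoffShape f) : AntitoneOn f (Set.Icc 0 1) := by
  refine fun x hx y hy hxy => le_of_forall_pos_le_add fun ε hε => ?_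
  obtain ⟨s, u, hs, h1, h2⟩ := hf.2 y hy ε hε
  have := h2 x hx
  nlinarith

lemma one_eq_zero (hf : TradeoffShape f) : f 1 = 0 := by
  have := hf.1 1 ⟨zero_le_one, le_rfl⟩
  linarith

/-- At `0` the affine minorants bound from below and monotonicity from above; at `1` the function is
squeezed between `0` and `1 - x`. -/
lemma continuousOn (hf : TradeoffShape f) : ContinuousOn f (Set.Icc 0 1) := by
  intro x hx
  rcases eq_or_lt_of_le hx.1 with rfl | h0
  · rw [ContinuousWithinAt, tendsto_order]
    refine ⟨fun y hy => ?_, fun y hy => ?_⟩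
    · obtain ⟨s, u, hs, h1, h2⟩ := hf.2 0 hx ((f 0 - y) / 2) (by linarith)
      have hc : Filter.Tendsto (fun x : ℝ => u - s * x)
          (nhdsWithin 0 (Set.Icc 0 1)) (nhds (u - s * 0)) :=
        (Continuous.tendsto (by fun_prop) 0).mono_left nhdsWithin_le_nhds
      filter_upwards [hc.eventually_const_lt (u := y) (by linarith), self_mem_nhdsWithin]
        with z hz hz1
      exact hz.trans_le (h2 z hz1)
    · filter_upwards [self_mem_nhdsWithin] with z hz
      exact (hf.antitoneOn hx hz hz.1).trans_lt hy
  rcases eq_or_lt_of_le hx.2 with rfl | h1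
  · rw [ContinuousWithinAt, hf.one_eq_zero]
    have hc : Filter.Tendsto (fun x : ℝ => 1 - x) (nhdsWithin 1 (Set.Icc 0 1)) (nhds (1 - 1)) :=
        (Continuous.tendsto (by fun_prop) 1).mono_left nhdsWithin_le_nhds
    rw [sub_self] at hc
    refine tendsto_of_tendsto_of_tendsto_of_le_of_le' tendsto_const_nhds hc ?_ ?_ <;>
      filter_upwards [self_mem_nhdsWithin] with z hz
    exacts [(hf.1 z hz).1, (hf.1 z hz).2]
  · have hc : ContinuousOn f (interior (Set.Icc 0 1)) := hf.convexOn.continuousOn_interior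
    rw [interior_Icc] at hc
    exact (hc.continuousAt (Ioo_mem_nhds h0 h1)).continuousWithinAt

/-- The density of the alternative in the canonical representation. -/
def slopeDensity (f : ℝ → ℝ) (x : ℝ) : ℝ := -derivWithin f (Set.Ioi x) x

lemma hasDerivWithinAt (hf : TradeoffShape f) {x : ℝ} (hx : x ∈ Set.Ioo (0 : ℝ) 1) :
    HasDerivWithinAt (fun y => -f y) (slopeDensity f x) (Set.Ioi x) x :=
  (hf.convexOn.hasDerivWithinAt_rightDeriv_of_mem_interior (by rwa [interior_Icc])).neg

lemma slopeDensity_antitoneOn (hf : TradeoffShape f) :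
    AntitoneOn (slopeDensity f) (Set.Ioo 0 1) := by
  have := hf.convexOn.monotoneOn_rightDeriv
  rw [interior_Icc] at this
  exact fun x hx y hy hxy => neg_le_neg (this hx hy hxy)

lemma slopeDensity_nonneg (hf : TradeoffShape f) {x : ℝ} (hx : x ∈ Set.Ioo (0 : ℝ) 1) :
    0 ≤ slopeDensity f x := by
  have h := hf.convexOn.rightDeriv_le_slope_of_mem_interior (x := x) (y := 1)
    (by rwa [interior_Icc]) ⟨zero_le_one, le_rfl⟩ hx.2
  have h1 := (hf.1 x ⟨hx.1.le, hx.2.le⟩).1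
  have h2 : slope f x 1 ≤ 0 := by
    rw [slope_def_field, hf.one_eq_zero]
    exact div_nonpos_of_nonpos_of_nonneg (by linarith) (by linarith [hx.2])
  unfold slopeDensity
  linarith

lemma integrableOn_slopeDensity (hf : TradeoffShape f) :
    IntegrableOn (slopeDensity f) (Set.Ioc 0 1) :=
  intervalIntegral.integrableOn_deriv_right_of_nonneg hf.continuousOn.neg
    (fun _ hx => hf.hasDerivWithinAt hx) fun _ hx => hf.slopeDensity_nonneg hx

lemma integral_slopeDensity (hf : TradeoffShape f) {α : ℝ} (hα : α ∈ Set.Icc (0 : ℝ) 1) :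
    ∫ x in Set.Ioc 0 α, slopeDensity f x = f 0 - f α := by
  rw [← intervalIntegral.integral_of_le hα.1,
    intervalIntegral.integral_eq_sub_of_hasDeriv_right (f := fun y => -f y)]
  · ring
  · rw [Set.uIcc_of_le hα.1]
    exact hf.continuousOn.neg.mono (Set.Icc_subset_Icc_right hα.2)
  · rw [min_eq_left hα.1, max_eq_right hα.1]
    exact fun x hx => hf.hasDerivWithinAt ⟨hx.1, hx.2.trans_le hα.2⟩
  · rw [intervalIntegrable_iff_integrableOn_Ioc_of_le hα.1]
    exact hf.integrableOn_slopeDensity.mono_set (Set.Ioc_subset_Ioc_right hα.2)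

/-- The null hypothesis of the canonical representation. -/
def canonicalNull : Measure ℝ := volume.restrict (Set.Ioc 0 1)

/-- The alternative of the canonical representation. -/
def canonicalAlt (f : ℝ → ℝ) : Measure ℝ :=
  canonicalNull.withDensity (fun x => ENNReal.ofReal (slopeDensity f x)) +
    ENNReal.ofReal (1 - f 0) • Measure.dirac 2

instance : IsProbabilityMeasure canonicalNull := ⟨by simp [canonicalNull]⟩

lemma ae_canonicalNull : ∀ᵐ x ∂canonicalNull, x ∈ Set.Ioo (0 : ℝ) 1 := by
  rw [canonicalNull, ← restrict_Ioo_eq_restrict_Ioc]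
  exact ae_restrict_mem measurableSet_Ioo

lemma aemeasurable_slopeDensity (hf : TradeoffShape f) :
    AEMeasurable (slopeDensity f) canonicalNull :=
  hf.integrableOn_slopeDensity.aemeasurable

lemma integral_canonicalAlt (hf : TradeoffShape f) {φ : ℝ → ℝ} (hm : Measurable φ)
    (h01 : ∀ x, 0 ≤ φ x ∧ φ x ≤ 1) :
    Integrable (fun x => slopeDensity f x * φ x) canonicalNull ∧
    ∫ x, φ x ∂canonicalAlt f =
      ∫ x, slopeDensity f x * φ x ∂canonicalNull + (1 - f 0) * φ 2 := by
  have h0 := (hf.1 0 ⟨le_rfl, zero_le_one⟩).2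
  have hgi : Integrable (slopeDensity f) canonicalNull := hf.integrableOn_slopeDensity
  have hnn : ∀ᵐ x ∂canonicalNull, 0 ≤ slopeDensity f x := by
    filter_upwards [ae_canonicalNull] with x hx using hf.slopeDensity_nonneg hx
  have hb : ∀ x, ‖φ x‖ ≤ 1 := fun x => by
    rw [Real.norm_eq_abs, abs_le]; constructor <;> linarith [(h01 x).1, (h01 x).2]
  have hi : Integrable (fun x => slopeDensity f x * φ x) canonicalNull :=
    hgi.mul_bdd hm.aestronglyMeasurable (Filter.Eventually.of_forall hb)
  have hfin : IsFiniteMeasure (canonicalNull.withDensity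
      (fun x => ENNReal.ofReal (slopeDensity f x))) :=
    isFiniteMeasure_withDensity_ofReal hgi.2
  refine ⟨hi, ?_⟩
  rw [canonicalAlt, integral_add_measure (Integrable.of_bound hm.aestronglyMeasurable 1
      (Filter.Eventually.of_forall hb)) (Integrable.smul_measure (Integrable.of_bound hm.aestronglyMeasurable 1
      (Filter.Eventually.of_forall hb)) (by simp)), integral_smul_measure, integral_dirac,
    integral_withDensity_eq_integral_toReal_smul₀ hf.aemeasurable_slopeDensity.ennreal_ofReal
      (by simp), ENNReal.toReal_ofReal (by linarith), smul_eq_mul]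
  congr 1
  refine integral_congr_ae ?_
  filter_upwards [hnn] with x hx
  rw [ENNReal.toReal_ofReal hx, smul_eq_mul]

/-- The density has mass `f 0 - f 1 = f 0`, by the fundamental theorem for right derivatives; the
atom supplies the missing `1 - f 0`. -/
lemma isProbabilityMeasure_canonicalAlt (hf : TradeoffShape f) :
    IsProbabilityMeasure (canonicalAlt f) := by
  have h0 := (hf.1 0 ⟨le_rfl, zero_le_one⟩)
  have hnn : ∀ᵐ x ∂canonicalNull, 0 ≤ slopeDensity f x := by
    filter_upwards [ae_canonicalNull] with x hx using hf.slopeDensity_nonneg hx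
  have h := hf.integral_slopeDensity (α := 1) ⟨zero_le_one, le_rfl⟩
  rw [hf.one_eq_zero, sub_zero] at h
  constructor
  rw [canonicalAlt, Measure.add_apply, withDensity_apply _ MeasurableSet.univ,
    Measure.restrict_univ, ← ofReal_integral_eq_lintegral_ofReal
      (μ := canonicalNull) hf.integrableOn_slopeDensity hnn, canonicalNull, h]
  simp only [Measure.smul_apply, measure_univ, smul_eq_mul, mul_one]
  rw [← ENNReal.ofReal_add h0.1 (by linarith)]
  simp

/-- The likelihood ratio `-f'` is nonincreasing, so the best test of level `α` rejects on `(0, α]`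
and on the atom. Its power is `(f 0 - f α) + (1 - f 0) = 1 - f α`. -/
lemma tradeoff_canonical (hf : TradeoffShape f) {α : ℝ} (hα : α ∈ Set.Icc (0 : ℝ) 1) :
    tradeoff canonicalNull (canonicalAlt f) α = f α := by
  have hprob := hf.isProbabilityMeasure_canonicalAlt
  have h0 := (hf.1 0 ⟨le_rfl, zero_le_one⟩)
  have hsub : Set.Ioc (0 : ℝ) α ∩ Set.Ioc 0 1 = Set.Ioc 0 α :=
    Set.inter_eq_left.2 (Set.Ioc_subset_Ioc_right hα.2)
  have hgi : Integrable (slopeDensity f) canonicalNull := hf.integrableOn_slopeDensity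
  have hgα : ∫ x, (Set.Ioc 0 α).indicator (slopeDensity f) x ∂canonicalNull = f 0 - f α := by
    rw [integral_indicator measurableSet_Ioc, canonicalNull,
      Measure.restrict_restrict measurableSet_Ioc, hsub, hf.integral_slopeDensity hα]
  apply le_antisymm
  -- The atom `2` lies outside `(0, 1]`, so including it does not affect the type I error.
  · have hm : Measurable ((Set.Ioc 0 α ∪ {2}).indicator (1 : ℝ → ℝ)) :=
      measurable_one.indicator (measurableSet_Ioc.union (measurableSet_singleton 2))
    have h01 : ∀ x, 0 ≤ (Set.Ioc 0 α ∪ {2}).indicator (1 : ℝ → ℝ) x ∧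
        (Set.Ioc 0 α ∪ {2}).indicator (1 : ℝ → ℝ) x ≤ 1 := fun x =>
      ⟨Set.indicator_nonneg (by simp) x, Set.indicator_le_self' (by simp) x⟩
    have h := tradeoff_le_of_integral canonicalNull (canonicalAlt f) (α := α) hm h01 ?_
    · rw [(hf.integral_canonicalAlt hm h01).2] at h
      have : ∫ x, slopeDensity f x * (Set.Ioc 0 α ∪ {2}).indicator (1 : ℝ → ℝ) x ∂canonicalNull
          = f 0 - f α := by
        rw [← hgα]
        refine integral_congr_ae ?_
        filter_upwards [ae_canonicalNull] with x hx
        have h2 : x ≠ 2 := by have := hx.2; intro h; linarith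
        by_cases hxα : x ∈ Set.Ioc 0 α
        · simp [hxα]
        · rw [Set.indicator_of_notMem hxα, Set.indicator_of_notMem (by simp [h2]; simpa using hxα),
            mul_zero]
      rw [this] at h
      simp at h
      linarith
    · rw [integral_indicator_one (measurableSet_Ioc.union (measurableSet_singleton 2))]
      have h2 : (Set.Ioc (0 : ℝ) α ∪ {2}) ∩ Set.Ioc 0 1 = Set.Ioc 0 α := by
        rw [Set.union_inter_distrib_right, hsub]
        have : ({2} : Set ℝ) ∩ Set.Ioc 0 1 = ∅ := by
          ext x
          simp only [Set.mem_inter_iff, Set.mem_singleton_iff, Set.mem_Ioc, Set.mem_empty_iff_false,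
            iff_false]
          rintro ⟨rfl, h⟩
          linarith [h.2]
        rw [this, Set.union_empty]
      rw [canonicalNull, measureReal_restrict_apply
        (measurableSet_Ioc.union (measurableSet_singleton 2)), h2]
      simp [hα.1]
  · refine le_tradeoff_of_integral _ _ hα.1 fun φ hm h01 hφα => ?_
    obtain ⟨hi, he⟩ := hf.integral_canonicalAlt hm h01
    have hint : Integrable φ canonicalNull :=
      Integrable.of_bound hm.aestronglyMeasurable 1 (Filter.Eventually.of_forall fun x => by
        rw [Real.norm_eq_abs, abs_le]; constructor <;> linarith [(h01 x).1, (h01 x).2])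
    have key : ∫ x, slopeDensity f x * φ x ∂canonicalNull ≤ f 0 - f α := by
      -- The end points are treated apart because sign and monotonicity of the density are available
      -- only in the open interval.
      rcases eq_or_lt_of_le hα.1 with rfl | hα0
      · have hz : ∫ x, φ x ∂canonicalNull = 0 :=
          le_antisymm hφα (integral_nonneg fun x => (h01 x).1)
        rw [integral_eq_zero_iff_of_nonneg (fun x => (h01 x).1) hint] at hz
        rw [sub_self, integral_congr_ae (g := fun _ => (0 : ℝ))]
        · simp
        · filter_upwards [hz] with x hx
          simp [hx]
      rcases eq_or_lt_of_le hα.2 with rfl | hα1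
      · rw [← hgα]
        refine integral_mono_ae hi (hgi.indicator measurableSet_Ioc) ?_
        filter_upwards [ae_canonicalNull] with x hx
        rw [Set.indicator_of_mem (show x ∈ Set.Ioc (0 : ℝ) 1 from ⟨hx.1, hx.2.le⟩)]
        have := hf.slopeDensity_nonneg hx
        nlinarith [(h01 x).2]
      · have hgα0 := hf.slopeDensity_nonneg ⟨hα0, hα1⟩
        have hint1 : Integrable ((Set.Ioc 0 α).indicator (1 : ℝ → ℝ)) canonicalNull :=
          (integrable_const (1 : ℝ)).indicator measurableSet_Ioc
        have hmass : ∫ x, (Set.Ioc 0 α).indicator (1 : ℝ → ℝ) x ∂canonicalNull = α := by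
          rw [integral_indicator_one measurableSet_Ioc, canonicalNull,
            measureReal_restrict_apply measurableSet_Ioc, hsub]
          simp [hα.1]
        -- Neyman–Pearson: replacing `φ` by the indicator of `(0, α]` gains pointwise, since
        -- `slopeDensity f x - slopeDensity f α` is nonnegative before `α` and nonpositive after.
        -- The correction term integrates to `slopeDensity f α * (∫ φ - α) ≤ 0`.
        have hle : ∫ x, slopeDensity f x * φ x ∂canonicalNull ≤
            ∫ x, ((Set.Ioc 0 α).indicator (slopeDensity f) x +
              slopeDensity f α * (φ x - (Set.Ioc 0 α).indicator 1 x)) ∂canonicalNull := by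
          refine integral_mono_ae hi ((hgi.indicator measurableSet_Ioc).add
            ((hint.sub hint1).const_mul _)) ?_
          filter_upwards [ae_canonicalNull] with x hx
          by_cases hxα : x ≤ α
          · have hmem : x ∈ Set.Ioc 0 α := ⟨hx.1, hxα⟩
            simp only [Set.indicator_of_mem hmem, Pi.one_apply]
            have := hf.slopeDensity_antitoneOn hx ⟨hα0, hα1⟩ hxα
            nlinarith [(h01 x).2]
          · have hmem : x ∉ Set.Ioc 0 α := fun h => hxα h.2
            simp only [Set.indicator_of_notMem hmem]
            have := hf.slopeDensity_antitoneOn ⟨hα0, hα1⟩ hx (not_le.1 hxα).le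
            nlinarith [(h01 x).1]
        have hsubi : Integrable (fun x => slopeDensity f α *
            (φ x - (Set.Ioc 0 α).indicator (1 : ℝ → ℝ) x)) canonicalNull :=
          (hint.sub hint1).const_mul _
        rw [integral_add (hgi.indicator measurableSet_Ioc) hsubi, integral_const_mul, integral_sub hint hint1, hmass, hgα] at hle
        nlinarith
    rw [he]
    nlinarith [(h01 2).2]

lemma represents_canonical (hf : TradeoffShape f) :
    Represents canonicalNull (canonicalAlt f) f :=
  ⟨inferInstance, hf.isProbabilityMeasure_canonicalAlt, fun _ hα => (hf.tradeoff_canonical hα).symm⟩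

lemma isTradeoff (hf : TradeoffShape f) : IsTradeoff f :=
  ⟨ℝ, inferInstance, _, _, hf.represents_canonical⟩

end TradeoffShape

lemma IsTradeoff.shape {f : ℝ → ℝ} (hf : IsTradeoff f) : TradeoffShape f := by
  obtain ⟨X, _, P, Q, hP, hQ, h⟩ := hf
  obtain ⟨h1, h2⟩ := tradeoffShape_tradeoff P Q
  refine ⟨fun x hx => by rw [h x hx]; exact h1 x hx, fun α hα ε hε => ?_⟩
  obtain ⟨s, u, hs, h3, h4⟩ := h2 α hα ε hε
  exact ⟨s, u, hs, by rwa [h α hα], fun x hx => by rw [h x hx]; exact h4 x hx⟩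

lemma isTradeoff_zero : IsTradeoff 0 :=
  TradeoffShape.isTradeoff ⟨fun x hx => ⟨le_rfl, by simpa using hx.2⟩,
    fun α _ ε hε => ⟨0, 0, le_rfl, by simpa using hε.le, fun x _ => by simp⟩⟩

/-- The upper envelope of a nonempty family of trade-off functions is a trade-off function. -/
lemma isTradeoff_sSup {C : (ℝ → ℝ) → Prop} (hC : ∃ h, IsTradeoff h ∧ C h) :
    IsTradeoff fun α => sSup {β : ℝ | ∃ h : ℝ → ℝ, IsTradeoff h ∧ C h ∧ β = h α} := by
  obtain ⟨h₀, hh₀, hC₀⟩ := hC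
  have hbdd : ∀ x ∈ Set.Icc (0 : ℝ) 1,
      BddAbove {β : ℝ | ∃ h : ℝ → ℝ, IsTradeoff h ∧ C h ∧ β = h x} := fun x hx =>
    ⟨1 - x, by rintro _ ⟨h, hh, -, rfl⟩; exact (hh.shape.1 x hx).2⟩
  have hle : ∀ h, IsTradeoff h → C h → ∀ x ∈ Set.Icc (0 : ℝ) 1,
      h x ≤ sSup {β : ℝ | ∃ h : ℝ → ℝ, IsTradeoff h ∧ C h ∧ β = h x} := fun h hh hCh x hx =>
    le_csSup (hbdd x hx) ⟨h, hh, hCh, rfl⟩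
  refine TradeoffShape.isTradeoff ⟨fun x hx => ⟨?_, ?_⟩, fun α hα ε hε => ?_⟩
  · exact (hh₀.shape.1 x hx).1.trans (hle h₀ hh₀ hC₀ x hx)
  · refine csSup_le ⟨_, h₀, hh₀, hC₀, rfl⟩ ?_
    rintro _ ⟨h, hh, -, rfl⟩
    exact (hh.shape.1 x hx).2
  · obtain ⟨_, ⟨h, hh, hCh, rfl⟩, hlt⟩ := exists_lt_of_lt_csSup
      (⟨_, h₀, hh₀, hC₀, rfl⟩ : {β : ℝ | ∃ h : ℝ → ℝ, IsTradeoff h ∧ C h ∧ β = h α}.Nonempty)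
      (show sSup {β : ℝ | ∃ h : ℝ → ℝ, IsTradeoff h ∧ C h ∧ β = h α} - ε / 2 < _ by linarith)
    obtain ⟨s, u, hs, h3, h4⟩ := hh.shape.2 α hα (ε / 2) (by linarith)
    exact ⟨s, u, hs, by linarith, fun x hx => (h4 x hx).trans (hle h hh hCh x hx)⟩

/-! ### The likelihood-ratio test -/

/-- The likelihood-ratio test with threshold `s` attains the trade-off function. -/
lemma tradeoff_likelihoodRatio {X : Type*} [MeasurableSpace X] (P Q : Measure X)
    [IsProbabilityMeasure P] [IsProbabilityMeasure Q] {s : ℝ} (hs : 0 ≤ s) :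
    tradeoff P Q (P.real {x | ENNReal.ofReal s < Q.rnDeriv P x}) +
      s * P.real {x | ENNReal.ofReal s < Q.rnDeriv P x} =
      1 - (hockey P Q (ENNReal.ofReal s) 1).toReal := by
  set A := {x | ENNReal.ofReal s < Q.rnDeriv P x}
  have hA : MeasurableSet A := measurableSet_lt measurable_const (Measure.measurable_rnDeriv Q P)
  have hht : hockey P Q (ENNReal.ofReal s) 1 ≠ ∞ :=
    ((hockey_le P Q ENNReal.ofReal_ne_top 1).trans_lt ENNReal.one_lt_top).ne
  apply le_antisymm
  swap
  · rw [← sub_le_iff_le_add]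
    refine le_tradeoff_of_test P Q measureReal_nonneg fun φ hφ hφP => ?_
    have hPt := lintegral_test_ne_top P hφ
    have h1 := ENNReal.toReal_mono (by simp [ENNReal.mul_eq_top, hPt, hht])
      (test_le_add_hockey P Q hφ (ENNReal.ofReal s) 1)
    rw [one_mul, ENNReal.toReal_add (by simp [ENNReal.mul_eq_top, hPt]) hht, ENNReal.toReal_mul,
        ENNReal.toReal_ofReal hs] at h1
    have := mul_le_mul_of_nonneg_left hφP hs
    linarith
  · obtain ⟨B, hB, hPB, hQB⟩ := Measure.mutuallySingular_singularPart Q P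
    set r := Q.rnDeriv P
    have hr : Measurable r := Measure.measurable_rnDeriv Q P
    set σ := ENNReal.ofReal s
    -- `Q.rnDeriv P` sees only the absolutely continuous part of `Q`. Adding the `P`-null set `Bᶜ`,
    -- which carries the whole singular part, makes the test optimal without changing its type I
    -- error.
    set S := A ∪ Bᶜ
    have hS : MeasurableSet S := hA.union hB.compl
    have hPS : P S = P A :=
      le_antisymm ((measure_union_le _ _).trans (by rw [hQB, add_zero]))
        (measure_mono Set.subset_union_left)
    have hQ : ∀ φ : X → ℝ≥0∞, Measurable φ →
        ∫⁻ x, φ x ∂Q = ∫⁻ x, φ x ∂Q.singularPart P + ∫⁻ x, r x * φ x ∂P := fun φ hφ => by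
      conv_lhs => rw [Measure.haveLebesgueDecomposition_add Q P]
      rw [lintegral_add_measure, lintegral_withDensity_eq_lintegral_mul _ hr hφ]
      rfl
    have hQS : Q.singularPart P Set.univ + ∫⁻ x, r x * A.indicator 1 x ∂P ≤ Q S := by
      rw [← lintegral_indicator_one hS, hQ _ (measurable_one.indicator hS)]
      gcongr
      · rw [lintegral_indicator_one hS, ← Set.union_compl_self B]
        refine (measure_union_le _ _).trans ?_
        rw [hPB, zero_add]
        exact measure_mono Set.subset_union_right
      · exact Set.subset_union_left
    have hle : ∀ φ : X → ℝ≥0∞, IsTest φ →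
        ∫⁻ x, φ x ∂Q + σ * P A ≤ σ * ∫⁻ x, φ x ∂P + Q S := fun φ hφ => by
      refine le_trans ?_ (add_le_add_right hQS _)
      have h1A : Measurable (A.indicator (1 : X → ℝ≥0∞)) := measurable_one.indicator hA
      suffices hsuff : ∫⁻ x, r x * φ x ∂P + σ * P A ≤
          σ * ∫⁻ x, φ x ∂P + ∫⁻ x, r x * A.indicator 1 x ∂P by
        rw [hQ φ hφ.1, add_assoc, add_left_comm (σ * _)]
        exact add_le_add ((lintegral_mono hφ.2).trans (by simp)) hsuff
      rw [← lintegral_indicator_one hA, ← lintegral_const_mul _ h1A,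
        ← lintegral_const_mul _ hφ.1, ← lintegral_add_left (f := fun x => r x * φ x) (hr.mul hφ.1),
        ← lintegral_add_left (hφ.1.const_mul σ)]
      refine lintegral_mono fun x => ?_
      by_cases hx : x ∈ A
      · have hx' : σ < r x := hx
        simp only [Set.indicator_of_mem hx, Pi.one_apply, mul_one]
        calc r x * φ x + σ = (σ + (r x - σ)) * φ x + σ := by rw [add_tsub_cancel_of_le hx'.le]
          _ = σ * φ x + ((r x - σ) * φ x + σ) := by ring
          _ ≤ σ * φ x + ((r x - σ) * 1 + σ) := by gcongr; exact hφ.2 x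
          _ = σ * φ x + r x := by rw [mul_one, tsub_add_cancel_of_le hx'.le]
      · have hx' : r x ≤ σ := not_lt.1 hx
        simp only [Set.indicator_of_notMem hx, mul_zero, add_zero]
        gcongr
    have hAS : σ * P A ≤ Q S := by simpa using hle 0 ⟨measurable_zero, by simp⟩
    have hhk : hockey P Q σ 1 ≤ Q S - σ * P A := by
      refine hockey_le_of_forall_test P Q ENNReal.ofReal_ne_top fun φ hφ => ?_
      rw [one_mul, ← ENNReal.add_le_add_iff_right
        (ENNReal.mul_ne_top ENNReal.ofReal_ne_top (measure_ne_top P A)), add_assoc,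
        tsub_add_cancel_of_le hAS]
      exact hle φ hφ
    have h2 := ENNReal.toReal_mono (by simp) hhk
    rw [ENNReal.toReal_sub_of_le hAS (by simp), ENNReal.toReal_mul, ENNReal.toReal_ofReal hs] at h2
    have h1 := tradeoff_le_of_test P Q (α := P.real A) (φ := S.indicator 1)
      ⟨measurable_one.indicator hS, fun x => Set.indicator_le_self' (by simp) x⟩
      (by rw [lintegral_indicator_one hS, hPS]; rfl)
    rw [lintegral_indicator_one hS] at h1
    have : (P A).toReal = P.real A := rfl
    rw [this] at h2
    linarith

/-- Divergences depend on a pair only through its trade-off function, which makes `hockeyOf`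
independent of the canonical choice. -/
lemma hockey_eq_of_represents {X Y : Type} [MeasurableSpace X] [MeasurableSpace Y]
    {P Q : Measure X} {P' Q' : Measure Y} {f : ℝ → ℝ} (h : Represents P Q f)
    (h' : Represents P' Q' f) {a b : ℝ≥0∞} (ha : a ≠ ∞) (hb : b ≠ ∞) :
    hockey P Q a b = hockey P' Q' a b := by
  obtain ⟨hP, hQ, h⟩ := h
  obtain ⟨hP', hQ', h'⟩ := h'
  apply le_antisymm
  · exact hockey_le_of_dominates P Q P' Q' (fun α hα => by rw [← h α hα, ← h' α hα]) ha hb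
  · exact hockey_le_of_dominates P' Q' P Q (fun α hα => by rw [← h α hα, ← h' α hα]) ha hb

/-- The hockey-stick divergence of a trade-off function. -/
def hockeyOf (f : ℝ → ℝ) (a b : ℝ≥0∞) : ℝ≥0∞ :=
  hockey TradeoffShape.canonicalNull (TradeoffShape.canonicalAlt f) a b

lemma hockey_eq_hockeyOf {X : Type} [MeasurableSpace X] {P Q : Measure X} {f : ℝ → ℝ}
    (h : Represents P Q f) {a b : ℝ≥0∞} (ha : a ≠ ∞) (hb : b ≠ ∞) :
    hockey P Q a b = hockeyOf f a b :=
  hockey_eq_of_represents h (IsTradeoff.shape ⟨X, _, P, Q, h⟩).represents_canonical ha hb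

lemma measurable_hockey {X : Type*} [MeasurableSpace X] (P Q : Measure X) [IsFiniteMeasure P]
    [IsFiniteMeasure Q] : Measurable fun c : ℝ≥0∞ × ℝ≥0∞ => hockey P Q c.1 c.2 := by
  refine Measurable.lintegral_prod_right' (ν := P + Q) (f := fun z : (ℝ≥0∞ × ℝ≥0∞) × X =>
    z.1.2 * Q.rnDeriv (P + Q) z.2 - z.1.1 * P.rnDeriv (P + Q) z.2) ?_
  have h1 := (Measure.measurable_rnDeriv P (P + Q))
  have h2 := (Measure.measurable_rnDeriv Q (P + Q))
  fun_prop

lemma IsTypeIError.mem_Icc {f : ℝ → ℝ} {s a : ℝ} (h : IsTypeIError f s a) :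
    a ∈ Set.Icc (0 : ℝ) 1 := by
  obtain ⟨X, _, P, Q, ⟨hP, hQ, -⟩, rfl⟩ := h
  exact ⟨measureReal_nonneg, measureReal_le_one⟩

/-- The intercept of the supporting line of slope `-s` is expressed by `f` alone, whichever pair
supplies the type I error `a`. -/
lemma IsTypeIError.add_eq {f : ℝ → ℝ} {s a : ℝ} (hs : 0 ≤ s) (h : IsTypeIError f s a) :
    f a + s * a = 1 - (hockeyOf f (ENNReal.ofReal s) 1).toReal := by
  have ha := h.mem_Icc
  obtain ⟨X, _, P, Q, hr, rfl⟩ := h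
  rw [← hockey_eq_hockeyOf hr ENNReal.ofReal_ne_top ENNReal.one_ne_top]
  obtain ⟨hP, hQ, h⟩ := hr
  rw [h _ ha]
  exact tradeoff_likelihoodRatio P Q hs

lemma IsTradeoff.exists_isTypeIError {f : ℝ → ℝ} (hf : IsTradeoff f) (s : ℝ) :
    ∃ a, IsTypeIError f s a := by
  obtain ⟨X, _, P, Q, h⟩ := hf
  exact ⟨_, X, _, P, Q, h, rfl⟩

/-! ### Mixtures of trade-off functions -/

/-- Homogeneity reduces the pair `(a, b)` to the single threshold `a / b`. -/
lemma hockey_mul {X : Type*} [MeasurableSpace X] (P Q : Measure X) {c : ℝ≥0∞} (hc : c ≠ ∞)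
    (a b : ℝ≥0∞) : hockey P Q (c * a) (c * b) = c * hockey P Q a b := by
  rw [hockey, hockey, ← lintegral_const_mul' _ _ hc]
  refine lintegral_congr fun x => ?_
  rw [ENNReal.mul_sub (fun _ _ => hc), mul_assoc, mul_assoc]

/-- The mixture of the measures `μ t`, `1 ≤ t ≤ T`, on disjoint copies of `ℝ`, with the remaining
weight on a single point. -/
def mixture (T : ℕ) (w : ℕ → ℝ) (μ : ℕ → Measure ℝ) : Measure (ℕ × ℝ) :=
  ∑ t ∈ Finset.Icc 1 T, ENNReal.ofReal (w t) • (μ t).map (fun x => (t, x)) +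
    ENNReal.ofReal (1 - ∑ t ∈ Finset.Icc 1 T, w t) • Measure.dirac (T + 1, 0)

lemma lintegral_mixture (T : ℕ) (w : ℕ → ℝ) (μ : ℕ → Measure ℝ) {φ : ℕ × ℝ → ℝ≥0∞}
    (hφ : Measurable φ) :
    ∫⁻ z, φ z ∂mixture T w μ = ∑ t ∈ Finset.Icc 1 T, ENNReal.ofReal (w t) * ∫⁻ x, φ (t, x) ∂μ t +
      ENNReal.ofReal (1 - ∑ t ∈ Finset.Icc 1 T, w t) * φ (T + 1, 0) := by
  rw [mixture, lintegral_add_measure, lintegral_finsetSum_measure, lintegral_smul_measure,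
    lintegral_dirac' _ hφ]
  congr 1
  refine Finset.sum_congr rfl fun t _ => ?_
  rw [lintegral_smul_measure, lintegral_map hφ (by fun_prop)]
  rfl

lemma isProbabilityMeasure_mixture {T : ℕ} {w : ℕ → ℝ} (hw : ∀ t, 0 ≤ w t)
    (hw1 : ∑ t ∈ Finset.Icc 1 T, w t ≤ 1) {μ : ℕ → Measure ℝ}
    (hμ : ∀ t, IsProbabilityMeasure (μ t)) : IsProbabilityMeasure (mixture T w μ) := by
  constructor
  have := lintegral_mixture T w μ (φ := 1) measurable_one
  simp only [Pi.one_apply, lintegral_one, measure_univ, mul_one] at this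
  rw [this, ← ENNReal.ofReal_sum_of_nonneg fun t _ => hw t, ← ENNReal.ofReal_add
    (Finset.sum_nonneg fun t _ => hw t) (by linarith)]
  simp

lemma hockeyOf_ne_top {f : ℝ → ℝ} (hf : IsTradeoff f) {a b : ℝ≥0∞} (ha : a ≠ ∞) (hb : b ≠ ∞) :
    hockeyOf f a b ≠ ∞ := by
  have := hf.shape.isProbabilityMeasure_canonicalAlt
  exact ((hockey_le _ _ ha b).trans_lt hb.lt_top).ne

/-- The label `t` is part of the outcome, so a test on the mixture is one test for each component.
At the remaining point both hypotheses have the same mass, which leaves the divergence `b - a` of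
perfect privacy. -/
lemma hockey_mixture_le {T : ℕ} {w : ℕ → ℝ} (hw : ∀ t, 0 ≤ w t)
    (hw1 : ∑ t ∈ Finset.Icc 1 T, w t ≤ 1) {f : ℕ → ℝ → ℝ} (hf : ∀ t, IsTradeoff (f t))
    {a : ℝ≥0∞} (ha : a ≠ ∞) (b : ℝ≥0∞) :
    hockey (mixture T w fun _ => TradeoffShape.canonicalNull)
      (mixture T w fun t => TradeoffShape.canonicalAlt (f t)) a b ≤
      ∑ t ∈ Finset.Icc 1 T, ENNReal.ofReal (w t) * hockeyOf (f t) a b +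
        ENNReal.ofReal (1 - ∑ t ∈ Finset.Icc 1 T, w t) * (b - a) := by
  have hQ := fun t => (hf t).shape.isProbabilityMeasure_canonicalAlt
  have := isProbabilityMeasure_mixture hw hw1 hQ
  have := isProbabilityMeasure_mixture hw hw1 fun _ => TradeoffShape.instIsProbabilityMeasureRealCanonicalNull
  refine hockey_le_of_forall_test _ _ ha fun φ hφ => ?_
  rw [lintegral_mixture _ _ _ hφ.1, lintegral_mixture _ _ _ hφ.1, mul_add, mul_add, Finset.mul_sum,
    Finset.mul_sum, add_add_add_comm, ← Finset.sum_add_distrib]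
  refine add_le_add (Finset.sum_le_sum fun t _ => ?_) ?_
  · calc b * (ENNReal.ofReal (w t) * ∫⁻ x, φ (t, x) ∂TradeoffShape.canonicalAlt (f t))
        = ENNReal.ofReal (w t) * (b * ∫⁻ x, φ (t, x) ∂TradeoffShape.canonicalAlt (f t)) := by ring
      _ ≤ ENNReal.ofReal (w t) * (a * ∫⁻ x, φ (t, x) ∂TradeoffShape.canonicalNull +
          hockeyOf (f t) a b) := by
        gcongr
        exact test_le_add_hockey _ _ (φ := fun x => φ (t, x))
          ⟨hφ.1.comp (by fun_prop), fun x => hφ.2 _⟩ a b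
      _ = _ := by ring
  · set v := ENNReal.ofReal (1 - ∑ t ∈ Finset.Icc 1 T, w t)
    calc b * (v * φ (T + 1, 0)) ≤ (a + (b - a)) * (v * φ (T + 1, 0)) := by
          gcongr; exact le_add_tsub
      _ = a * (v * φ (T + 1, 0)) + v * ((b - a) * φ (T + 1, 0)) := by ring
      _ ≤ a * (v * φ (T + 1, 0)) + v * ((b - a) * 1) := by gcongr; exact hφ.2 _
      _ = _ := by rw [mul_one]

lemma toReal_one_sub_ofReal {s : ℝ} (hs : 0 ≤ s) :
    (1 - ENNReal.ofReal s).toReal = (if s < 1 then 1 else 0) * (1 - s) := by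
  rw [← ENNReal.ofReal_one, ← ENNReal.ofReal_sub _ hs]
  split_ifs with h
  · rw [ENNReal.toReal_ofReal (by linarith), one_mul]
  · rw [ENNReal.ofReal_of_nonpos (by linarith)]; simp

lemma toReal_mixture_bound {T : ℕ} {w : ℕ → ℝ} (hw : ∀ t, 0 ≤ w t)
    (hw1 : ∑ t ∈ Finset.Icc 1 T, w t ≤ 1) {f : ℕ → ℝ → ℝ} (hf : ∀ t, IsTradeoff (f t))
    {s : ℝ} (hs : 0 ≤ s) :
    (∑ t ∈ Finset.Icc 1 T, ENNReal.ofReal (w t) * hockeyOf (f t) (ENNReal.ofReal s) 1 +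
        ENNReal.ofReal (1 - ∑ t ∈ Finset.Icc 1 T, w t) * (1 - ENNReal.ofReal s)).toReal =
    ∑ t ∈ Finset.Icc 1 T, w t * (hockeyOf (f t) (ENNReal.ofReal s) 1).toReal +
      (1 - ∑ t ∈ Finset.Icc 1 T, w t) * ((if s < 1 then 1 else 0) * (1 - s)) := by
  have ht : ∀ t ∈ Finset.Icc 1 T,
      ENNReal.ofReal (w t) * hockeyOf (f t) (ENNReal.ofReal s) 1 ≠ ∞ := fun t _ =>
    ENNReal.mul_ne_top ENNReal.ofReal_ne_top
      (hockeyOf_ne_top (hf t) ENNReal.ofReal_ne_top ENNReal.one_ne_top)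
  rw [ENNReal.toReal_add (ENNReal.sum_ne_top.2 ht) (ENNReal.mul_ne_top (by simp) (by simp)),
    ENNReal.toReal_sum ht, ENNReal.toReal_mul, ENNReal.toReal_ofReal (by linarith),
    toReal_one_sub_ofReal hs]
  congr 1
  refine Finset.sum_congr rfl fun t _ => ?_
  rw [ENNReal.toReal_mul, ENNReal.toReal_ofReal (hw t)]

/-- The mixture of the canonical pairs, with the label visible, has the required trade-off function.
Upper bound: near-optimal tests of levels `a t` are used component by component. Lower bound: all
components have a supporting line of the same slope `-s`, and these lines average to a minorant that
meets the upper bound at `α(s)`. -/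
lemma exists_isSingle {T : ℕ} {w : ℕ → ℝ} (hw : ∀ t, 0 ≤ w t)
    (hw1 : ∑ t ∈ Finset.Icc 1 T, w t ≤ 1) {f : ℕ → ℝ → ℝ} (hf : ∀ t, IsTradeoff (f t)) :
    ∃ g, IsSingle T w f g := by
  set P := mixture T w fun _ => TradeoffShape.canonicalNull with hPdef
  set Q := mixture T w fun t => TradeoffShape.canonicalAlt (f t) with hQdef
  have hQt := fun t => (hf t).shape.isProbabilityMeasure_canonicalAlt
  have hQ : IsProbabilityMeasure Q := isProbabilityMeasure_mixture hw hw1 hQt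
  have hP : IsProbabilityMeasure P := isProbabilityMeasure_mixture hw hw1 fun _ =>
    TradeoffShape.instIsProbabilityMeasureRealCanonicalNull
  refine ⟨tradeoff P Q, ⟨ℕ × ℝ, inferInstance, P, Q, hP, hQ, fun _ _ => rfl⟩,
    fun s hs a ha haT => ?_⟩
  set v := 1 - ∑ t ∈ Finset.Icc 1 T, w t with hv
  have hv0 : 0 ≤ v := by linarith
  have hc : a (T + 1) ∈ Set.Icc (0 : ℝ) 1 := by
    rw [haT]; split_ifs <;> simp
  set α := (∑ t ∈ Finset.Icc 1 T, w t * a t) + v * a (T + 1) with hα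
  have ha01 : ∀ t ∈ Finset.Icc 1 T, a t ∈ Set.Icc (0 : ℝ) 1 := fun t ht => (ha t ht).mem_Icc
  have hα0 : 0 ≤ α := add_nonneg
    (Finset.sum_nonneg fun t ht => mul_nonneg (hw t) (ha01 t ht).1) (mul_nonneg hv0 hc.1)
  apply le_antisymm
  · refine le_of_forall_pos_le_add fun ε hε => ?_
    have hex : ∀ t ∈ Finset.Icc 1 T, ∃ φ : ℝ → ℝ≥0∞, IsTest φ ∧
        (∫⁻ x, φ x ∂TradeoffShape.canonicalNull).toReal ≤ a t ∧
        1 - (∫⁻ x, φ x ∂TradeoffShape.canonicalAlt (f t)).toReal < f t (a t) + ε := fun t ht =>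
      exists_test_of_tradeoff_lt _ _ (ha01 t ht).1 (by
        rw [(hf t).shape.tradeoff_canonical (ha01 t ht)]; linarith)
    choose! φ hφ hφP hφQ using hex
    -- At the remaining point the test rejects with the constant probability `a (T + 1)`, of type II
    -- error `1 - a (T + 1)`.
    let ψ : ℕ × ℝ → ℝ≥0∞ := fun z =>
      if z.1 ∈ Finset.Icc 1 T then φ z.1 z.2 else ENNReal.ofReal (a (T + 1))
    have hψ : IsTest ψ := by
      refine ⟨measurable_from_prod_countable_right fun t => ?_, fun z => ?_⟩
      · by_cases ht : t ∈ Finset.Icc 1 T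
        · simp only [ψ, ht, if_true]; exact (hφ t ht).1
        · simp only [ψ, ht, if_false]; exact measurable_const
      · by_cases ht : z.1 ∈ Finset.Icc 1 T
        · simp only [ψ, ht, if_true]; exact (hφ _ ht).2 _
        · simp only [ψ, ht, if_false]; simpa using hc.2
    have hint : ∀ (μ : ℕ → Measure ℝ), (∀ t, IsProbabilityMeasure (μ t)) →
        (∫⁻ z, ψ z ∂mixture T w μ).toReal =
          ∑ t ∈ Finset.Icc 1 T, w t * (∫⁻ x, φ t x ∂μ t).toReal + v * a (T + 1) := by
      intro μ hμ
      have hfin : ∀ t ∈ Finset.Icc 1 T, ENNReal.ofReal (w t) * ∫⁻ x, ψ (t, x) ∂μ t ≠ ∞ :=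
        fun t _ => ENNReal.mul_ne_top ENNReal.ofReal_ne_top (lintegral_test_ne_top _
          ⟨hψ.1.comp (by fun_prop), fun x => hψ.2 _⟩)
      rw [lintegral_mixture _ _ _ hψ.1, ENNReal.toReal_add (ENNReal.sum_ne_top.2 hfin)
        (ENNReal.mul_ne_top ENNReal.ofReal_ne_top ((hψ.2 _).trans_lt ENNReal.one_lt_top).ne),
        ENNReal.toReal_sum hfin]
      congr 1
      · refine Finset.sum_congr rfl fun t ht => ?_
        simp only [ψ, ht, if_true]
        rw [ENNReal.toReal_mul, ENNReal.toReal_ofReal (hw t)]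
      · have : T + 1 ∉ Finset.Icc 1 T := by simp
        simp only [ψ, this, if_false]
        rw [ENNReal.toReal_mul, ENNReal.toReal_ofReal hv0, ENNReal.toReal_ofReal hc.1]
    have h1 := tradeoff_le_of_test P Q (α := α) hψ (by
      rw [hPdef, hint _ fun _ => inferInstance]
      refine add_le_add (Finset.sum_le_sum fun t ht => ?_) le_rfl
      exact mul_le_mul_of_nonneg_left (hφP t ht) (hw t))
    rw [hQdef, hint _ hQt] at h1
    have h2 : ∑ t ∈ Finset.Icc 1 T, w t * (1 - (f t (a t) + ε)) ≤
        ∑ t ∈ Finset.Icc 1 T, w t * (∫⁻ x, φ t x ∂TradeoffShape.canonicalAlt (f t)).toReal :=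
      Finset.sum_le_sum fun t ht => mul_le_mul_of_nonneg_left (by linarith [hφQ t ht]) (hw t)
    have h3 : ∑ t ∈ Finset.Icc 1 T, w t * (1 - (f t (a t) + ε)) =
        (∑ t ∈ Finset.Icc 1 T, w t) * (1 - ε) - ∑ t ∈ Finset.Icc 1 T, w t * f t (a t) := by
      rw [Finset.sum_mul, ← Finset.sum_sub_distrib]
      exact Finset.sum_congr rfl fun t _ => by ring
    nlinarith
  · refine le_tradeoff_of_test P Q hα0 fun φ hφ hφP => ?_
    have hPt := lintegral_test_ne_top P hφ
    have hht : hockey P Q (ENNReal.ofReal s) 1 ≠ ∞ :=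
      ((hockey_le P Q ENNReal.ofReal_ne_top 1).trans_lt ENNReal.one_lt_top).ne
    have h1 := ENNReal.toReal_mono (by simp [ENNReal.mul_eq_top, hPt, hht])
      (test_le_add_hockey P Q hφ (ENNReal.ofReal s) 1)
    rw [one_mul, ENNReal.toReal_add (by simp [ENNReal.mul_eq_top, hPt]) hht, ENNReal.toReal_mul,
        ENNReal.toReal_ofReal hs] at h1
    have h2 := ENNReal.toReal_mono (by
      refine ENNReal.add_ne_top.2 ⟨ENNReal.sum_ne_top.2 fun t _ => ENNReal.mul_ne_top
        ENNReal.ofReal_ne_top (hockeyOf_ne_top (hf t) ENNReal.ofReal_ne_top ENNReal.one_ne_top),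
        ENNReal.mul_ne_top (by simp) (by simp)⟩)
      (hockey_mixture_le hw hw1 hf (ENNReal.ofReal_ne_top (r := s)) 1)
    rw [toReal_mixture_bound hw hw1 hf hs, ← haT] at h2
    have h3 : ∑ t ∈ Finset.Icc 1 T, w t * (hockeyOf (f t) (ENNReal.ofReal s) 1).toReal =
        ∑ t ∈ Finset.Icc 1 T, w t - ∑ t ∈ Finset.Icc 1 T, w t * f t (a t) -
          s * ∑ t ∈ Finset.Icc 1 T, w t * a t := by
      rw [Finset.mul_sum, ← Finset.sum_sub_distrib, ← Finset.sum_sub_distrib]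
      refine Finset.sum_congr rfl fun t ht => ?_
      have := (ha t ht).add_eq hs
      rw [show (hockeyOf (f t) (ENNReal.ofReal s) 1).toReal = 1 - (f t (a t) + s * a t) by linarith]
      ring
    have h4 : s * (∫⁻ x, φ x ∂P).toReal ≤ s * α := mul_le_mul_of_nonneg_left hφP hs
    change (hockey P Q (ENNReal.ofReal s) 1).toReal ≤ _ at h2
    rw [h3] at h2
    nlinarith

/-- The mixture of the hockey-stick divergences is below that of the single-visit function. -/
lemma IsSingle.mixture_le_hockeyOf {T : ℕ} {w : ℕ → ℝ} (hw : ∀ t, 0 ≤ w t)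
    (hw1 : ∑ t ∈ Finset.Icc 1 T, w t ≤ 1) {f : ℕ → ℝ → ℝ} (hf : ∀ t, IsTradeoff (f t))
    {g : ℝ → ℝ} (hg : IsSingle T w f g) {a b : ℝ≥0∞} (ha : a ≠ ∞) (hb : b ≠ ∞) :
    ∑ t ∈ Finset.Icc 1 T, ENNReal.ofReal (w t) * hockeyOf (f t) a b +
      ENNReal.ofReal (1 - ∑ t ∈ Finset.Icc 1 T, w t) * (b - a) ≤ hockeyOf g a b := by
  obtain ⟨hgt, hg⟩ := hg
  have hgQ := hgt.shape.isProbabilityMeasure_canonicalAlt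
  -- Case `b = 1`. The defining equation gives the value of `g` at `α(s)`, and a near-optimal test
  -- of that level for the canonical pair of `g` bounds its divergence from below by `1 - s α(s) -
  -- g(α(s))`, which is the average on the left.
  have key : ∀ s : ℝ, 0 ≤ s →
      ∑ t ∈ Finset.Icc 1 T, ENNReal.ofReal (w t) * hockeyOf (f t) (ENNReal.ofReal s) 1 +
      ENNReal.ofReal (1 - ∑ t ∈ Finset.Icc 1 T, w t) * (1 - ENNReal.ofReal s) ≤
        hockeyOf g (ENNReal.ofReal s) 1 := by
    intro s hs
    have hht := hockeyOf_ne_top hgt (ENNReal.ofReal_ne_top (r := s)) ENNReal.one_ne_top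
    rw [← ENNReal.toReal_le_toReal (by
      refine ENNReal.add_ne_top.2 ⟨ENNReal.sum_ne_top.2 fun t _ => ENNReal.mul_ne_top
        ENNReal.ofReal_ne_top (hockeyOf_ne_top (hf t) ENNReal.ofReal_ne_top ENNReal.one_ne_top),
        ENNReal.mul_ne_top (by simp) (by simp)⟩) hht, toReal_mixture_bound hw hw1 hf hs]
    choose a₀ ha₀ using fun t => (hf t).exists_isTypeIError s
    set c : ℝ := if s < 1 then 1 else 0 with hc
    have hc01 : 0 ≤ c ∧ c ≤ 1 := by rw [hc]; split_ifs <;> simp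
    set a : ℕ → ℝ := fun t => if t = T + 1 then c else a₀ t with hadef
    have haT : a (T + 1) = c := by simp [hadef]
    have ha : ∀ t ∈ Finset.Icc 1 T, IsTypeIError (f t) s (a t) := fun t ht => by
      have : t ≠ T + 1 := by simp at ht; omega
      simp only [hadef, this, if_false]
      exact ha₀ t
    have h1 := hg s hs a ha haT
    set v := 1 - ∑ t ∈ Finset.Icc 1 T, w t with hv
    have hv0 : 0 ≤ v := by linarith
    set α := (∑ t ∈ Finset.Icc 1 T, w t * a t) + v * a (T + 1) with hα
    have ha01 : ∀ t ∈ Finset.Icc 1 T, a t ∈ Set.Icc (0 : ℝ) 1 := fun t ht => (ha t ht).mem_Icc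
    have hα0 : 0 ≤ α := add_nonneg
      (Finset.sum_nonneg fun t ht => mul_nonneg (hw t) (ha01 t ht).1)
      (mul_nonneg hv0 (by rw [haT]; exact hc01.1))
    have hα1 : α ≤ 1 := by
      have h2 : ∑ t ∈ Finset.Icc 1 T, w t * a t ≤ ∑ t ∈ Finset.Icc 1 T, w t :=
        Finset.sum_le_sum fun t ht => mul_le_of_le_one_right (hw t) (ha01 t ht).2
      have h3 : v * a (T + 1) ≤ v := mul_le_of_le_one_right hv0 (by rw [haT]; exact hc01.2)
      linarith
    have h3 : ∑ t ∈ Finset.Icc 1 T, w t * (hockeyOf (f t) (ENNReal.ofReal s) 1).toReal =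
        ∑ t ∈ Finset.Icc 1 T, w t - ∑ t ∈ Finset.Icc 1 T, w t * f t (a t) -
          s * ∑ t ∈ Finset.Icc 1 T, w t * a t := by
      rw [Finset.mul_sum, ← Finset.sum_sub_distrib, ← Finset.sum_sub_distrib]
      refine Finset.sum_congr rfl fun t ht => ?_
      have := (ha t ht).add_eq hs
      rw [show (hockeyOf (f t) (ENNReal.ofReal s) 1).toReal = 1 - (f t (a t) + s * a t) by linarith]
      ring
    rw [h3]
    have h4 : 1 - s * α - g α ≤ (hockeyOf g (ENNReal.ofReal s) 1).toReal := by
      refine le_of_forall_pos_le_add fun ε hε => ?_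
      obtain ⟨φ, hφ, hφP, hφQ⟩ := exists_test_of_tradeoff_lt TradeoffShape.canonicalNull
        (TradeoffShape.canonicalAlt g) hα0 (c := g α + ε)
        (by rw [hgt.shape.tradeoff_canonical ⟨hα0, hα1⟩]; linarith)
      have hPt := lintegral_test_ne_top TradeoffShape.canonicalNull hφ
      have h5 := ENNReal.toReal_mono
        (ENNReal.add_ne_top.2 ⟨ENNReal.mul_ne_top ENNReal.ofReal_ne_top hPt, hht⟩)
        (test_le_add_hockey _ (TradeoffShape.canonicalAlt g) hφ (ENNReal.ofReal s) 1)
      rw [one_mul, ENNReal.toReal_add (by simp [ENNReal.mul_eq_top, hPt]) hht, ENNReal.toReal_mul,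
        ENNReal.toReal_ofReal hs] at h5
      have h6 := mul_le_mul_of_nonneg_left hφP hs
      change _ ≤ _ + (hockeyOf g (ENNReal.ofReal s) 1).toReal at h5
      linarith
    rw [h1, haT] at h4
    rw [hα, haT] at h4
    nlinarith
  -- Homogeneity divides by `b`; for `b = 0` all divergences vanish.
  rcases eq_or_ne b 0 with rfl | hb0
  · have : ∀ t, hockeyOf (f t) a 0 = 0 := fun t => by
      have := (hf t).shape.isProbabilityMeasure_canonicalAlt
      exact le_antisymm (hockey_le _ _ ha 0) zero_le
    simp [this]
  · have hs := key (a / b).toReal ENNReal.toReal_nonneg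
    have hab : a / b ≠ ∞ := ENNReal.div_ne_top ha hb0
    rw [ENNReal.ofReal_toReal hab] at hs
    have hm : ∀ f, hockeyOf f a b = b * hockeyOf f (a / b) 1 := fun f => by
      rw [hockeyOf, hockeyOf, ← hockey_mul _ _ hb, ENNReal.mul_div_cancel hb0 hb, mul_one]
    rw [hm g]
    simp_rw [hm]
    calc _ = b * (∑ t ∈ Finset.Icc 1 T, ENNReal.ofReal (w t) * hockeyOf (f t) (a / b) 1 +
          ENNReal.ofReal (1 - ∑ t ∈ Finset.Icc 1 T, w t) * (1 - a / b)) := by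
          rw [mul_add, Finset.mul_sum]
          congr 1
          · exact Finset.sum_congr rfl fun t _ => by ring
          · rw [mul_left_comm, ENNReal.mul_sub (fun _ _ => hb), ENNReal.mul_div_cancel hb0 hb,
              mul_one]
      _ ≤ _ := by gcongr

/-! ### Nearest-point projections -/

section Projection

variable {d : ℕ} {C : Set (Model d)}

lemma proj_spec (hne : C.Nonempty) (hC : IsClosed C) (x : Model d) :
    proj C x ∈ C ∧ ∀ z ∈ C, dist x (proj C x) ≤ dist x z := by
  obtain ⟨y, hy, h⟩ := hC.exists_infDist_eq_dist hne x
  exact Classical.epsilon_spec (p := fun y => y ∈ C ∧ ∀ z ∈ C, dist x y ≤ dist x z)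
    ⟨y, hy, fun z hz => h ▸ Metric.infDist_le_dist_of_mem hz⟩

lemma inner_sub_proj_nonpos (hne : C.Nonempty) (hC : IsClosed C) (hconv : Convex ℝ C)
    (x : Model d) {w : Model d} (hw : w ∈ C) : inner ℝ (x - proj C x) (w - proj C x) ≤ 0 := by
  obtain ⟨h1, h2⟩ := proj_spec hne hC x
  refine (norm_eq_iInf_iff_real_inner_le_zero hconv h1).1 ?_ w hw
  have : Nonempty C := ⟨⟨_, h1⟩⟩
  refine le_antisymm (le_ciInf fun z => ?_) (ciInf_le ⟨0, ?_⟩ (⟨_, h1⟩ : C))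
  · simpa [dist_eq_norm] using h2 z z.2
  · rintro _ ⟨z, rfl⟩
    exact norm_nonneg _

/-- The obtuse-angle inequalities at the two projections add up to `‖u - v‖² ≤ ⟨x - y, u - v⟩`, and
Cauchy–Schwarz finishes. The purpose is measurability: `proj` is defined by choice, and continuity
makes the updates Markov kernels. -/
lemma lipschitzWith_proj (hne : C.Nonempty) (hC : IsClosed C) (hconv : Convex ℝ C) :
    LipschitzWith 1 (proj C) := by
  refine LipschitzWith.of_dist_le_mul fun x y => ?_
  rw [NNReal.coe_one, one_mul, dist_eq_norm, dist_eq_norm]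
  set u := proj C x
  set v := proj C y
  have h1 := inner_sub_proj_nonpos hne hC hconv x (proj_spec hne hC y).1
  have h2 := inner_sub_proj_nonpos hne hC hconv y (proj_spec hne hC x).1
  change inner ℝ (x - u) (v - u) ≤ 0 at h1
  change inner ℝ (y - v) (u - v) ≤ 0 at h2
  have h3 : ‖u - v‖ * ‖u - v‖ ≤ inner ℝ (x - y) (u - v) := by
    rw [← real_inner_self_eq_norm_mul_norm]
    have e1 : inner ℝ (x - u) (v - u) = - inner ℝ (x - u) (u - v) := by
      rw [← inner_neg_right, neg_sub]
    have e2 : inner ℝ (x - y) (u - v) =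
        inner ℝ (x - u) (u - v) + inner ℝ (u - v) (u - v) - inner ℝ (y - v) (u - v) := by
      rw [← inner_add_left, ← inner_sub_left]
      congr 1
      abel
    linarith
  have h4 := h3.trans (real_inner_le_norm _ _)
  by_contra! hlt
  have := norm_nonneg (x - y)
  nlinarith [norm_nonneg (u - v)]

end Projection

/-! ### The local updates as Markov kernels -/

/-- The standing assumptions on the parameters. -/
structure Params.Regular {n d : ℕ} {Z : Type*} (p : Params n d Z) (m : Fin n → ℕ) : Prop where
  stochastic : IsStochastic p.W
  closed : IsClosed p.domain
  convex : Convex ℝ p.domain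
  nonempty : p.domain.Nonempty
  batch_le : ∀ k, p.b ≤ m k
  one_le_K : 1 ≤ p.K

section Kernels

variable {n d : ℕ} {Z : Type*} {m : Fin n → ℕ} {p : Params n d Z}

lemma measurable_gradient (f : Model d → ℝ) : Measurable (gradient f) :=
  (InnerProductSpace.toDual ℝ (Model d)).symm.continuous.measurable.comp (measurable_fderiv ℝ f)

lemma measurable_batchGrad (p : Params n d Z) (D : Data n m Z) (k : Fin n) (B : Finset (Fin (m k))) :
    Measurable (batchGrad p D k B) := by
  unfold batchGrad
  exact (Finset.measurable_sum B fun r _ => measurable_gradient (p.loss (D k r))).const_smul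
    (p.b : ℝ)⁻¹

lemma Params.Regular.measurable_update (hp : p.Regular m) (D : Data n m Z) (k : Fin n)
    (B : Finset (Fin (m k))) : Measurable fun z : Model d × Model d =>
      proj p.domain (z.1 - p.η • (batchGrad p D k B z.1 + p.σ • z.2)) := by
  refine (lipschitzWith_proj hp.nonempty hp.closed hp.convex).continuous.measurable.comp ?_
  have := measurable_batchGrad p D k B
  fun_prop

lemma Params.Regular.lintegral_localStep (hp : p.Regular m) (D : Data n m Z) (k : Fin n)
    (θ : Model d) {F : Model d → ℝ≥0∞} (hF : Measurable F) :
    ∫⁻ x, F x ∂localStep p D k θ =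
      ∑ B ∈ (Finset.univ : Finset (Fin (m k))).powersetCard p.b,
        (((m k).choose p.b : ℕ) : ℝ≥0∞)⁻¹ * ∫⁻ z, F (proj p.domain
          (θ - p.η • (batchGrad p D k B θ + p.σ • z))) ∂stdGaussian (Model d) := by
  rw [localStep, lintegral_finsetSum_measure]
  refine Finset.sum_congr rfl fun B _ => ?_
  have hm : Measurable fun z => proj p.domain (θ - p.η • (batchGrad p D k B θ + p.σ • z)) :=
    (lipschitzWith_proj hp.nonempty hp.closed hp.convex).continuous.measurable.comp (by fun_prop)
  rw [lintegral_smul_measure, lintegral_map hF hm, smul_eq_mul]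

lemma measurable_of_measurable_lintegral {α β : Type*} [MeasurableSpace α] [MeasurableSpace β]
    {κ : α → Measure β} (h : ∀ F : β → ℝ≥0∞, Measurable F → Measurable fun a => ∫⁻ b, F b ∂κ a) :
    Measurable κ := by
  refine Measure.measurable_of_measurable_coe _ fun s hs => ?_
  simpa [lintegral_indicator_one hs] using h (s.indicator 1) (measurable_one.indicator hs)

lemma Params.Regular.measurable_localStep (hp : p.Regular m) (D : Data n m Z) (k : Fin n) :
    Measurable (localStep p D k) := by
  refine measurable_of_measurable_lintegral fun F hF => ?_
  simp_rw [hp.lintegral_localStep D k _ hF]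
  refine Finset.measurable_sum _ fun B _ => Measurable.const_mul ?_ _
  exact Measurable.lintegral_prod_right' (f := fun z : Model d × Model d => F (proj p.domain
          (z.1 - p.η • (batchGrad p D k B z.1 + p.σ • z.2)))) (hF.comp (hp.measurable_update D k B))

lemma isProbabilityMeasure_of_lintegral_one {β : Type*} [MeasurableSpace β] {μ : Measure β}
    (h : ∫⁻ _, 1 ∂μ = 1) : IsProbabilityMeasure μ := ⟨by rwa [lintegral_one] at h⟩

lemma Params.Regular.isProbabilityMeasure_localStep (hp : p.Regular m) (D : Data n m Z)
    (k : Fin n) (θ : Model d) : IsProbabilityMeasure (localStep p D k θ) := by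
  refine isProbabilityMeasure_of_lintegral_one ?_
  rw [hp.lintegral_localStep D k θ measurable_const]
  simp only [lintegral_one, measure_univ, mul_one, Finset.sum_const, Finset.card_powersetCard,
    Finset.card_univ, Fintype.card_fin, nsmul_eq_mul]
  refine ENNReal.mul_inv_cancel ?_ (by simp)
  exact_mod_cast (Nat.choose_pos (hp.batch_le k)).ne'

lemma Params.Regular.localStep_compl_domain (hp : p.Regular m) (D : Data n m Z)
    (k : Fin n) (θ : Model d) : localStep p D k θ p.domainᶜ = 0 := by
  have hm : MeasurableSet p.domainᶜ := hp.closed.measurableSet.compl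
  rw [← lintegral_indicator_one hm, hp.lintegral_localStep D k θ (measurable_one.indicator hm)]
  refine Finset.sum_eq_zero fun B _ => ?_
  simp [(proj_spec hp.nonempty hp.closed _).1]

lemma Params.Regular.measurable_localRun (hp : p.Regular m) (D : Data n m Z) (k : Fin n) :
    ∀ K : ℕ, Measurable (localRun p D k K)
  | 0 => Measure.measurable_dirac
  | K + 1 => (Measure.measurable_bind' (hp.measurable_localRun D k K)).comp
      (hp.measurable_localStep D k)

lemma Params.Regular.lintegral_localRun_succ (hp : p.Regular m) (D : Data n m Z) (k : Fin n)
    (K : ℕ) (θ : Model d) {F : Model d → ℝ≥0∞} (hF : Measurable F) :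
    ∫⁻ x, F x ∂localRun p D k (K + 1) θ =
      ∫⁻ x, ∫⁻ y, F y ∂localRun p D k K x ∂localStep p D k θ :=
  Measure.lintegral_bind (hp.measurable_localRun D k K).aemeasurable hF.aemeasurable

lemma Params.Regular.isProbabilityMeasure_localRun (hp : p.Regular m) (D : Data n m Z)
    (k : Fin n) : ∀ (K : ℕ) (θ : Model d), IsProbabilityMeasure (localRun p D k K θ)
  | 0, θ => Measure.dirac.isProbabilityMeasure
  | K + 1, θ => by
    have := hp.isProbabilityMeasure_localStep D k θ
    have := hp.isProbabilityMeasure_localRun D k K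
    refine isProbabilityMeasure_of_lintegral_one ?_
    rw [hp.lintegral_localRun_succ D k K θ measurable_const]
    simp

/-- Either some step has projected or the run has not moved from a point of the domain. This matters
because per-visit bounds are available only for starting models in the domain. -/
lemma Params.Regular.localRun_compl_domain (hp : p.Regular m) (D : Data n m Z)
    (k : Fin n) : ∀ (K : ℕ) (θ : Model d), 1 ≤ K ∨ θ ∈ p.domain →
      localRun p D k K θ p.domainᶜ = 0
  | 0, θ, h => by
    have hθ : θ ∈ p.domain := by simpa using h
    rw [localRun, Measure.dirac_apply' _ hp.closed.measurableSet.compl]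
    simp [hθ]
  | K + 1, θ, _ => by
    have hm : MeasurableSet p.domainᶜ := hp.closed.measurableSet.compl
    rw [← lintegral_indicator_one hm,
      hp.lintegral_localRun_succ D k K θ (measurable_one.indicator hm)]
    have hae : ∀ᵐ x ∂localStep p D k θ, x ∈ p.domain := hp.localStep_compl_domain D k θ
    rw [lintegral_congr_ae (g := fun _ => 0)]
    · simp
    · filter_upwards [hae] with x hx
      rw [lintegral_indicator_one hm, hp.localRun_compl_domain D k K x (Or.inr hx)]

lemma lintegral_walkStep (W : Matrix (Fin n) (Fin n) ℝ) (k : Fin n) (F : Fin n → ℝ≥0∞) :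
    ∫⁻ l, F l ∂walkStep W k = ∑ l, ENNReal.ofReal (W k l) * F l := by
  rw [walkStep, lintegral_finsetSum_measure]
  refine Finset.sum_congr rfl fun l _ => ?_
  rw [lintegral_smul_measure, lintegral_dirac]
  rfl

lemma IsStochastic.isProbabilityMeasure_walkStep {W : Matrix (Fin n) (Fin n) ℝ}
    (hW : IsStochastic W) (k : Fin n) : IsProbabilityMeasure (walkStep W k) := by
  refine isProbabilityMeasure_of_lintegral_one ?_
  rw [lintegral_walkStep]
  simp only [mul_one]
  rw [← ENNReal.ofReal_sum_of_nonneg fun l _ => hW.1 k l, hW.2 k, ENNReal.ofReal_one]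

lemma measurable_walkStep (W : Matrix (Fin n) (Fin n) ℝ) : Measurable (walkStep W) :=
  measurable_of_finite _

lemma Params.Regular.lintegral_roundStep (hp : p.Regular m) (D : Data n m Z) (x : Fin n × Model d)
    {F : Fin n × Model d → ℝ≥0∞} (hF : Measurable F) :
    ∫⁻ y, F y ∂roundStep p D x =
      ∑ l, ENNReal.ofReal (p.W x.1 l) * ∫⁻ θ, F (l, θ) ∂localRun p D x.1 p.K x.2 := by
  have := hp.isProbabilityMeasure_localRun D x.1 p.K x.2
  rw [roundStep, lintegral_prod _ hF.aemeasurable, lintegral_walkStep]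

lemma Params.Regular.measurable_roundStep (hp : p.Regular m) (D : Data n m Z) :
    Measurable (roundStep p D) := by
  refine measurable_of_measurable_lintegral fun F hF => ?_
  simp_rw [hp.lintegral_roundStep D _ hF]
  refine Finset.measurable_sum _ fun l _ => ?_
  refine measurable_from_prod_countable_right fun k => ?_
  change Measurable fun θ' => ENNReal.ofReal (p.W k l) * ∫⁻ θ, F (l, θ) ∂localRun p D k p.K θ'
  refine Measurable.const_mul ?_ _
  exact (Measure.measurable_lintegral (hF.comp measurable_prodMk_left)).comp
    (hp.measurable_localRun D k p.K)

lemma Params.Regular.isProbabilityMeasure_roundStep (hp : p.Regular m) (D : Data n m Z)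
    (x : Fin n × Model d) : IsProbabilityMeasure (roundStep p D x) := by
  have := hp.isProbabilityMeasure_localRun D x.1 p.K x.2
  have := hp.stochastic.isProbabilityMeasure_walkStep x.1
  rw [roundStep]
  infer_instance

lemma Params.Regular.ae_roundStep (hp : p.Regular m) (D : Data n m Z) (x : Fin n × Model d) :
    ∀ᵐ y ∂roundStep p D x, y.2 ∈ p.domain := by
  have hm : MeasurableSet {y : Fin n × Model d | y.2 ∈ p.domain}ᶜ :=
    (measurable_snd hp.closed.measurableSet).compl
  change roundStep p D x {y : Fin n × Model d | y.2 ∈ p.domain}ᶜ = 0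
  rw [← lintegral_indicator_one hm, hp.lintegral_roundStep D x (measurable_one.indicator hm)]
  refine Finset.sum_eq_zero fun l _ => ?_
  have : ∀ᵐ θ ∂localRun p D x.1 p.K x.2, θ ∈ p.domain :=
    hp.localRun_compl_domain D x.1 p.K x.2 (Or.inl hp.one_le_K)
  rw [lintegral_congr_ae (g := fun _ => 0)]
  · simp
  · filter_upwards [this] with θ hθ
    simp [hθ]

end Kernels

/-! ### Paths of Markov chains -/

section Paths

variable {S : Type*} [MeasurableSpace S] {step : S → Measure S}

lemma measurable_finCons {A : Type*} [MeasurableSpace A] (T : ℕ) :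
    Measurable fun z : A × (Fin T → A) => (Fin.cons z.1 z.2 : Fin (T + 1) → A) := by
  refine measurable_pi_iff.2 fun t => ?_
  refine Fin.cases ?_ (fun s => ?_) t
  · simpa using measurable_fst
  · exact (measurable_pi_apply s).comp measurable_snd

lemma measurable_finCons_right {A : Type*} [MeasurableSpace A] {T : ℕ} (x : A) :
    Measurable fun y : Fin T → A => (Fin.cons x y : Fin (T + 1) → A) :=
  (measurable_finCons T).comp measurable_prodMk_left

/-- The transition kernel of the whole path, together with its total mass. -/
lemma measurable_pathLaw_and_isProbabilityMeasure (hstep : Measurable step)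
    (hprob : ∀ x, IsProbabilityMeasure (step x)) :
    ∀ T : ℕ, Measurable (pathLaw step T) ∧ ∀ x, IsProbabilityMeasure (pathLaw step T x)
  | 0 => ⟨Measure.measurable_dirac.comp (measurable_pi_iff.2 fun _ => measurable_id),
      fun _ => Measure.dirac.isProbabilityMeasure⟩
  | T + 1 => by
    obtain ⟨hm, hP⟩ := measurable_pathLaw_and_isProbabilityMeasure hstep hprob T
    -- Measurability of a parametrized integral is applied to a kernel of finite mass, so
    -- measurability and total mass are carried through one induction.
    let κ : Kernel S (Fin (T + 1) → S) := ⟨pathLaw step T, hm⟩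
    have hκ : IsMarkovKernel κ := ⟨hP⟩
    let σ : Kernel S S := ⟨step, hstep⟩
    have hσ : IsMarkovKernel σ := ⟨hprob⟩
    have hmap : ∀ x, Measurable fun x' => (pathLaw step T x').map fun y =>
        (Fin.cons x y : Fin (T + 2) → S) := fun x =>
      (Measure.measurable_map _ (measurable_finCons_right x)).comp hm
    have hl : ∀ x, ∀ F : (Fin (T + 2) → S) → ℝ≥0∞, Measurable F →
        ∫⁻ y, F y ∂pathLaw step (T + 1) x =
          ∫⁻ x', ∫⁻ y, F (Fin.cons x y) ∂κ x' ∂σ x := fun x F hF => by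
      rw [pathLaw, Measure.lintegral_bind (hmap x).aemeasurable hF.aemeasurable]
      refine lintegral_congr fun x' => ?_
      rw [lintegral_map hF (measurable_finCons_right x)]
      rfl
    refine ⟨measurable_of_measurable_lintegral fun F hF => ?_, fun x => ?_⟩
    · simp_rw [hl _ F hF]
      refine Measurable.lintegral_kernel_prod_right (κ := σ)
        (f := fun x x' => ∫⁻ y, F (Fin.cons x y) ∂κ x') ?_
      refine Measurable.lintegral_kernel_prod_right (κ := κ.comap Prod.snd measurable_snd)
        (f := fun (z : S × S) y => F (Fin.cons z.1 y)) ?_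
      exact hF.comp ((measurable_finCons (T + 1)).comp
        ((measurable_fst.comp measurable_fst).prodMk measurable_snd))
    · refine isProbabilityMeasure_of_lintegral_one ?_
      rw [hl x _ measurable_const]
      simp

end Paths

/-! ### Integration against path laws -/

section Paths

variable {S : Type*} [MeasurableSpace S] {step : S → Measure S}

lemma measurable_pathLaw (hstep : Measurable step) (hprob : ∀ x, IsProbabilityMeasure (step x))
    (T : ℕ) : Measurable (pathLaw step T) :=
  (measurable_pathLaw_and_isProbabilityMeasure hstep hprob T).1

lemma isProbabilityMeasure_pathLaw (hstep : Measurable step)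
    (hprob : ∀ x, IsProbabilityMeasure (step x)) (T : ℕ) (x : S) :
    IsProbabilityMeasure (pathLaw step T x) :=
  (measurable_pathLaw_and_isProbabilityMeasure hstep hprob T).2 x

lemma lintegral_pathLaw_zero (step : S → Measure S) (x : S) {F : (Fin 1 → S) → ℝ≥0∞}
    (hF : Measurable F) : ∫⁻ y, F y ∂pathLaw step 0 x = F fun _ => x :=
  lintegral_dirac' _ hF

lemma lintegral_pathLaw_succ (hstep : Measurable step)
    (hprob : ∀ x, IsProbabilityMeasure (step x)) (T : ℕ) (x : S)
    {F : (Fin (T + 2) → S) → ℝ≥0∞} (hF : Measurable F) :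
    ∫⁻ y, F y ∂pathLaw step (T + 1) x =
      ∫⁻ x', ∫⁻ y, F (Fin.cons x y) ∂pathLaw step T x' ∂step x := by
  have hmap : Measurable fun x' => (pathLaw step T x').map fun y =>
      (Fin.cons x y : Fin (T + 2) → S) :=
    (Measure.measurable_map _ (measurable_finCons_right x)).comp (measurable_pathLaw hstep hprob T)
  rw [pathLaw, Measure.lintegral_bind hmap.aemeasurable hF.aemeasurable]
  refine lintegral_congr fun x' => ?_
  rw [lintegral_map hF (measurable_finCons_right x)]

/-- The path starts at the prescribed state. -/
lemma lintegral_pathLaw_congr (hstep : Measurable step)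
    (hprob : ∀ x, IsProbabilityMeasure (step x)) (T : ℕ) (x : S)
    {F G : (Fin (T + 1) → S) → ℝ≥0∞} (hF : Measurable F) (hG : Measurable G)
    (h : ∀ y, y 0 = x → F y = G y) :
    ∫⁻ y, F y ∂pathLaw step T x = ∫⁻ y, G y ∂pathLaw step T x := by
  cases T with
  | zero => rw [lintegral_pathLaw_zero _ _ hF, lintegral_pathLaw_zero _ _ hG, h _ rfl]
  | succ T =>
    rw [lintegral_pathLaw_succ hstep hprob T x hF, lintegral_pathLaw_succ hstep hprob T x hG]
    exact lintegral_congr fun x' => lintegral_congr fun y => h _ rfl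

lemma measurable_lintegral_pathLaw (hstep : Measurable step)
    (hprob : ∀ x, IsProbabilityMeasure (step x)) (T : ℕ) {A : Type*} [MeasurableSpace A]
    {g : A → S} (hg : Measurable g) {F : A → (Fin (T + 1) → S) → ℝ≥0∞}
    (hF : Measurable (Function.uncurry F)) :
    Measurable fun a => ∫⁻ y, F a y ∂pathLaw step T (g a) := by
  let κ : Kernel S (Fin (T + 1) → S) := ⟨pathLaw step T, measurable_pathLaw hstep hprob T⟩
  have hκ : IsMarkovKernel κ := ⟨isProbabilityMeasure_pathLaw hstep hprob T⟩
  exact Measurable.lintegral_kernel_prod_right (κ := κ.comap g hg) (f := F) hF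

end Paths

/-! ### Runs of the algorithm and the walk of their active users -/

section Runs

variable {n d : ℕ} {Z : Type*} {m : Fin n → ℕ} {p : Params n d Z}

/-- The users of a run. -/
def users {T : ℕ} (y : Fin (T + 1) → Fin n × Model d) : Fin (T + 1) → Fin n := fun t => (y t).1

lemma measurable_users {T : ℕ} :
    Measurable (users : (Fin (T + 1) → Fin n × Model d) → Fin (T + 1) → Fin n) :=
  measurable_pi_iff.2 fun t => measurable_fst.comp (measurable_pi_apply t)

lemma users_cons {T : ℕ} (x : Fin n × Model d) (y : Fin (T + 1) → Fin n × Model d) :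
    users (T := T + 1) (Fin.cons x y) = Fin.cons x.1 (users y) := by
  funext t
  refine Fin.cases ?_ (fun s => ?_) t <;> simp [users]

lemma measurable_of_users {T : ℕ} (F : (Fin (T + 1) → Fin n) → ℝ≥0∞) : Measurable F :=
  measurable_of_finite F

lemma Params.Regular.lintegral_roundStep_fst (hp : p.Regular m) (D : Data n m Z)
    (x : Fin n × Model d) (F : Fin n → ℝ≥0∞) :
    ∫⁻ y, F y.1 ∂roundStep p D x = ∫⁻ l, F l ∂walkStep p.W x.1 := by
  have := hp.isProbabilityMeasure_localRun D x.1 p.K x.2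
  rw [hp.lintegral_roundStep D x (F := fun y => F y.1) ((measurable_of_finite F).comp measurable_fst),
    lintegral_walkStep]
  simp

/-- The users of a run form the random walk. -/
lemma Params.Regular.lintegral_users (hp : p.Regular m) (D : Data n m Z) :
    ∀ (T : ℕ) (x : Fin n × Model d) (F : (Fin (T + 1) → Fin n) → ℝ≥0∞),
      ∫⁻ y, F (users y) ∂pathLaw (roundStep p D) T x =
        ∫⁻ u, F u ∂pathLaw (walkStep p.W) T x.1
  | 0, x, F => by
    rw [lintegral_pathLaw_zero _ _ (F := fun y => F (users y))
        ((measurable_of_users F).comp measurable_users), lintegral_pathLaw_zero _ _ (measurable_of_users F)]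
    rfl
  | T + 1, x, F => by
    rw [lintegral_pathLaw_succ (hp.measurable_roundStep D) (hp.isProbabilityMeasure_roundStep D) _ _
        (F := fun y => F (users y)) ((measurable_of_users F).comp measurable_users),
      lintegral_pathLaw_succ (measurable_walkStep _) hp.stochastic.isProbabilityMeasure_walkStep _ _
        (measurable_of_users F)]
    simp_rw [users_cons]
    rw [← hp.lintegral_roundStep_fst D x fun l =>
      ∫⁻ u, F (Fin.cons x.1 u) ∂pathLaw (walkStep p.W) T l]
    exact lintegral_congr fun x' => hp.lintegral_users D T x' fun u => F (Fin.cons x.1 u)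

/-! ### First passages -/

/-- The paths whose first visit to `j` is at the last time `t + 1`. -/
def passageSet (d : ℕ) (j : Fin n) (t : ℕ) : Set (Fin (t + 2) → Fin n × Model d) :=
  {y | users y ∈ firstVisit j (t + 1)}

/-- The law of the model received by `j` at its first visit, restricted to the event that this
visit is at the time `t + 1`. -/
def passageLaw (p : Params n d Z) (D : Data n m Z) (j : Fin n) (t : ℕ) (x : Fin n × Model d) :
    Measure (Model d) :=
  ((pathLaw (roundStep p D) (t + 1) x).restrict (passageSet d j t)).map
    fun y => (y (Fin.last (t + 1))).2

lemma measurableSet_passageSet (j : Fin n) (t : ℕ) : MeasurableSet (passageSet d j t) :=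
  measurable_users (Set.toFinite (firstVisit j (t + 1))).measurableSet

lemma measurable_lastModel (t : ℕ) :
    Measurable fun y : Fin (t + 2) → Fin n × Model d => (y (Fin.last (t + 1))).2 :=
  measurable_snd.comp (measurable_pi_apply _)

lemma lintegral_passageLaw (D : Data n m Z) (j : Fin n) (t : ℕ) (x : Fin n × Model d)
    {ψ : Model d → ℝ≥0∞} (hψ : Measurable ψ) :
    ∫⁻ θ, ψ θ ∂passageLaw p D j t x =
      ∫⁻ y, (passageSet d j t).indicator (fun y => ψ (y (Fin.last (t + 1))).2) y
        ∂pathLaw (roundStep p D) (t + 1) x := by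
  rw [passageLaw, lintegral_map hψ (measurable_lastModel t),
    lintegral_indicator (measurableSet_passageSet j t)]

lemma measurable_passage_indicator (j : Fin n) (t : ℕ) {ψ : Model d → ℝ≥0∞} (hψ : Measurable ψ) :
    Measurable ((passageSet d j t).indicator (fun y => ψ (y (Fin.last (t + 1))).2)) :=
  (hψ.comp (measurable_lastModel t)).indicator (measurableSet_passageSet j t)

lemma cons_mem_passageSet_zero (j : Fin n) (x : Fin n × Model d) (y : Fin 1 → Fin n × Model d) :
    (Fin.cons x y : Fin 2 → Fin n × Model d) ∈ passageSet d j 0 ↔ (y 0).1 = j := by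
  rw [passageSet, Set.mem_ofPred_eq, users_cons, firstVisit, Set.mem_ofPred_eq]
  constructor
  · exact fun h => h.1
  · refine fun h => ⟨h, fun s h0 h1 => ?_⟩
    exfalso
    have h0' : (0 : ℕ) < s := h0
    have h1' : (s : ℕ) < 1 := h1
    omega

/-- `firstVisit` ignores time `0`. Prefixing a state turns time `0` of the tail into time `1`, which
must avoid `j`: hence the extra condition on `y 0`. -/
lemma cons_mem_passageSet_succ (j : Fin n) (t : ℕ) (x : Fin n × Model d)
    (y : Fin (t + 2) → Fin n × Model d) :
    (Fin.cons x y : Fin (t + 3) → Fin n × Model d) ∈ passageSet d j (t + 1) ↔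
      (y 0).1 ≠ j ∧ y ∈ passageSet d j t := by
  simp only [passageSet, Set.mem_ofPred_eq, users_cons, firstVisit]
  have hlast : (Fin.cons x.1 (users y) : Fin (t + 3) → Fin n) (Fin.last (t + 1 + 1)) =
      users y (Fin.last (t + 1)) := rfl
  rw [hlast]
  constructor
  · rintro ⟨h1, h2⟩
    refine ⟨?_, h1, fun s h0 hs => ?_⟩
    · exact h2 (Fin.succ 0) (Fin.succ_pos _) (by
        rw [Fin.lt_def]; simp)
    · exact h2 (Fin.succ s) (Fin.succ_pos _) (by
        rw [Fin.lt_def] at hs ⊢; simpa using hs)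
  · rintro ⟨h0, h1, h2⟩
    refine ⟨h1, fun s hs hs' => ?_⟩
    obtain ⟨s, rfl⟩ := Fin.exists_succ_eq_of_ne_zero hs.ne'
    change users y s ≠ j
    rcases eq_or_ne s 0 with rfl | hpos
    · exact h0
    · exact h2 s (Fin.pos_iff_ne_zero.2 hpos) (by rw [Fin.lt_def] at hs' ⊢; simpa using hs')

lemma Params.Regular.lintegral_passageLaw_zero (hp : p.Regular m) (D : Data n m Z) (j : Fin n)
    (x : Fin n × Model d) {ψ : Model d → ℝ≥0∞} (hψ : Measurable ψ) :
    ∫⁻ θ, ψ θ ∂passageLaw p D j 0 x =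
      ∫⁻ x', (if x'.1 = j then ψ x'.2 else 0) ∂roundStep p D x := by
  have hs := hp.measurable_roundStep D
  have hP := hp.isProbabilityMeasure_roundStep D
  rw [lintegral_passageLaw D j 0 x hψ,
    lintegral_pathLaw_succ hs hP _ _ (measurable_passage_indicator j 0 hψ)]
  refine lintegral_congr fun x' => ?_
  rw [lintegral_pathLaw_zero _ _ (F := fun y => (passageSet d j 0).indicator
    (fun y => ψ (y (Fin.last (0 + 1))).2) (Fin.cons x y)) ((measurable_passage_indicator j 0 hψ).comp
    (measurable_finCons_right x))]
  by_cases h : x'.1 = j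
  · rw [Set.indicator_of_mem ((cons_mem_passageSet_zero j x _).2 h), if_pos h]
    rfl
  · rw [Set.indicator_of_notMem (fun h' => h ((cons_mem_passageSet_zero j x _).1 h')), if_neg h]

lemma Params.Regular.lintegral_passageLaw_succ (hp : p.Regular m) (D : Data n m Z) (j : Fin n)
    (t : ℕ) (x : Fin n × Model d) {ψ : Model d → ℝ≥0∞} (hψ : Measurable ψ) :
    ∫⁻ θ, ψ θ ∂passageLaw p D j (t + 1) x =
      ∫⁻ x', (if x'.1 = j then 0 else ∫⁻ θ, ψ θ ∂passageLaw p D j t x') ∂roundStep p D x := by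
  have hs := hp.measurable_roundStep D
  have hP := hp.isProbabilityMeasure_roundStep D
  rw [lintegral_passageLaw D j (t + 1) x hψ,
    lintegral_pathLaw_succ hs hP _ _ (measurable_passage_indicator j (t + 1) hψ)]
  refine lintegral_congr fun x' => ?_
  have hm : Measurable fun y => (passageSet d j (t + 1)).indicator
      (fun y => ψ (y (Fin.last (t + 1 + 1))).2) (Fin.cons x y) :=
    (measurable_passage_indicator j (t + 1) hψ).comp (measurable_finCons_right x)
  split_ifs with h
  · rw [lintegral_pathLaw_congr hs hP (t + 1) x' hm measurable_zero]
    · simp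
    · intro y hy
      rw [Set.indicator_of_notMem]
      · rfl
      rw [cons_mem_passageSet_succ, hy]
      exact fun h' => h'.1 h
  · rw [lintegral_passageLaw D j t x' hψ]
    refine lintegral_pathLaw_congr hs hP (t + 1) x' hm (measurable_passage_indicator j t hψ) ?_
    intro y hy
    classical
    rw [Set.indicator_apply, Set.indicator_apply]
    simp only [cons_mem_passageSet_succ, hy, ne_eq, h, not_false_eq_true, true_and]
    rfl

lemma Params.Regular.measurable_lintegral_passageLaw (hp : p.Regular m) (D : Data n m Z)
    (j : Fin n) (t : ℕ) {ψ : Model d → ℝ≥0∞} (hψ : Measurable ψ) :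
    Measurable fun x => ∫⁻ θ, ψ θ ∂passageLaw p D j t x := by
  simp_rw [lintegral_passageLaw D j t _ hψ]
  exact measurable_lintegral_pathLaw (hp.measurable_roundStep D) (hp.isProbabilityMeasure_roundStep D)
    (t + 1) measurable_id ((measurable_passage_indicator j t hψ).comp measurable_snd)

lemma Params.Regular.isFiniteMeasure_passageLaw (hp : p.Regular m) (D : Data n m Z)
    (j : Fin n) (t : ℕ) (x : Fin n × Model d) : IsFiniteMeasure (passageLaw p D j t x) := by
  have := isProbabilityMeasure_pathLaw (hp.measurable_roundStep D)
    (hp.isProbabilityMeasure_roundStep D) (t + 1) x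
  unfold passageLaw
  infer_instance

/-- The probability that `j` is not visited at the times `1, …, T`. -/
def avoidProb (p : Params n d Z) (D : Data n m Z) (j : Fin n) : ℕ → Fin n × Model d → ℝ≥0∞
  | 0, _ => 1
  | T + 1, x => ∫⁻ x', (if x'.1 = j then 0 else avoidProb p D j T x') ∂roundStep p D x

lemma measurableSet_fst_eq (j : Fin n) : MeasurableSet {x : Fin n × Model d | x.1 = j} :=
  measurable_fst (measurableSet_singleton j)

lemma Params.Regular.measurable_avoidProb (hp : p.Regular m) (D : Data n m Z) (j : Fin n) :
    ∀ T : ℕ, Measurable (avoidProb p D j T)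
  | 0 => measurable_const
  | T + 1 => (Measure.measurable_lintegral (Measurable.ite (measurableSet_fst_eq j) measurable_const
      (hp.measurable_avoidProb D j T))).comp (hp.measurable_roundStep D)

/-- Either `j` is first visited at one of the times `1, …, T` or it is avoided. The induction
conditions on the first step: a step to `j` ends the passage, any other step restarts it. -/
lemma Params.Regular.sum_passageLaw_add_avoidProb (hp : p.Regular m) (D : Data n m Z) (j : Fin n) :
    ∀ (T : ℕ) (x : Fin n × Model d),
      ∑ t ∈ Finset.range T, passageLaw p D j t x Set.univ + avoidProb p D j T x = 1
  | 0, x => by simp [avoidProb]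
  | T + 1, x => by
    have hm1 := fun t => hp.measurable_lintegral_passageLaw D j t (ψ := fun _ => 1) measurable_const
    have hP := hp.isProbabilityMeasure_roundStep D x
    simp_rw [← lintegral_one] at *
    rw [Finset.sum_range_succ', hp.lintegral_passageLaw_zero D j x measurable_const, avoidProb]
    simp_rw [hp.lintegral_passageLaw_succ D j _ x (ψ := fun _ => 1) measurable_const]
    rw [← lintegral_finsetSum' _ fun t _ => (Measurable.ite (measurableSet_fst_eq j)
        measurable_const (hm1 t)).aemeasurable,
      ← lintegral_add_right _ (Measurable.ite (measurableSet_fst_eq j) measurable_const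
        measurable_const),
      ← lintegral_add_right _ (Measurable.ite (measurableSet_fst_eq j) measurable_const
        (hp.measurable_avoidProb D j T))]
    rw [lintegral_congr (g := fun _ => 1)]
    · simp
    · intro x'
      by_cases h : x'.1 = j
      · simp [h]
      · simp only [h, if_false, add_zero]
        have := hp.sum_passageLaw_add_avoidProb D j T x'
        simpa only [lintegral_one] using this

/-- The mass is a property of the walk alone, so both datasets have the same passage weights. -/
lemma Params.Regular.passageLaw_univ (hp : p.Regular m) (D : Data n m Z) (j : Fin n) (t : ℕ)
    (x : Fin n × Model d) :
    passageLaw p D j t x Set.univ = ENNReal.ofReal (hitProb p.W x.1 j (t + 1)) := by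
  have := isProbabilityMeasure_pathLaw (measurable_walkStep p.W)
    hp.stochastic.isProbabilityMeasure_walkStep (t + 1) x.1
  rw [← lintegral_one, lintegral_passageLaw D j t x measurable_const, hitProb,
    ofReal_measureReal, ← lintegral_indicator_one (Set.toFinite (firstVisit j (t + 1))).measurableSet,
    ← hp.lintegral_users D]
  rfl

lemma Params.Regular.passageLaw_compl_domain (hp : p.Regular m) (D : Data n m Z) (j : Fin n) :
    ∀ (t : ℕ) (x : Fin n × Model d), passageLaw p D j t x p.domainᶜ = 0 := by
  have hm : MeasurableSet p.domainᶜ := hp.closed.measurableSet.compl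
  have h1 : Measurable (p.domainᶜ.indicator (1 : Model d → ℝ≥0∞)) := measurable_one.indicator hm
  intro t
  induction t with
  | zero =>
    intro x
    rw [← lintegral_indicator_one hm, hp.lintegral_passageLaw_zero D j x h1,
      lintegral_congr_ae (g := fun _ => 0)]
    · simp
    · filter_upwards [hp.ae_roundStep D x] with y hy
      simp [hy]
  | succ t ih =>
    intro x
    rw [← lintegral_indicator_one hm, hp.lintegral_passageLaw_succ D j t x h1]
    simp_rw [lintegral_indicator_one hm, ih]
    simp

/-- The hitting probability is assumed nonzero because conditioning on a null event yields the zero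
measure. -/
lemma Params.Regular.passageLaw_eq_smul (hp : p.Regular m) (D : Data n m Z) (i j : Fin n) (t : ℕ)
    (θ : Model d) (h : hitProb p.W i j (t + 1) ≠ 0) :
    IsProbabilityMeasure (firstModelLaw p D i j (t + 1) θ) ∧
    passageLaw p D j t (i, θ) =
      ENNReal.ofReal (hitProb p.W i j (t + 1)) • firstModelLaw p D i j (t + 1) θ := by
  have hP := isProbabilityMeasure_pathLaw (hp.measurable_roundStep D)
    (hp.isProbabilityMeasure_roundStep D) (t + 1) (i, θ)
  have hpos : 0 < hitProb p.W i j (t + 1) := lt_of_le_of_ne measureReal_nonneg h.symm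
  have hE : pathLaw (roundStep p D) (t + 1) (i, θ) (passageSet d j t) =
      ENNReal.ofReal (hitProb p.W i j (t + 1)) := by
    rw [← hp.passageLaw_univ D j t (i, θ), passageLaw, Measure.map_apply (measurable_lastModel t)
      MeasurableSet.univ]
    simp
  have hE0 : pathLaw (roundStep p D) (t + 1) (i, θ) (passageSet d j t) ≠ 0 := by
    rw [hE]; simpa using hpos
  constructor
  · have : IsProbabilityMeasure (cond (pathLaw (roundStep p D) (t + 1) (i, θ)) (passageSet d j t)) :=
      cond_isProbabilityMeasure hE0
    exact Measure.isProbabilityMeasure_map (μ := cond (pathLaw (roundStep p D) (t + 1) (i, θ))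
      (passageSet d j t)) (measurable_lastModel t).aemeasurable
  · have : firstModelLaw p D i j (t + 1) θ =
        (ENNReal.ofReal (hitProb p.W i j (t + 1)))⁻¹ • passageLaw p D j t (i, θ) := by
      rw [passageLaw, ← hE, ← Measure.map_smul]
      rfl
    rw [this, smul_smul, ENNReal.mul_inv_cancel (by simpa using hpos) (by simp), one_smul]

lemma sum_Icc_eq_sum_range {M : Type*} [AddCommMonoid M] (T : ℕ) (g : ℕ → M) :
    ∑ t ∈ Finset.Icc 1 T, g t = ∑ t ∈ Finset.range T, g (t + 1) := by
  rw [← Finset.sum_image (f := g) (s := Finset.range T) (g := fun t => t + 1) (by simp)]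
  congr 1
  ext t
  simp only [Finset.mem_Icc, Finset.mem_image, Finset.mem_range]
  constructor
  · exact fun h => ⟨t - 1, by omega, by omega⟩
  · rintro ⟨s, hs, rfl⟩
    omega

lemma Params.Regular.sum_hitProb_add_avoidProb (hp : p.Regular m) (D : Data n m Z) (i j : Fin n)
    (T : ℕ) (θ : Model d) :
    ENNReal.ofReal (∑ t ∈ Finset.range T, hitProb p.W i j (t + 1)) + avoidProb p D j T (i, θ) = 1 := by
  rw [← hp.sum_passageLaw_add_avoidProb D j T (i, θ), ENNReal.ofReal_sum_of_nonneg
    (f := fun t => hitProb p.W i j (t + 1)) fun t _ => measureReal_nonneg]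
  congr 1
  exact Finset.sum_congr rfl fun t _ => (hp.passageLaw_univ D j t (i, θ)).symm

lemma Params.Regular.sum_hitProb_le_one (hp : p.Regular m) (D : Data n m Z) (i j : Fin n)
    (T : ℕ) : ∑ t ∈ Finset.Icc 1 T, hitProb p.W i j t ≤ 1 := by
  obtain ⟨θ, -⟩ := hp.nonempty
  rw [sum_Icc_eq_sum_range]
  have := hp.sum_hitProb_add_avoidProb D i j T θ
  have h : ENNReal.ofReal (∑ t ∈ Finset.range T, hitProb p.W i j (t + 1)) ≤ 1 :=
    le_self_add.trans this.le
  simpa using h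

lemma Params.Regular.avoidProb_eq (hp : p.Regular m) (D : Data n m Z) (i j : Fin n)
    (T : ℕ) (θ : Model d) :
    avoidProb p D j T (i, θ) =
      ENNReal.ofReal (1 - ∑ t ∈ Finset.range T, hitProb p.W i j (t + 1)) := by
  have h0 : 0 ≤ ∑ t ∈ Finset.range T, hitProb p.W i j (t + 1) :=
    Finset.sum_nonneg fun t _ => measureReal_nonneg
  rw [ENNReal.ofReal_sub _ h0, ENNReal.ofReal_one]
  exact ENNReal.eq_sub_of_add_eq (by simp) (by
    rw [add_comm]; exact hp.sum_hitProb_add_avoidProb D i j T θ)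

/-! ### Views -/

/-- What `j` sees of a message. -/
def observe (j : Fin n) (x : Fin n × Model d) : Model d ⊕ Unit :=
  if x.1 = j then Sum.inl x.2 else Sum.inr ()

lemma measurable_observe (j : Fin n) : Measurable (observe j : Fin n × Model d → Model d ⊕ Unit) :=
  Measurable.ite (measurableSet_fst_eq j) (measurable_inl.comp measurable_snd) measurable_const

lemma measurable_received {T : ℕ} (j : Fin n) :
    Measurable (received j : (Fin (T + 1) → Fin n × Model d) → _) :=
  measurable_pi_iff.2 fun t => (measurable_observe j).comp (measurable_pi_apply t.succ)

lemma received_cons {T : ℕ} (j : Fin n) (x : Fin n × Model d)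
    (y : Fin (T + 1) → Fin n × Model d) :
    received (T := T + 1) j (Fin.cons x y) = Fin.cons (observe j (y 0)) (received j y) := by
  funext t
  refine Fin.cases rfl (fun s => rfl) t

/-- The expectation of a function of the view of `j`, for a run started at `x`. -/
def viewInt (p : Params n d Z) (D : Data n m Z) (j : Fin n) (T : ℕ) (x : Fin n × Model d)
    (φ : (Fin T → Model d ⊕ Unit) → ℝ≥0∞) : ℝ≥0∞ :=
  ∫⁻ y, φ (received j y) ∂pathLaw (roundStep p D) T x

lemma viewInt_zero (D : Data n m Z) (j : Fin n) (x : Fin n × Model d)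
    {φ : (Fin 0 → Model d ⊕ Unit) → ℝ≥0∞} (hφ : Measurable φ) :
    viewInt p D j 0 x φ = φ Fin.elim0 := by
  rw [viewInt, lintegral_pathLaw_zero _ _ (F := fun y => φ (received j y)) (hφ.comp (measurable_received j))]
  congr 1
  exact Subsingleton.elim _ _

/-- The starting state does not enter the view: the first entry is what `j` sees of the next state.
-/
lemma Params.Regular.viewInt_succ (hp : p.Regular m) (D : Data n m Z) (j : Fin n) (T : ℕ)
    (x : Fin n × Model d) {φ : (Fin (T + 1) → Model d ⊕ Unit) → ℝ≥0∞} (hφ : Measurable φ) :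
    viewInt p D j (T + 1) x φ =
      ∫⁻ x', viewInt p D j T x' (fun v => φ (Fin.cons (observe j x') v)) ∂roundStep p D x := by
  have hs := hp.measurable_roundStep D
  have hP := hp.isProbabilityMeasure_roundStep D
  have hm : Measurable fun y : Fin (T + 2) → Fin n × Model d => φ (received j y) :=
    hφ.comp (measurable_received j)
  unfold viewInt
  rw [lintegral_pathLaw_succ hs hP _ _ hm]
  refine lintegral_congr fun x' => lintegral_pathLaw_congr hs hP T x'
    (hm.comp (measurable_finCons_right x))
    (hφ.comp ((measurable_finCons_right _).comp (measurable_received j))) fun y hy => ?_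
  rw [received_cons, hy]

lemma Params.Regular.measurable_viewInt_cons (hp : p.Regular m) (D : Data n m Z) (j : Fin n) (T : ℕ)
    {A : Type*} [MeasurableSpace A] {g : A → Fin n × Model d} (hg : Measurable g)
    {o : A → Model d ⊕ Unit} (ho : Measurable o)
    {φ : (Fin (T + 1) → Model d ⊕ Unit) → ℝ≥0∞} (hφ : Measurable φ) :
    Measurable fun a => viewInt p D j T (g a) (fun v => φ (Fin.cons (o a) v)) :=
  measurable_lintegral_pathLaw (hp.measurable_roundStep D) (hp.isProbabilityMeasure_roundStep D) T hg
    (F := fun a y => φ (Fin.cons (o a) (received j y)))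
    (hφ.comp ((measurable_finCons T).comp
      ((ho.comp measurable_fst).prodMk ((measurable_received j).comp measurable_snd))))

/-- The number of models in a view. -/
def receipts {T : ℕ} (v : Fin T → Model d ⊕ Unit) : ℕ :=
  (Finset.univ.filter fun t => (v t).isLeft).card

/-- `φ` is constant on the views with more than `k` models. -/
def ConstAbove {T : ℕ} (k : ℕ) (φ : (Fin T → Model d ⊕ Unit) → ℝ≥0∞) : Prop :=
  ∃ c, ∀ v, k < receipts v → φ v = c

lemma receipts_cons {T : ℕ} (o : Model d ⊕ Unit) (v : Fin T → Model d ⊕ Unit) :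
    receipts (Fin.cons o v : Fin (T + 1) → Model d ⊕ Unit) =
      (if o.isLeft then 1 else 0) + receipts v := by
  unfold receipts
  rw [Finset.card_filter, Finset.card_filter, Fin.sum_univ_succ]
  rfl

lemma ConstAbove.cons_inl {T k : ℕ} {φ : (Fin (T + 1) → Model d ⊕ Unit) → ℝ≥0∞}
    (h : ConstAbove (k + 1) φ) (θ : Model d) :
    ConstAbove k fun v => φ (Fin.cons (Sum.inl θ) v) := by
  obtain ⟨c, hc⟩ := h
  exact ⟨c, fun v hv => hc _ (by rw [receipts_cons]; simp; omega)⟩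

lemma ConstAbove.cons_inr {T k : ℕ} {φ : (Fin (T + 1) → Model d ⊕ Unit) → ℝ≥0∞}
    (h : ConstAbove k φ) : ConstAbove k fun v => φ (Fin.cons (Sum.inr ()) v) := by
  obtain ⟨c, hc⟩ := h
  exact ⟨c, fun v hv => hc _ (by rw [receipts_cons]; simpa using hv)⟩

lemma IsTest.cons {T : ℕ} {φ : (Fin (T + 1) → Model d ⊕ Unit) → ℝ≥0∞} (h : IsTest φ)
    (o : Model d ⊕ Unit) : IsTest fun v : Fin T → Model d ⊕ Unit => φ (Fin.cons o v) :=
  ⟨h.1.comp (measurable_finCons_right o), fun _ => h.2 _⟩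

/-- The expectation of a test, split according to the time of the first visit to `j`, for two
datasets at once. -/
lemma Params.Regular.exists_viewInt_eq_sum (hp : p.Regular m) (D D' : Data n m Z) (j : Fin n)
    (k : ℕ) : ∀ (T : ℕ) (φ : (Fin T → Model d ⊕ Unit) → ℝ≥0∞), IsTest φ → ConstAbove (k + 1) φ →
      ∃ (ψ ψ' : ℕ → Model d → ℝ≥0∞) (c : ℝ≥0∞), (∀ t, Measurable (ψ t)) ∧
        (∀ t, Measurable (ψ' t)) ∧ c ≤ 1 ∧
        (∀ x, viewInt p D j T x φ =
          ∑ t ∈ Finset.range T, ∫⁻ θ, ψ t θ ∂passageLaw p D j t x + avoidProb p D j T x * c) ∧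
        (∀ x, viewInt p D' j T x φ =
          ∑ t ∈ Finset.range T, ∫⁻ θ, ψ' t θ ∂passageLaw p D' j t x + avoidProb p D' j T x * c) ∧
        ∀ t < T, ∀ θ, ∃ (T' : ℕ) (φ' : (Fin T' → Model d ⊕ Unit) → ℝ≥0∞), T' ≤ T ∧
          IsTest φ' ∧ ConstAbove k φ' ∧ ψ t θ = viewInt p D j T' (j, θ) φ' ∧
          ψ' t θ = viewInt p D' j T' (j, θ) φ' := by
  intro T
  induction T with
  | zero =>
    refine fun φ hφ _ => ⟨fun _ _ => 0, fun _ _ => 0, φ Fin.elim0, fun _ => measurable_const,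
      fun _ => measurable_const, hφ.2 _, fun x => ?_, fun x => ?_, by simp⟩ <;>
    simp [viewInt_zero _ _ _ hφ.1, avoidProb]
  | succ T ih =>
    intro φ hφ hk
    -- The constant `c` is the value of `φ` at the view without receipts, which is why one constant
    -- serves both datasets.
    obtain ⟨ψ, ψ', c, hψ, hψ', hc, h1, h2, h3⟩ := ih _ (hφ.cons (Sum.inr ())) hk.cons_inr
    have key : ∀ (E : Data n m Z) (χ : ℕ → Model d → ℝ≥0∞), (∀ t, Measurable (χ t)) →
        (∀ x, viewInt p E j T x (fun v => φ (Fin.cons (Sum.inr ()) v)) =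
          ∑ t ∈ Finset.range T, ∫⁻ θ, χ t θ ∂passageLaw p E j t x + avoidProb p E j T x * c) →
        ∃ χ₁ : ℕ → Model d → ℝ≥0∞, (∀ t, Measurable (χ₁ t)) ∧
          (∀ θ, χ₁ 0 θ = viewInt p E j T (j, θ) (fun v => φ (Fin.cons (Sum.inl θ) v))) ∧
          (∀ t, χ₁ (t + 1) = χ t) ∧ ∀ x, viewInt p E j (T + 1) x φ =
          ∑ t ∈ Finset.range (T + 1), ∫⁻ θ, χ₁ t θ ∂passageLaw p E j t x +
            avoidProb p E j (T + 1) x * c := by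
      intro E χ hχ hE
      -- A visit at time `1` contributes the acceptance probability of the rest of the run,
      -- restarted at `(j, θ)` with the first receipt fixed. All later passages keep their functions
      -- and shift by one.
      set χ₀ : Model d → ℝ≥0∞ :=
        fun θ => viewInt p E j T (j, θ) (fun v => φ (Fin.cons (Sum.inl θ) v)) with hχ₀
      have hχ₀m : Measurable χ₀ := hp.measurable_viewInt_cons E j T (g := fun θ => (j, θ))
        measurable_prodMk_left measurable_inl hφ.1
      refine ⟨fun t => Nat.casesOn t χ₀ χ, fun t => ?_, fun θ => rfl, fun t => rfl, fun x => ?_⟩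
      · cases t with
        | zero => exact hχ₀m
        | succ t => exact hχ t
      · rw [hp.viewInt_succ E j T x hφ.1, Finset.sum_range_succ', avoidProb]
        change _ = ∑ t ∈ Finset.range T, ∫⁻ θ, χ t θ ∂passageLaw p E j (t + 1) x +
          ∫⁻ θ, χ₀ θ ∂passageLaw p E j 0 x + _
        rw [hp.lintegral_passageLaw_zero E j x hχ₀m]
        simp_rw [fun t => hp.lintegral_passageLaw_succ E j t x (hχ t)]
        have hav : Measurable fun x' : Fin n × Model d =>
            if x'.1 = j then 0 else avoidProb p E j T x' :=
          Measurable.ite (measurableSet_fst_eq j) measurable_const (hp.measurable_avoidProb E j T)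
        have hini : Measurable fun x' : Fin n × Model d => if x'.1 = j then χ₀ x'.2 else 0 :=
          Measurable.ite (measurableSet_fst_eq j) (hχ₀m.comp measurable_snd) measurable_const
        rw [← lintegral_finsetSum' _ fun t _ => (Measurable.ite (measurableSet_fst_eq j)
              measurable_const (hp.measurable_lintegral_passageLaw E j t (hχ t))).aemeasurable,
          ← lintegral_mul_const _ hav,
          ← lintegral_add_right _ hini,
          ← lintegral_add_right _ (hav.mul_const c)]
        refine lintegral_congr fun x' => ?_
        by_cases h : x'.1 = j
        · have hx' : x' = (j, x'.2) := by rw [← h]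
          simp only [observe, h, if_true, Finset.sum_const_zero, zero_add, zero_mul, add_zero]
          rw [hχ₀]
          simp only
          rw [← hx']
        · simp only [observe, h, if_false, add_zero]
          exact hE x'
    obtain ⟨χ, hχ, hχ0, hχs, hχe⟩ := key D ψ hψ h1
    obtain ⟨χ', hχ', hχ0', hχs', hχe'⟩ := key D' ψ' hψ' h2
    refine ⟨χ, χ', c, hχ, hχ', hc, hχe, hχe', fun t ht θ => ?_⟩
    cases t with
    | zero => exact ⟨T, _, T.le_succ, hφ.cons (Sum.inl θ), hk.cons_inl θ, hχ0 θ, hχ0' θ⟩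
    | succ t =>
      rw [hχs, hχs']
      obtain ⟨T', φ', hT', h⟩ := h3 t (by omega) θ
      exact ⟨T', φ', hT'.trans T.le_succ, h⟩

end Runs

/-! ### Adaptive composition -/

section Composition

variable {X Y : Type*} [MeasurableSpace X] [MeasurableSpace Y]

lemma lintegral_eq_lintegral_rnDeriv_mul (B ν : Measure X) [SigmaFinite B] [SigmaFinite ν]
    (h : B ≪ ν) {ψ : X → ℝ≥0∞} (hψ : Measurable ψ) :
    ∫⁻ x, ψ x ∂B = ∫⁻ x, B.rnDeriv ν x * ψ x ∂ν := by
  conv_lhs => rw [← Measure.withDensity_rnDeriv_eq B ν h]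
  exact lintegral_withDensity_eq_lintegral_mul _ (Measure.measurable_rnDeriv B ν) hψ

/-- Adaptive composition: the first output has the law `B` or `B'`, and `ψ`, `ψ'` are the conditional
acceptance probabilities given the first output. -/
lemma lintegral_comp_le (B B' : Measure X) [IsFiniteMeasure B] [IsFiniteMeasure B'] {s : Set X}
    (hs : B sᶜ = 0) (hs' : B' sᶜ = 0) (μ : Measure Y) [SigmaFinite μ] {p q : Y → ℝ≥0∞}
    (hp : Measurable p) (hq : Measurable q) (hpt : ∀ᵐ y ∂μ, p y ≠ ∞) (hqt : ∀ᵐ y ∂μ, q y ≠ ∞)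
    {ψ ψ' : X → ℝ≥0∞} (hψ : Measurable ψ) (hψ' : Measurable ψ')
    (h : ∀ x ∈ s, ∀ a b : ℝ≥0∞, a ≠ ∞ → b ≠ ∞ →
      b * ψ' x ≤ a * ψ x + ∫⁻ y, (b * q y - a * p y) ∂μ)
    {c : ℝ≥0∞ → ℝ≥0∞ → ℝ≥0∞} (hc : ∀ a b, a ≠ ∞ → b ≠ ∞ → hockey B B' a b ≤ c a b)
    {a b : ℝ≥0∞} (ha : a ≠ ∞) (hb : b ≠ ∞) :
    b * ∫⁻ x, ψ' x ∂B' ≤ a * ∫⁻ x, ψ x ∂B + ∫⁻ y, c (a * p y) (b * q y) ∂μ := by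
  set ν := B + B'
  set r := B.rnDeriv ν
  set r' := B'.rnDeriv ν
  have hr : Measurable r := Measure.measurable_rnDeriv _ _
  have hr' : Measurable r' := Measure.measurable_rnDeriv _ _
  have hB : B ≪ ν := Measure.absolutelyContinuous_of_le (Measure.le_add_right le_rfl)
  have hB' : B' ≪ ν := Measure.absolutelyContinuous_of_le (Measure.le_add_left le_rfl)
  have hνs : ∀ᵐ x ∂ν, x ∈ s := by
    change ν sᶜ = 0
    simp [ν, hs, hs']
  rw [lintegral_eq_lintegral_rnDeriv_mul B ν hB hψ, lintegral_eq_lintegral_rnDeriv_mul B' ν hB' hψ',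
    ← lintegral_const_mul _ (f := fun x => B.rnDeriv ν x * ψ x) (hr.mul hψ),
    ← lintegral_const_mul _ (f := fun x => B'.rnDeriv ν x * ψ' x) (hr'.mul hψ')]
  have hj : Measurable fun z : X × Y => b * r' z.1 * q z.2 - a * r z.1 * p z.2 := by fun_prop
  calc ∫⁻ x, b * (r' x * ψ' x) ∂ν
      ≤ ∫⁻ x, (a * (r x * ψ x) + ∫⁻ y, (b * r' x * q y - a * r x * p y) ∂μ) ∂ν := by
        refine lintegral_mono_ae ?_
        filter_upwards [hνs, Measure.rnDeriv_ne_top B ν, Measure.rnDeriv_ne_top B' ν]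
          with x hx h1 h2
        -- The bound on the second stage is used with coefficients multiplied by the densities of
        -- the first output; this is why the divergences carry two parameters.
        have := h x hx (a * r x) (b * r' x) (ENNReal.mul_ne_top ha h1) (ENNReal.mul_ne_top hb h2)
        rwa [mul_assoc, mul_assoc] at this
    _ = ∫⁻ x, a * (r x * ψ x) ∂ν + ∫⁻ x, ∫⁻ y, (b * r' x * q y - a * r x * p y) ∂μ ∂ν :=
        lintegral_add_left ((hr.mul hψ).const_mul a) _
    _ = ∫⁻ x, a * (r x * ψ x) ∂ν + ∫⁻ y, ∫⁻ x, (b * r' x * q y - a * r x * p y) ∂ν ∂μ := by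
        -- After Tonelli, the inner integral at fixed `y` is the divergence of `(B, B')` at `(a
        -- p(y), b q(y))`.
        rw [lintegral_lintegral_swap (f := fun x y => b * r' x * q y - a * r x * p y)
          hj.aemeasurable]
    _ ≤ _ := by
        gcongr 1
        refine lintegral_mono_ae ?_
        filter_upwards [hpt, hqt] with y h1 h2
        refine le_trans (le_of_eq ?_) (hc _ _ (ENNReal.mul_ne_top ha h1) (ENNReal.mul_ne_top hb h2))
        refine lintegral_congr fun x => ?_
        rw [mul_right_comm b, mul_right_comm a]

/-- The divergences of `P₀ × P` and `Q₀ × Q` from those of `P₀` and `Q₀`. -/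
lemma lintegral_hockey_le_hockey_prod (P₀ Q₀ : Measure X) (P Q : Measure Y) [IsFiniteMeasure P₀]
    [IsFiniteMeasure Q₀] [IsFiniteMeasure P] [IsFiniteMeasure Q] {a : ℝ≥0∞} (ha : a ≠ ∞)
    (b : ℝ≥0∞) :
    ∫⁻ y, hockey P₀ Q₀ (a * P.rnDeriv (P + Q) y) (b * Q.rnDeriv (P + Q) y) ∂(P + Q) ≤
      hockey (P₀.prod P) (Q₀.prod Q) a b := by
  set ν := P₀ + Q₀
  set μ := P + Q
  set p₀ := P₀.rnDeriv ν
  set q₀ := Q₀.rnDeriv ν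
  set p := P.rnDeriv μ
  set q := Q.rnDeriv μ
  have hp₀ : Measurable p₀ := Measure.measurable_rnDeriv _ _
  have hq₀ : Measurable q₀ := Measure.measurable_rnDeriv _ _
  have hp : Measurable p := Measure.measurable_rnDeriv _ _
  have hq : Measurable q := Measure.measurable_rnDeriv _ _
  have hP : P₀.prod P = (ν.prod μ).withDensity fun z => p₀ z.1 * p z.2 := by
    rw [← prod_withDensity hp₀ hp]
    congr 1
    · exact (withDensity_rnDeriv_add_left P₀ Q₀).symm
    · exact (withDensity_rnDeriv_add_left P Q).symm
  have hQ : Q₀.prod Q = (ν.prod μ).withDensity fun z => q₀ z.1 * q z.2 := by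
    rw [← prod_withDensity hq₀ hq]
    congr 1
    · exact (withDensity_rnDeriv_add_right P₀ Q₀).symm
    · exact (withDensity_rnDeriv_add_right P Q).symm
  have hPf : IsFiniteMeasure ((ν.prod μ).withDensity fun z => p₀ z.1 * p z.2) := by
    rw [← hP]; infer_instance
  have hQf : IsFiniteMeasure ((ν.prod μ).withDensity fun z => q₀ z.1 * q z.2) := by
    rw [← hQ]; infer_instance
  have h := lintegral_tsub_le_hockey (ν.prod μ) (p := fun z => p₀ z.1 * p z.2)
    (q := fun z => q₀ z.1 * q z.2) (by fun_prop) (by fun_prop) ha b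
  rw [← hP, ← hQ, lintegral_prod_symm _ (by fun_prop)] at h
  refine le_trans (le_of_eq ?_) h
  refine lintegral_congr fun y => lintegral_congr fun x => ?_
  change b * q y * q₀ x - a * p y * p₀ x = b * (q₀ x * q y) - a * (p₀ x * p y)
  rw [mul_assoc, mul_assoc, mul_comm (q y), mul_comm (p y)]

/-- The divergences of the `k`-fold products. -/
def hockeyPow (P Q : Measure X) (k : ℕ) : ℝ≥0∞ → ℝ≥0∞ → ℝ≥0∞ :=
  hockey (Measure.pi fun _ : Fin k => P) (Measure.pi fun _ : Fin k => Q)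

/-- The first coordinate of the power is split off, and data processing passes through the
measurable equivalence. -/
lemma lintegral_hockey_le_hockeyPow_succ (P Q : Measure X) [IsProbabilityMeasure P]
    [IsProbabilityMeasure Q] (k : ℕ) {a : ℝ≥0∞} (ha : a ≠ ∞) (b : ℝ≥0∞) :
    ∫⁻ y, hockey P Q
        (a * (Measure.pi fun _ : Fin k => P).rnDeriv
          ((Measure.pi fun _ : Fin k => P) + Measure.pi fun _ : Fin k => Q) y)
        (b * (Measure.pi fun _ : Fin k => Q).rnDeriv
          ((Measure.pi fun _ : Fin k => P) + Measure.pi fun _ : Fin k => Q) y)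
        ∂((Measure.pi fun _ : Fin k => P) + Measure.pi fun _ : Fin k => Q) ≤
      hockeyPow P Q (k + 1) a b := by
  refine (lintegral_hockey_le_hockey_prod P Q _ _ ha b).trans ?_
  have hP := (measurePreserving_piFinSuccAbove (fun _ : Fin (k + 1) => P) 0).map_eq
  have hQ := (measurePreserving_piFinSuccAbove (fun _ : Fin (k + 1) => Q) 0).map_eq
  rw [← hP, ← hQ]
  exact hockey_map_le _ _ (MeasurableEquiv.measurable _) ha b

/-- An extra factor only helps to distinguish: the integrand `(b q - a p)⁺` is at most the
divergence of `(P, Q)` at `(a p, b q)`, by the test that always rejects. -/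
lemma hockeyPow_le_succ (P Q : Measure X) [IsProbabilityMeasure P]
    [IsProbabilityMeasure Q] (k : ℕ) {a : ℝ≥0∞} (ha : a ≠ ∞) (b : ℝ≥0∞) :
    hockeyPow P Q k a b ≤ hockeyPow P Q (k + 1) a b :=
  (lintegral_mono fun _ => tsub_le_hockey P Q _ _).trans
    (lintegral_hockey_le_hockeyPow_succ P Q k ha b)

lemma tsub_le_hockeyPow (P Q : Measure X) [IsProbabilityMeasure P]
    [IsProbabilityMeasure Q] (k : ℕ) (a b : ℝ≥0∞) : b - a ≤ hockeyPow P Q k a b :=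
  tsub_le_hockey _ _ a b

/-- An event of the same probability `e` under both hypotheses costs at most `(b - a)⁺`. -/
lemma mul_le_mul_add_tsub {e : ℝ≥0∞} (he : e ≤ 1) (a b : ℝ≥0∞) : b * e ≤ a * e + (b - a) :=
  calc b * e ≤ (a + (b - a)) * e := by gcongr; exact le_add_tsub
    _ = a * e + (b - a) * e := by ring
    _ ≤ a * e + (b - a) * 1 := by gcongr
    _ = _ := by rw [mul_one]

end Composition

/-! ### The view of a user -/

section View

variable {n d : ℕ} {Z : Type*} {m : Fin n → ℕ} {p : Params n d Z}

lemma localRun_congr (p : Params n d Z) {D D' : Data n m Z} {k : Fin n} (h : D k = D' k) :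
    ∀ (K : ℕ), localRun p D k K = localRun p D' k K := by
  have hs : localStep p D k = localStep p D' k := by
    funext θ
    simp only [localStep, batchGrad, h]
  intro K
  induction K with
  | zero => rfl
  | succ K ih =>
    funext θ
    rw [localRun, localRun, hs, ih]

lemma roundStep_congr (p : Params n d Z) {D D' : Data n m Z} {x : Fin n × Model d}
    (h : D x.1 = D' x.1) : roundStep p D x = roundStep p D' x := by
  rw [roundStep, roundStep, localRun_congr p h]

/-- The mass is `1`, or `0` when the conditioning event is null. Mass at most `1` already makes the
trade-off values nonnegative, so the zero function is a competitor in `perVisit`. -/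
lemma firstModelLaw_univ_le_one (p : Params n d Z) (D : Data n m Z) (i j : Fin n) (t : ℕ)
    (θ : Model d) : firstModelLaw p D i j t θ Set.univ ≤ 1 := by
  rw [firstModelLaw, Measure.map_apply (by fun_prop) MeasurableSet.univ, Set.preimage_univ, ProbabilityTheory.cond, Measure.smul_apply,
    Measure.restrict_apply_univ, smul_eq_mul]
  exact ENNReal.inv_mul_le_one _

lemma isTradeoff_perVisit (p : Params n d Z) (D D' : Data n m Z) (i j : Fin n) (t : ℕ) :
    IsTradeoff (perVisit p D D' i j t) := by
  refine isTradeoff_sSup (C := fun h => ∀ θ ∈ p.domain, Dominates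
    (tradeoff (firstModelLaw p D i j t θ) (firstModelLaw p D' i j t θ)) h)
    ⟨0, isTradeoff_zero, fun θ _ α hα => le_tradeoff_of_test _ _ hα.1 fun φ hφ _ => ?_⟩
  have h : ∫⁻ x, φ x ∂firstModelLaw p D' i j t θ ≤ 1 :=
    (lintegral_mono hφ.2).trans (by simpa using firstModelLaw_univ_le_one p D' i j t θ)
  have := ENNReal.toReal_mono ENNReal.one_ne_top h
  simp at this
  simpa using this

lemma dominates_perVisit (p : Params n d Z) (D D' : Data n m Z) (i j : Fin n) (t : ℕ)
    {θ : Model d} (hθ : θ ∈ p.domain) :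
    Dominates (tradeoff (firstModelLaw p D i j t θ) (firstModelLaw p D' i j t θ))
      (perVisit p D D' i j t) := by
  refine fun α hα => Real.sSup_le ?_ ?_
  · rintro _ ⟨h, -, hh, rfl⟩
    exact hh θ hθ α hα
  · refine le_tradeoff_of_test _ _ hα.1 fun φ hφ _ => ?_
    have h : ∫⁻ x, φ x ∂firstModelLaw p D' i j t θ ≤ 1 :=
      (lintegral_mono hφ.2).trans (by simpa using firstModelLaw_univ_le_one p D' i j t θ)
    have := ENNReal.toReal_mono ENNReal.one_ne_top h
    simp at this
    simpa using this

/-- The common hitting probability factors out, and the conditional laws are compared through the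
per-visit function. If it is zero, the passage law on the left vanishes. -/
lemma Params.Regular.hockey_passageLaw_le (hp : p.Regular m) (D D' : Data n m Z) (i j : Fin n)
    (t : ℕ) {θ : Model d} (hθ : θ ∈ p.domain) {a b : ℝ≥0∞} (ha : a ≠ ∞) (hb : b ≠ ∞) :
    hockey (passageLaw p D j t (i, θ)) (passageLaw p D' j t (i, θ)) a b ≤
      ENNReal.ofReal (hitProb p.W i j (t + 1)) * hockeyOf (perVisit p D D' i j (t + 1)) a b := by
  have := hp.isFiniteMeasure_passageLaw D j t (i, θ)
  have := hp.isFiniteMeasure_passageLaw D' j t (i, θ)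
  have hT := (isTradeoff_perVisit p D D' i j (t + 1)).shape
  have := hT.isProbabilityMeasure_canonicalAlt
  refine hockey_le_of_forall_test _ _ ha fun φ hφ => ?_
  by_cases h : hitProb p.W i j (t + 1) = 0
  · have h0 : passageLaw p D' j t (i, θ) = 0 := by
      rw [← Measure.measure_univ_eq_zero, hp.passageLaw_univ, h, ENNReal.ofReal_zero]
    simp [h0]
  · obtain ⟨hP, hPe⟩ := hp.passageLaw_eq_smul D i j t θ h
    obtain ⟨hP', hPe'⟩ := hp.passageLaw_eq_smul D' i j t θ h
    set w := ENNReal.ofReal (hitProb p.W i j (t + 1))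
    rw [hPe, hPe', lintegral_smul_measure, lintegral_smul_measure, smul_eq_mul, smul_eq_mul]
    calc b * (w * ∫⁻ x, φ x ∂firstModelLaw p D' i j (t + 1) θ)
        = w * (b * ∫⁻ x, φ x ∂firstModelLaw p D' i j (t + 1) θ) := by ring
      _ ≤ w * (a * ∫⁻ x, φ x ∂firstModelLaw p D i j (t + 1) θ +
          hockey (firstModelLaw p D i j (t + 1) θ) (firstModelLaw p D' i j (t + 1) θ) a b) := by
        gcongr; exact test_le_add_hockey _ _ hφ a b
      _ ≤ w * (a * ∫⁻ x, φ x ∂firstModelLaw p D i j (t + 1) θ +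
          hockeyOf (perVisit p D D' i j (t + 1)) a b) := by
        gcongr
        refine hockey_le_of_dominates _ _ _ _ (fun α hα => ?_) ha hb
        rw [hT.tradeoff_canonical hα]
        exact dominates_perVisit p D D' i j (t + 1) hθ α hα
      _ = _ := by ring

/-- The mixture bound for a shorter horizon. -/
lemma Params.Regular.sum_hockeyOf_le (hp : p.Regular m) (D D' : Data n m Z) (i j : Fin n)
    {T₀ : ℕ} {g : ℝ → ℝ} (hg : IsSingle T₀ (hitProb p.W i j) (perVisit p D D' i j) g) {T : ℕ}
    (hT : T ≤ T₀) {a b : ℝ≥0∞} (ha : a ≠ ∞) (hb : b ≠ ∞) :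
    ∑ t ∈ Finset.range T, ENNReal.ofReal (hitProb p.W i j (t + 1)) *
        hockeyOf (perVisit p D D' i j (t + 1)) a b +
      ENNReal.ofReal (1 - ∑ t ∈ Finset.range T, hitProb p.W i j (t + 1)) * (b - a) ≤
      hockeyOf g a b := by
  have hmix := hg.mixture_le_hockeyOf (fun t => measureReal_nonneg)
    (hp.sum_hitProb_le_one D i j T₀) (isTradeoff_perVisit p D D' i j) ha hb
  rw [sum_Icc_eq_sum_range, sum_Icc_eq_sum_range] at hmix
  refine le_trans ?_ hmix
  -- The left side increases with the horizon: one more time step moves weight from the perfectly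
  -- private component, of divergence `b - a`, to a component whose divergence is at least that.
  refine monotone_nat_of_le_succ (f := fun T =>
    ∑ t ∈ Finset.range T, ENNReal.ofReal (hitProb p.W i j (t + 1)) *
        hockeyOf (perVisit p D D' i j (t + 1)) a b +
      ENNReal.ofReal (1 - ∑ t ∈ Finset.range T, hitProb p.W i j (t + 1)) * (b - a))
    (fun T => ?_) hT
  rw [Finset.sum_range_succ, Finset.sum_range_succ]
  have h1 := hp.sum_hitProb_le_one D i j (T + 1)
  rw [sum_Icc_eq_sum_range, Finset.sum_range_succ] at h1
  have h0 : 0 ≤ hitProb p.W i j (T + 1) := measureReal_nonneg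
  have hsplit : ENNReal.ofReal (1 - ∑ t ∈ Finset.range T, hitProb p.W i j (t + 1)) =
      ENNReal.ofReal (hitProb p.W i j (T + 1)) + ENNReal.ofReal
        (1 - (∑ t ∈ Finset.range T, hitProb p.W i j (t + 1) + hitProb p.W i j (T + 1))) := by
    rw [← ENNReal.ofReal_add h0 (by linarith)]
    congr 1
    ring
  have := (isTradeoff_perVisit p D D' i j (T + 1)).shape.isProbabilityMeasure_canonicalAlt
  rw [hsplit, add_mul, ← add_assoc]
  gcongr
  exact tsub_le_hockey _ _ a b

/-- Such a test only uses whether `j` is visited, which is a function of the walk, and the law of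
the walk does not involve the data. -/
lemma Params.Regular.viewInt_eq_of_constAbove_zero (hp : p.Regular m) (D D' : Data n m Z)
    (j : Fin n) {T : ℕ} (x : Fin n × Model d) {φ : (Fin T → Model d ⊕ Unit) → ℝ≥0∞}
    (hk : ConstAbove 0 φ) : viewInt p D' j T x φ = viewInt p D j T x φ := by
  obtain ⟨c, hc⟩ := hk
  classical
  let F : (Fin (T + 1) → Fin n) → ℝ≥0∞ := fun u =>
    if ∀ t : Fin T, u t.succ ≠ j then φ fun _ => Sum.inr () else c
  have hF : ∀ y : Fin (T + 1) → Fin n × Model d, φ (received j y) = F (users y) := fun y => by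
    by_cases h : ∀ t : Fin T, users y t.succ ≠ j
    · simp only [F, if_pos h]
      congr 1
      funext t
      exact if_neg (h t)
    · simp only [F, if_neg h]
      push Not at h
      obtain ⟨t, ht⟩ := h
      refine hc _ (Finset.card_pos.2 ⟨t, ?_⟩)
      have : received j y t = Sum.inl (y t.succ).2 := if_pos ht
      simp [this]
  unfold viewInt
  simp_rw [hF]
  rw [hp.lintegral_users D', hp.lintegral_users D]

lemma viewInt_le_one (hp : p.Regular m) (D : Data n m Z) (j : Fin n) {T : ℕ} (x : Fin n × Model d)
    {φ : (Fin T → Model d ⊕ Unit) → ℝ≥0∞} (hφ : IsTest φ) : viewInt p D j T x φ ≤ 1 := by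
  have := isProbabilityMeasure_pathLaw (hp.measurable_roundStep D)
    (hp.isProbabilityMeasure_roundStep D) T x
  exact (lintegral_mono fun y => hφ.2 _).trans (by simp)

/-- The passage from `k` to `k + 1` receipts, for a run that starts at the user whose data differ. -/
lemma Params.Regular.viewInt_le_of_start (hp : p.Regular m) {D D' : Data n m Z} {i j : Fin n}
    {T₀ : ℕ} {g : ℝ → ℝ} (hg : IsSingle T₀ (hitProb p.W i j) (perVisit p D D' i j) g)
    {X : Type} [MeasurableSpace X] {P Q : Measure X} (hPQ : Represents P Q g) (k : ℕ)
    (ih : ∀ (T : ℕ), T ≤ T₀ → ∀ φ : (Fin T → Model d ⊕ Unit) → ℝ≥0∞, IsTest φ → ConstAbove k φ →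
      ∀ θ ∈ p.domain, ∀ a b : ℝ≥0∞, a ≠ ∞ → b ≠ ∞ →
        b * viewInt p D' j T (j, θ) φ ≤ a * viewInt p D j T (j, θ) φ + hockeyPow P Q k a b)
    {T : ℕ} (hT : T ≤ T₀) {φ : (Fin T → Model d ⊕ Unit) → ℝ≥0∞} (hφ : IsTest φ)
    (hk : ConstAbove (k + 1) φ) {θ : Model d} (hθ : θ ∈ p.domain) {a b : ℝ≥0∞} (ha : a ≠ ∞)
    (hb : b ≠ ∞) :
    b * viewInt p D' j T (i, θ) φ ≤ a * viewInt p D j T (i, θ) φ + hockeyPow P Q (k + 1) a b := by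
  obtain ⟨hP, hQ, hPQ'⟩ := hPQ
  set Pk := Measure.pi fun _ : Fin k => P with hPk
  set Qk := Measure.pi fun _ : Fin k => Q with hQk
  set μ := Pk + Qk
  set pk := Pk.rnDeriv μ
  set qk := Qk.rnDeriv μ
  have hpk : Measurable pk := Measure.measurable_rnDeriv _ _
  have hqk : Measurable qk := Measure.measurable_rnDeriv _ _
  have hpt : ∀ᵐ y ∂μ, pk y ≠ ∞ := Measure.rnDeriv_ne_top _ _
  have hqt : ∀ᵐ y ∂μ, qk y ≠ ∞ := Measure.rnDeriv_ne_top _ _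
  obtain ⟨ψ, ψ', c, hψ, hψ', hc, h1, h2, h3⟩ := hp.exists_viewInt_eq_sum D D' j k T φ hφ hk
  set w : ℕ → ℝ≥0∞ := fun t => ENNReal.ofReal (hitProb p.W i j (t + 1))
  set v := ENNReal.ofReal (1 - ∑ t ∈ Finset.range T, hitProb p.W i j (t + 1))
  set H : ℕ → ℝ≥0∞ → ℝ≥0∞ → ℝ≥0∞ := fun t => hockeyOf (perVisit p D D' i j (t + 1))
  -- Composition at a first passage: the first output is the model received by `j`, and from it the
  -- run continues with `k` receipts, to which `ih` applies.
  have hterm : ∀ t ∈ Finset.range T,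
      b * ∫⁻ x, ψ' t x ∂passageLaw p D' j t (i, θ) ≤ a * ∫⁻ x, ψ t x ∂passageLaw p D j t (i, θ) +
        ∫⁻ y, w t * H t (a * pk y) (b * qk y) ∂μ := fun t ht => by
    have := hp.isFiniteMeasure_passageLaw D j t (i, θ)
    have := hp.isFiniteMeasure_passageLaw D' j t (i, θ)
    refine lintegral_comp_le _ _ (hp.passageLaw_compl_domain D j t _)
      (hp.passageLaw_compl_domain D' j t _) μ hpk hqk hpt hqt (hψ t) (hψ' t) ?_
      (c := fun a b => w t * H t a b) (fun a b ha hb => hp.hockey_passageLaw_le D D' i j t hθ ha hb)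
      ha hb
    intro θ' hθ' a b ha hb
    obtain ⟨T', φ', hT', hφ', hk', he, he'⟩ := h3 t (Finset.mem_range.1 ht) θ'
    rw [he, he']
    exact ih T' (hT'.trans hT) φ' hφ' hk' θ' hθ' a b ha hb
  have hHm : ∀ t, Measurable fun y => w t * H t (a * pk y) (b * qk y) := fun t => by
    have := (isTradeoff_perVisit p D D' i j (t + 1)).shape.isProbabilityMeasure_canonicalAlt
    refine Measurable.const_mul ?_ _
    exact (measurable_hockey _ _).comp ((hpk.const_mul a).prodMk (hqk.const_mul b))
  -- Without a visit, both datasets give the same contribution.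
  have hrest : b * (v * c) ≤ a * (v * c) + ∫⁻ y, v * (b * qk y - a * pk y) ∂μ := by
    rw [lintegral_const_mul v (f := fun y => b * qk y - a * pk y)
      ((hqk.const_mul b).sub (hpk.const_mul a))]
    calc b * (v * c) = v * (b * c) := by ring
      _ ≤ v * (a * c + (b - a)) := by gcongr; exact mul_le_mul_add_tsub hc a b
      _ ≤ v * (a * c + hockeyPow P Q k a b) := by gcongr; exact tsub_le_hockeyPow P Q k a b
      _ = a * (v * c) + v * hockeyPow P Q k a b := by ring
  rw [h1, h2, hp.avoidProb_eq D i j T θ, hp.avoidProb_eq D' i j T θ]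
  calc b * (∑ t ∈ Finset.range T, ∫⁻ x, ψ' t x ∂passageLaw p D' j t (i, θ) + v * c)
      = ∑ t ∈ Finset.range T, b * ∫⁻ x, ψ' t x ∂passageLaw p D' j t (i, θ) + b * (v * c) := by
        rw [mul_add, Finset.mul_sum]
    _ ≤ ∑ t ∈ Finset.range T, (a * ∫⁻ x, ψ t x ∂passageLaw p D j t (i, θ) +
          ∫⁻ y, w t * H t (a * pk y) (b * qk y) ∂μ) +
          (a * (v * c) + ∫⁻ y, v * (b * qk y - a * pk y) ∂μ) :=
        add_le_add (Finset.sum_le_sum hterm) hrest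
    _ = a * (∑ t ∈ Finset.range T, ∫⁻ x, ψ t x ∂passageLaw p D j t (i, θ) + v * c) +
          ∫⁻ y, (∑ t ∈ Finset.range T, w t * H t (a * pk y) (b * qk y) +
            v * (b * qk y - a * pk y)) ∂μ := by
        rw [lintegral_add_left (Finset.measurable_sum _ fun t _ => hHm t),
          lintegral_finsetSum' _ fun t _ => (hHm t).aemeasurable, Finset.sum_add_distrib, mul_add,
          Finset.mul_sum]
        ring
    _ ≤ a * (∑ t ∈ Finset.range T, ∫⁻ x, ψ t x ∂passageLaw p D j t (i, θ) + v * c) +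
          ∫⁻ y, hockey P Q (a * pk y) (b * qk y) ∂μ := by
        gcongr 1
        refine lintegral_mono_ae ?_
        filter_upwards [hpt, hqt] with y hy1 hy2
        have ha' := ENNReal.mul_ne_top ha hy1
        have hb' := ENNReal.mul_ne_top hb hy2
        rw [hockey_eq_hockeyOf ⟨hP, hQ, hPQ'⟩ ha' hb']
        exact hp.sum_hockeyOf_le D D' i j hg hT ha' hb'
    _ ≤ _ := by
        gcongr
        exact lintegral_hockey_le_hockeyPow_succ P Q k ha b

/-- Every test on a view that ignores all but the first `k` receipts is bounded by the `k`-fold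
product of the single-visit pair. -/
theorem Params.Regular.viewInt_le (hp : p.Regular m) {D D' : Data n m Z} {i j : Fin n}
    (hD : ∀ k, k ≠ i → D k = D' k) {T₀ : ℕ} {g : ℝ → ℝ}
    (hg : IsSingle T₀ (hitProb p.W i j) (perVisit p D D' i j) g)
    {X : Type} [MeasurableSpace X] {P Q : Measure X} (hPQ : Represents P Q g) (k : ℕ) :
    ∀ (T : ℕ), T ≤ T₀ → ∀ φ : (Fin T → Model d ⊕ Unit) → ℝ≥0∞, IsTest φ → ConstAbove k φ →
      ∀ x : Fin n × Model d, x.2 ∈ p.domain → ∀ a b : ℝ≥0∞, a ≠ ∞ → b ≠ ∞ →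
        b * viewInt p D' j T x φ ≤ a * viewInt p D j T x φ + hockeyPow P Q k a b := by
  have hP := hPQ.1
  have hQ := hPQ.2.1
  induction k with
  | zero =>
    intro T _ φ hφ hk x _ a b _ _
    rw [hp.viewInt_eq_of_constAbove_zero D D' j x hk]
    exact (mul_le_mul_add_tsub (viewInt_le_one hp D j x hφ) a b).trans
      (add_le_add_right (tsub_le_hockeyPow P Q 0 a b) _)
  | succ k ihk =>
    intro T
    induction T with
    | zero =>
      intro _ φ hφ _ x _ a b _ _
      rw [viewInt_zero _ _ _ hφ.1, viewInt_zero _ _ _ hφ.1]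
      exact (mul_le_mul_add_tsub (hφ.2 _) a b).trans
        (add_le_add_right (tsub_le_hockeyPow P Q _ a b) _)
    | succ T ihT =>
      intro hT φ hφ hk x hx a b ha hb
      -- At user `i` the first passage to `j` is composed with the rest. At any other user a single
      -- round is peeled off.
      by_cases hxi : x.1 = i
      · obtain ⟨l, θ⟩ := x
        obtain rfl : l = i := hxi
        exact hp.viewInt_le_of_start hg hPQ k
          (fun T hT φ hφ hk θ hθ => ihk T hT φ hφ hk (j, θ) hθ) hT hφ hk hx ha hb
      -- The data of the active user agree, so the first step has one law for both datasets and its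
      -- output can be conditioned on at no cost.
      · have hstep := roundStep_congr p (hD x.1 hxi)
        have hprob := hp.isProbabilityMeasure_roundStep D x
        have hm : ∀ E : Data n m Z, Measurable fun x' =>
            viewInt p E j T x' (fun v => φ (Fin.cons (observe j x') v)) := fun E =>
          hp.measurable_viewInt_cons E j T measurable_id (measurable_observe j) hφ.1
        rw [hp.viewInt_succ D' j T x hφ.1, hp.viewInt_succ D j T x hφ.1, ← hstep,
          ← lintegral_const_mul _ (hm D'), ← lintegral_const_mul _ (hm D)]
        calc _ ≤ ∫⁻ x', (a * viewInt p D j T x' (fun v => φ (Fin.cons (observe j x') v)) +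
              hockeyPow P Q (k + 1) a b) ∂roundStep p D x := by
              refine lintegral_mono_ae ?_
              filter_upwards [hp.ae_roundStep D x] with x' hx'
              by_cases hj : x'.1 = j
              · simp only [observe, hj, if_true]
                -- A receipt before the walk meets `i` carries no information about the record; it
                -- uses up one of the `k + 1` receipts, and the bound with `k` factors is weaker
                -- than needed only by monotonicity.
                exact (ihk T (by omega) _ (hφ.cons _) (hk.cons_inl _) x' hx' a b ha hb).trans
                  (add_le_add_right (hockeyPow_le_succ P Q k ha b) _)
              · simp only [observe, hj, if_false]
                exact ihT (by omega) _ (hφ.cons _) hk.cons_inr x' hx' a b ha hb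
          _ = _ := by
              rw [lintegral_add_right _ measurable_const]
              simp

end View

/-! ### Hyperbolic inequalities -/

section Hyperbolic

lemma sinh_le_mul_cosh {x : ℝ} (hx : 0 ≤ x) : Real.sinh x ≤ x * Real.cosh x := by
  have hd : ∀ y : ℝ, HasDerivAt (fun y => y * Real.cosh y - Real.sinh y) (y * Real.sinh y) y :=
    fun y => by
      refine (((hasDerivAt_id' y).mul (Real.hasDerivAt_cosh y)).sub
        (Real.hasDerivAt_sinh y)).congr_deriv ?_
      ring
  have hm : MonotoneOn (fun y => y * Real.cosh y - Real.sinh y) (Set.Ici 0) := by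
    refine monotoneOn_of_deriv_nonneg (convex_Ici 0)
      (fun y _ => (hd y).continuousAt.continuousWithinAt)
      (fun y _ => (hd y).differentiableAt.differentiableWithinAt) fun y hy => ?_
    rw [interior_Ici] at hy
    rw [(hd y).deriv]
    exact mul_nonneg (le_of_lt hy) (Real.sinh_nonneg_iff.2 (le_of_lt hy))
  have := hm Set.self_mem_Ici hx hx
  simp at this
  linarith

lemma tendsto_sinh_div_self :
    Filter.Tendsto (fun x : ℝ => Real.sinh x / x) (nhdsWithin 0 (Set.Ioi 0)) (nhds 1) := by
  have h := (Real.hasDerivAt_sinh 0).tendsto_slope_zero_right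
  simp only [zero_add, Real.sinh_zero, sub_zero, Real.cosh_zero, smul_eq_mul] at h
  exact h.congr fun x => by rw [div_eq_inv_mul]

/-- The difference of the two sides tends to `0` at `0+` and has derivative `(y coth y - 1)² / y ≥
0`. -/
lemma log_sinh_div_add_le {x : ℝ} (hx : 0 < x) :
    Real.log (Real.sinh x / x) + x * (Real.cosh x / Real.sinh x) ≤ 1 + x ^ 2 / 2 := by
  set g : ℝ → ℝ := fun x =>
    1 + x ^ 2 / 2 - x * (Real.cosh x / Real.sinh x) - Real.log (Real.sinh x / x) with hg
  have hd : ∀ y : ℝ, 0 < y →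
      HasDerivAt g ((y * (Real.cosh y / Real.sinh y) - 1) ^ 2 / y) y := fun y hy => by
    have hs : Real.sinh y ≠ 0 := (Real.sinh_pos_iff.2 hy).ne'
    have h1 : HasDerivAt (fun x : ℝ => 1 + x ^ 2 / 2) y y := by
      refine (((hasDerivAt_pow 2 y).div_const 2).const_add 1).congr_deriv ?_
      norm_num
    have h2 := (hasDerivAt_id' y).mul ((Real.hasDerivAt_cosh y).div (Real.hasDerivAt_sinh y) hs)
    have h3 := ((Real.hasDerivAt_sinh y).div (hasDerivAt_id' y) hy.ne').log
      (div_ne_zero hs hy.ne')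
    refine ((h1.sub h2).sub h3).congr_deriv ?_
    simp only [Pi.div_apply]
    field_simp
    ring
  have hm : MonotoneOn g (Set.Ioi 0) := by
    refine monotoneOn_of_deriv_nonneg (convex_Ioi 0)
      (fun y hy => (hd y hy).continuousAt.continuousWithinAt)
      (fun y hy => (hd y (interior_subset hy)).differentiableAt.differentiableWithinAt)
      fun y hy => ?_
    have hy0 : 0 < y := interior_subset hy
    rw [(hd y hy0).deriv]
    positivity
  have hlim : Filter.Tendsto g (nhdsWithin 0 (Set.Ioi 0)) (nhds 0) := by
    have hid : Filter.Tendsto (fun x : ℝ => x) (nhdsWithin 0 (Set.Ioi 0)) (nhds 0) :=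
      Filter.tendsto_id.mono_left nhdsWithin_le_nhds
    have hcosh : Filter.Tendsto Real.cosh (nhdsWithin 0 (Set.Ioi 0)) (nhds 1) := by
      have := (Real.continuous_cosh.tendsto 0).mono_left (nhdsWithin_le_nhds (s := Set.Ioi 0))
      rwa [Real.cosh_zero] at this
    have h1 := ((hid.pow 2).div_const 2).const_add 1
    have h2 := hcosh.div tendsto_sinh_div_self one_ne_zero
    have h3 := tendsto_sinh_div_self.log one_ne_zero
    have := (h1.sub h2).sub h3
    norm_num at this
    refine this.congr fun x => ?_
    simp only [hg]
    rw [div_div_eq_mul_div, mul_comm (Real.cosh x) x, mul_div_assoc]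
  have h0 : 0 ≤ g x := by
    refine le_of_tendsto hlim ?_
    filter_upwards [Ioo_mem_nhdsGT hx] with y hy
    exact hm hy.1 hx hy.2.le
  simp only [hg] at h0
  linarith

/-- The difference of the sides has derivative `coth y (coth y - coth ψ)`, which is nonpositive for
`y ≥ ψ` because `coth` decreases. -/
lemma sub_coth_le {ψ u : ℝ} (hψ : 0 < ψ) (hu : ψ ≤ u) :
    u - Real.cosh u / Real.sinh u ≤ ψ - Real.cosh ψ / Real.sinh ψ +
      Real.cosh ψ / Real.sinh ψ * Real.log (Real.sinh u / Real.sinh ψ) := by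
  have hψs := Real.sinh_pos_iff.2 hψ
  set κ := Real.cosh ψ / Real.sinh ψ with hκ
  set g : ℝ → ℝ := fun u => u - Real.cosh u / Real.sinh u - κ * Real.log (Real.sinh u) with hg
  have hd : ∀ y : ℝ, 0 < y → HasDerivAt g
      (Real.cosh y / Real.sinh y * (Real.cosh y / Real.sinh y - κ)) y := fun y hy => by
    have hs : Real.sinh y ≠ 0 := (Real.sinh_pos_iff.2 hy).ne'
    have h2 := (Real.hasDerivAt_cosh y).div (Real.hasDerivAt_sinh y) hs
    have h3 := ((Real.hasDerivAt_sinh y).log hs).const_mul κ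
    refine (((hasDerivAt_id' y).sub h2).sub h3).congr_deriv ?_
    field_simp
    ring
  have hm : AntitoneOn g (Set.Ici ψ) := by
    refine antitoneOn_of_deriv_nonpos (convex_Ici ψ)
      (fun y hy => (hd y (hψ.trans_le hy)).continuousAt.continuousWithinAt)
      (fun y hy => (hd y (hψ.trans_le
        (interior_subset hy))).differentiableAt.differentiableWithinAt) fun y hy => ?_
    have hy1 : ψ ≤ y := interior_subset hy
    have hy0 : 0 < y := hψ.trans_le hy1
    have hys := Real.sinh_pos_iff.2 hy0
    rw [(hd y hy0).deriv]
    refine mul_nonpos_of_nonneg_of_nonpos (div_nonneg (Real.cosh_pos y).le hys.le) ?_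
    rw [hκ, sub_nonpos, div_le_div_iff₀ hys hψs]
    have h := Real.sinh_nonneg_iff.2 (sub_nonneg.2 hy1)
    rw [Real.sinh_sub] at h
    linarith
  have := hm Set.self_mem_Ici hu hu
  simp only [hg] at this
  rw [Real.log_div (Real.sinh_pos_iff.2 (hψ.trans_le hu)).ne' hψs.ne']
  linarith

lemma cosh_tangent_le (a b : ℝ) : Real.cosh b + Real.sinh b * (a - b) ≤ Real.cosh a := by
  have h1 : Real.exp b * (a - b + 1) ≤ Real.exp a := by
    calc Real.exp b * (a - b + 1) ≤ Real.exp b * Real.exp (a - b) := by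
          gcongr; exact Real.add_one_le_exp _
      _ = Real.exp a := by rw [← Real.exp_add]; congr 1; ring
  have h2 : Real.exp (-b) * (-(a - b) + 1) ≤ Real.exp (-a) := by
    calc Real.exp (-b) * (-(a - b) + 1) ≤ Real.exp (-b) * Real.exp (-(a - b)) := by
          gcongr; exact Real.add_one_le_exp _
      _ = Real.exp (-a) := by rw [← Real.exp_add]; congr 1; ring
  rw [Real.cosh_eq, Real.cosh_eq, Real.sinh_eq]
  nlinarith

lemma self_le_sinh_of_pos {x : ℝ} (hx : 0 < x) : x ≤ Real.sinh x :=
  Real.self_le_sinh_iff.2 hx.le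

/-- The hyperbolic form of the bound on the top eigenvalue of the tilted two-state chain. -/
lemma cosh_mul_add_le_cosh {ψ x : ℝ} (hψ : 0 < ψ) (hx : 0 < x) (c : ℝ) :
    Real.cosh ψ * Real.cosh x + c * Real.sinh ψ * Real.sinh x ≤
      Real.cosh (ψ + c * x + Real.cosh ψ / Real.sinh ψ * x ^ 2 / 2) := by
  set S := Real.sinh ψ
  set C := Real.cosh ψ
  have hS : 0 < S := Real.sinh_pos_iff.2 hψ
  have hC : 0 < C := Real.cosh_pos ψ
  have hsx : 0 < Real.sinh x := Real.sinh_pos_iff.2 hx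
  set q := Real.sinh x / x with hq
  have hq1 : 1 ≤ q := (one_le_div hx).2 (self_le_sinh_of_pos hx)
  -- The left side is affine in `c` with slope `S sinh x`, the right side convex in `c`. The point
  -- `u` with `x sinh u = S sinh x` is where the tangent to `cosh` has this slope, so the tangent
  -- inequality at `u` leaves a bound free of `c`.
  set u := Real.arsinh (S * q)
  have hu : Real.sinh u = S * q := Real.sinh_arsinh _
  have hψu : ψ ≤ u := by
    rw [← Real.sinh_le_sinh, hu]
    exact le_mul_of_one_le_right hS.le hq1
  have hSq : 0 < S * q := by positivity
  have hB := sub_coth_le hψ hψu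
  rw [hu, mul_div_cancel_left₀ _ hS.ne'] at hB
  change u - Real.cosh u / (S * q) ≤ ψ - C / S + C / S * Real.log q at hB
  have hA := mul_le_mul_of_nonneg_left (log_sinh_div_add_le hx) (div_pos hC hS).le
  have hsum : u - Real.cosh u / (S * q) + C / S * (x * (Real.cosh x / Real.sinh x)) ≤
      ψ + C / S * (x ^ 2 / 2) := by
    change C / S * (Real.log q + _) ≤ _ at hA
    linarith
  have hmul := mul_le_mul_of_nonneg_left hsum hSq.le
  have e1 : S * q * (u - Real.cosh u / (S * q) + C / S * (x * (Real.cosh x / Real.sinh x))) =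
      S * q * u - Real.cosh u + C * Real.cosh x := by
    rw [hq]
    field_simp
  rw [e1] at hmul
  have ht := cosh_tangent_le (ψ + c * x + C / S * x ^ 2 / 2) u
  rw [hu] at ht
  have e2 : S * q * (c * x) = c * S * Real.sinh x := by
    rw [hq]
    field_simp
  nlinarith

/-- The bound `r` on the top eigenvalue of the tilted two-state chain with stationary probability `μ`
and second eigenvalue `l`. -/
lemma tilted_root_bound {l μ θ : ℝ} (hl0 : 0 < l) (hl1 : l < 1) (hμ0 : 0 < μ)
    (hθ : 0 < θ) {r : ℝ} (hr : r = Real.exp (θ * μ + (1 + l) / (1 - l) * θ ^ 2 / 8)) :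
    l * Real.exp θ < r ∧
      r * (Real.exp θ * (l + (1 - l) * μ) + (l + (1 - l) * (1 - μ))) ≤
        r ^ 2 + l * Real.exp θ := by
  -- With `l = exp (-2ψ)` and `θ = 2x`, the factor `(1 + l) / (1 - l)` becomes `coth ψ`. The second
  -- claim says that the characteristic polynomial, of determinant `l exp θ`, is nonnegative at `r`;
  -- since it is negative at `l exp θ`, the first claim puts `r` above the larger root.
  set ψ := -Real.log l / 2 with hψ
  set x := θ / 2 with hx
  have hψ0 : 0 < ψ := by
    have := Real.log_neg hl0 hl1
    rw [hψ]; linarith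
  have hx0 : 0 < x := by rw [hx]; linarith
  set s := Real.exp (-ψ) with hs
  set E := Real.exp x with hE
  have hs0 : 0 < s := Real.exp_pos _
  have hE0 : 0 < E := Real.exp_pos _
  have hls : l = s ^ 2 := by
    rw [hs, ← Real.exp_nat_mul, hψ]
    push_cast
    rw [show (2 : ℝ) * -(-Real.log l / 2) = Real.log l by ring, Real.exp_log hl0]
  have hEθ : Real.exp θ = E ^ 2 := by
    rw [hE, ← Real.exp_nat_mul, hx]
    congr 1
    push_cast
    ring
  have hexpψ : Real.exp ψ = s⁻¹ := by rw [hs, Real.exp_neg, inv_inv]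
  have hC : Real.cosh ψ = (s⁻¹ + s) / 2 := by rw [Real.cosh_eq, hexpψ]
  have hS : Real.sinh ψ = (s⁻¹ - s) / 2 := by rw [Real.sinh_eq, hexpψ]
  have hκ : Real.cosh ψ / Real.sinh ψ = (1 + l) / (1 - l) := by
    have h1 : 1 - s ^ 2 ≠ 0 := by rw [← hls]; linarith
    have h2 : s⁻¹ - s ≠ 0 := by
      intro h
      apply h1
      have : s * (s⁻¹ - s) = 1 - s ^ 2 := by field_simp
      rw [← this, h, mul_zero]
    rw [hC, hS, hls]
    field_simp
  set κ := (1 + l) / (1 - l) with hκd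
  have hκ0 : 0 < κ := div_pos (by linarith) (by linarith)
  have hSpos := Real.sinh_pos_iff.2 hψ0
  have hκψ : 1 ≤ κ * ψ := by
    rw [← hκ, div_mul_eq_mul_div, one_le_div hSpos, mul_comm]
    exact sinh_le_mul_cosh hψ0.le
  set R := ψ + (2 * μ - 1) * x + κ * x ^ 2 / 2 with hR
  have hrR : r = s * E * Real.exp R := by
    rw [hr, hs, hE, ← Real.exp_add, ← Real.exp_add, hR]
    congr 1
    rw [hx]
    ring
  have hr0 : 0 < r := by rw [hr]; exact Real.exp_pos _
  constructor
  · rw [hls, hEθ, hrR]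
    have : s * E < Real.exp R := by
      rw [hs, hE, ← Real.exp_add, Real.exp_lt_exp, hR]
      -- The expression is `(κ x - 2)² / 2 + 2 (κ ψ - 1)`, and `κ ψ ≥ 1` is the inequality `tanh ψ ≤
      -- ψ`.
      have h1 : 0 ≤ κ * (2 * ψ - 2 * x + κ * x ^ 2 / 2) := by
        nlinarith [sq_nonneg (κ * x - 2)]
      have h2 := nonneg_of_mul_nonneg_right h1 hκ0
      nlinarith [mul_pos hμ0 hx0]
    calc s ^ 2 * E ^ 2 = s * E * (s * E) := by ring
      _ < s * E * Real.exp R := by gcongr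
  · have hmain := cosh_mul_add_le_cosh hψ0 hx0 (2 * μ - 1)
    rw [hκ] at hmain
    have hER : Real.exp R = r / (s * E) := by rw [hrR]; field_simp
    rw [show ψ + (2 * μ - 1) * x + κ * x ^ 2 / 2 = R from rfl, hC, hS, Real.cosh_eq, Real.cosh_eq,
      Real.sinh_eq, Real.exp_neg, Real.exp_neg, hER] at hmain
    change (s⁻¹ + s) / 2 * ((E + E⁻¹) / 2) + (2 * μ - 1) * ((s⁻¹ - s) / 2) * ((E - E⁻¹) / 2) ≤ _
      at hmain
    have hmul := mul_le_mul_of_nonneg_left hmain (show 0 ≤ 2 * r * (s * E) by positivity)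
    have e1 : 2 * r * (s * E) * ((s⁻¹ + s) / 2 * ((E + E⁻¹) / 2) +
        (2 * μ - 1) * ((s⁻¹ - s) / 2) * ((E - E⁻¹) / 2)) =
        r * (E ^ 2 * (s ^ 2 + (1 - s ^ 2) * μ) + (s ^ 2 + (1 - s ^ 2) * (1 - μ))) := by
      field_simp
      ring
    have e2 : 2 * r * (s * E) * ((r / (s * E) + (r / (s * E))⁻¹) / 2) = r ^ 2 + s ^ 2 * E ^ 2 := by
      field_simp
    rw [e1, e2] at hmul
    rw [hls, hEθ]
    exact hmul

/-- The moment generating function of a Bernoulli variable. -/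
lemma bernoulli_mgf_le {l μ θ r : ℝ} (hl0 : 0 < l) (hl1 : l < 1) (hμ1 : μ ≤ 1) (hθ : 0 < θ)
    (hr1 : 1 ≤ r)
    (h : r * (Real.exp θ * (l + (1 - l) * μ) + (l + (1 - l) * (1 - μ))) ≤ r ^ 2 + l * Real.exp θ) :
    μ * Real.exp θ + (1 - μ) ≤ r := by
  have hE := Real.one_lt_exp_iff.2 hθ
  rcases le_total (Real.exp θ) r with h1 | h1
  · nlinarith
  -- For `1 ≤ r ≤ exp θ`, the part of the hypothesis multiplied by `l` is `(r - 1) (r - exp θ) ≤ 0`;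
  -- what remains is the claim multiplied by `(1 - l) r`.
  · have h2 : 0 ≤ l * ((r - 1) * (Real.exp θ - r)) :=
      mul_nonneg hl0.le (mul_nonneg (by linarith) (by linarith))
    have h3 : 0 ≤ (1 - l) * (r * (r - (μ * Real.exp θ + (1 - μ)))) := by nlinarith
    have h4 := nonneg_of_mul_nonneg_right h3 (by linarith : 0 < 1 - l)
    have h5 := nonneg_of_mul_nonneg_right h4 (by linarith : 0 < r)
    linarith

/-- The secular form of the eigenvalue bound. -/
lemma secular_le_one {l μ θ r : ℝ} (hl0 : 0 < l) (hθ : 0 < θ) (h1 : l * Real.exp θ < r)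
    (h : r * (Real.exp θ * (l + (1 - l) * μ) + (l + (1 - l) * (1 - μ))) ≤ r ^ 2 + l * Real.exp θ) :
    (1 - l) * (μ * (Real.exp θ / (r - l * Real.exp θ)) + (1 - μ) * (1 / (r - l))) ≤ 1 := by
  have hE := Real.one_lt_exp_iff.2 hθ
  have h2 : 0 < r - l * Real.exp θ := by linarith
  have h3 : 0 < r - l := by nlinarith
  have : (1 - l) * (μ * (Real.exp θ / (r - l * Real.exp θ)) + (1 - μ) * (1 / (r - l))) =
      (1 - l) * (μ * Real.exp θ * (r - l) + (1 - μ) * (r - l * Real.exp θ)) /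
        ((r - l * Real.exp θ) * (r - l)) := by
    field_simp
  rw [this, div_le_one (mul_pos h2 h3)]
  nlinarith

end Hyperbolic

/-! ### Symmetric stochastic matrices -/

section SymmetricChain

open Matrix

variable {n : ℕ} {W : Matrix (Fin n) (Fin n) ℝ}

lemma IsStochastic.mulVec_one (hW : IsStochastic W) : W *ᵥ 1 = 1 := by
  ext i
  simpa [mulVec, dotProduct] using hW.2 i

lemma IsStochastic.pow (hW : IsStochastic W) : ∀ t : ℕ, IsStochastic (W ^ t)
  | 0 => by
    refine ⟨fun i j => ?_, fun i => ?_⟩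
    · rw [pow_zero, one_apply]
      split_ifs <;> norm_num
    · simp [one_apply]
  | t + 1 => by
    have h := hW.pow t
    refine ⟨fun i j => ?_, fun i => ?_⟩
    · rw [pow_succ, mul_apply]
      exact Finset.sum_nonneg fun k _ => mul_nonneg (h.1 i k) (hW.1 k j)
    · simp_rw [pow_succ, mul_apply]
      rw [Finset.sum_comm]
      simp_rw [← Finset.mul_sum, hW.2, mul_one, h.2]

lemma IsStationaryDist.vecMul_pow {π : Fin n → ℝ} (hπ : IsStationaryDist W π) :
    ∀ t : ℕ, π ᵥ* W ^ t = π
  | 0 => by simp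
  | t + 1 => by
    rw [pow_succ, ← vecMul_vecMul, hπ.vecMul_pow t]
    ext j
    exact hπ.2.2 j

/-- Maximum principle: by symmetry the largest value `π k` is an average of the values of `π` with
weights `(W ^ t) k i`, so `π` takes this value wherever a weight is positive, and irreducibility
reaches every state. -/
lemma IsStationaryDist.eq_uniform (hW : IsStochastic W) (hsymm : W.IsSymm)
    (hirr : IsIrreducibleChain W) {π : Fin n → ℝ} (hπ : IsStationaryDist W π) (i : Fin n) :
    π i = (n : ℝ)⁻¹ := by
  have : Nonempty (Fin n) := ⟨i⟩
  obtain ⟨k, hk⟩ := Finite.exists_max π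
  have hall : ∀ l, π l = π k := by
    intro l
    obtain ⟨t, -, ht⟩ := hirr k l
    have hs : (W ^ t).IsSymm := hsymm.pow t
    have h0 : ∑ i, (π k - π i) * (W ^ t) k i = 0 := by
      have h1 := congrFun (hπ.vecMul_pow t) k
      simp only [vecMul, dotProduct] at h1
      simp_rw [sub_mul]
      rw [Finset.sum_sub_distrib, ← Finset.mul_sum, (hW.pow t).2, mul_one, sub_eq_zero]
      conv_lhs => rw [← h1]
      exact Finset.sum_congr rfl fun i _ => by rw [hs.apply]
    have h2 := (Finset.sum_eq_zero_iff_of_nonneg fun i _ =>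
      mul_nonneg (sub_nonneg.2 (hk i)) ((hW.pow t).1 k i)).1 h0 l (Finset.mem_univ _)
    rcases mul_eq_zero.1 h2 with h | h
    · linarith
    · exact absurd h ht.ne'
  have hsum := hπ.2.1
  simp_rw [hall] at hsum
  rw [hall i]
  rw [Finset.sum_const, Finset.card_univ, Fintype.card_fin, nsmul_eq_mul] at hsum
  exact eq_inv_of_mul_eq_one_right hsum

lemma dotProduct_mulVec_comm (hsymm : W.IsSymm) (x y : Fin n → ℝ) :
    x ⬝ᵥ W *ᵥ y = (W *ᵥ x) ⬝ᵥ y := by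
  rw [dotProduct_mulVec, ← mulVec_transpose, hsymm.eq]

/-- The spectral bound: a symmetric stochastic matrix is at most `l + (1 - l) J / n` as a quadratic
form, where `l` bounds the second eigenvalue and `J` is the all-ones matrix. -/
lemma IsStochastic.dotProduct_mulVec_le (hn : 2 ≤ n) (hW : IsStochastic W) (hsymm : W.IsSymm) {l : ℝ}
    (hl : lambda2 hn W hsymm ≤ l) (hl1 : l < 1) (z : Fin n → ℝ) :
    z ⬝ᵥ W *ᵥ z ≤ l * (z ⬝ᵥ z) + (1 - l) * ((∑ i, z i) ^ 2 / n) := by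
  have hA : W.IsHermitian := (conjTranspose_eq_transpose_of_trivial W).trans hsymm
  set b := hA.eigenvectorBasis
  set e := (Fintype.equivOfCardEq (Fintype.card_fin (Fintype.card (Fin n))) :
    Fin (Fintype.card (Fin n)) ≃ Fin n)
  have hcard : 2 ≤ Fintype.card (Fin n) := by rwa [Fintype.card_fin]
  -- The index of the top eigenvalue; all other eigenvalues are at most `lambda2`, since
  -- `eigenvalues₀` is decreasing.
  set i₀ : Fin n := e ⟨0, by omega⟩
  have hev : ∀ i, i ≠ i₀ → hA.eigenvalues i ≤ l := by
    intro i hi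
    refine le_trans ?_ hl
    refine hA.eigenvalues₀_antitone ?_
    change (1 : ℕ) ≤ (e.symm i).val
    by_contra! h
    apply hi
    rw [← e.symm_apply_eq]
    exact Fin.ext (by simpa using h)
  have hpars : ∀ x y : Fin n → ℝ, ∑ i, (b i ⬝ᵥ x) * (b i ⬝ᵥ y) = x ⬝ᵥ y := by
    intro x y
    have := b.sum_inner_mul_inner (WithLp.toLp 2 x) (WithLp.toLp 2 y)
    simp only [EuclideanSpace.inner_eq_star_dotProduct, star_trivial] at this
    rw [dotProduct_comm x y, ← this]
    exact Finset.sum_congr rfl fun i _ => by rw [dotProduct_comm y]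
  have hbW : ∀ i x, b i ⬝ᵥ W *ᵥ x = hA.eigenvalues i * (b i ⬝ᵥ x) := by
    intro i x
    rw [dotProduct_mulVec_comm hsymm, hA.mulVec_eigenvectorBasis, smul_dotProduct, smul_eq_mul]
  -- As `l < 1`, the other eigenvectors have eigenvalue different from `1` and are orthogonal to the
  -- constants. So the eigenvector `b i₀` spans the constants.
  have hone : ∀ i, i ≠ i₀ → b i ⬝ᵥ (1 : Fin n → ℝ) = 0 := by
    intro i hi
    have h := hbW i 1
    rw [hW.mulVec_one] at h
    have h1 : hA.eigenvalues i < 1 := (hev i hi).trans_lt hl1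
    have h2 : (1 - hA.eigenvalues i) * (b i ⬝ᵥ (1 : Fin n → ℝ)) = 0 := by linarith
    exact (mul_eq_zero.1 h2).resolve_left (by linarith)
  set c₀ := b i₀ ⬝ᵥ (1 : Fin n → ℝ)
  have hn0 : (0 : ℝ) < n := by exact_mod_cast (by omega : 0 < n)
  have hc₀ : c₀ ^ 2 = n := by
    have h := hpars 1 1
    rw [Finset.sum_eq_single i₀ (fun i _ hi => by rw [hone i hi, zero_mul]) (by simp)] at h
    rw [sq]
    refine h.trans ?_
    simp
  have hz : ∑ i, z i = c₀ * (b i₀ ⬝ᵥ z) := by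
    have h := hpars 1 z
    rw [Finset.sum_eq_single i₀ (fun i _ hi => by rw [hone i hi, zero_mul]) (by simp)] at h
    rw [one_dotProduct] at h
    exact h.symm
  have hev₀ : hA.eigenvalues i₀ = 1 := by
    have h := hbW i₀ 1
    rw [hW.mulVec_one] at h
    have : c₀ ≠ 0 := fun h0 => by rw [h0] at hc₀; norm_num at hc₀; linarith
    exact (mul_right_cancel₀ this (by rw [one_mul]; exact h)).symm
  rw [hz, mul_pow, hc₀, mul_div_cancel_left₀ _ hn0.ne', ← hpars z (W *ᵥ z), ← hpars z z,
    ← Finset.add_sum_erase _ _ (Finset.mem_univ i₀),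
    ← Finset.add_sum_erase (a := i₀) _ (fun i => (b i ⬝ᵥ z) * (b i ⬝ᵥ z)) (Finset.mem_univ i₀),
    hbW, hev₀, mul_add, Finset.mul_sum]
  have : ∑ i ∈ Finset.univ.erase i₀, (b i ⬝ᵥ z) * (b i ⬝ᵥ W *ᵥ z) ≤
      ∑ i ∈ Finset.univ.erase i₀, l * ((b i ⬝ᵥ z) * (b i ⬝ᵥ z)) := by
    refine Finset.sum_le_sum fun i hi => ?_
    rw [hbW]
    nlinarith [hev i (Finset.ne_of_mem_erase hi), mul_self_nonneg (b i ⬝ᵥ z)]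
  nlinarith

/-- A symmetric matrix with nonnegative entries whose quadratic form is at most `r` has operator norm
at most `r`. -/
lemma dotProduct_mulVec_self_le {B : Matrix (Fin n) (Fin n) ℝ} (hB : B.IsSymm)
    (h0 : ∀ i j, 0 ≤ B i j) {r : ℝ} (hr : 0 < r) (h : ∀ x, x ⬝ᵥ B *ᵥ x ≤ r * (x ⬝ᵥ x))
    (x : Fin n → ℝ) : (B *ᵥ x) ⬝ᵥ (B *ᵥ x) ≤ r ^ 2 * (x ⬝ᵥ x) := by
  -- Nonnegative entries bound the form from below too: replacing `x` by `|x|` can only increase the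
  -- absolute value of the form.
  have hneg : ∀ x, -(r * (x ⬝ᵥ x)) ≤ x ⬝ᵥ B *ᵥ x := by
    intro x
    have h1 := h fun i => |x i|
    have h2 : (fun i => |x i|) ⬝ᵥ (fun i => |x i|) = x ⬝ᵥ x := by
      simp [dotProduct]
    have h3 : -(x ⬝ᵥ B *ᵥ x) ≤ (fun i => |x i|) ⬝ᵥ B *ᵥ fun i => |x i| := by
      simp only [dotProduct, mulVec, Finset.mul_sum, ← Finset.sum_neg_distrib]
      refine Finset.sum_le_sum fun i _ => Finset.sum_le_sum fun j _ => ?_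
      calc -(x i * (B i j * x j)) ≤ |x i * (B i j * x j)| := neg_le_abs _
        _ = |x i| * (B i j * |x j|) := by rw [abs_mul, abs_mul, abs_of_nonneg (h0 i j)]
    rw [h2] at h1
    linarith
  -- Polarization: the upper bound at `x + y` and the lower bound at `x - y` combine to a bound on
  -- the mixed term `x ⬝ᵥ B *ᵥ y = r⁻¹ ‖B x‖²`.
  set y := r⁻¹ • (B *ᵥ x) with hy
  have h1 := h (x + y)
  have h2 := hneg (x - y)
  have hc : y ⬝ᵥ B *ᵥ x = x ⬝ᵥ B *ᵥ y := by rw [dotProduct_mulVec_comm hB, dotProduct_comm]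
  have hxy : x ⬝ᵥ B *ᵥ y = r⁻¹ * ((B *ᵥ x) ⬝ᵥ (B *ᵥ x)) := by
    rw [← hc, hy, smul_dotProduct, smul_eq_mul]
  have hyy : y ⬝ᵥ y = r⁻¹ ^ 2 * ((B *ᵥ x) ⬝ᵥ (B *ᵥ x)) := by
    rw [hy, smul_dotProduct, dotProduct_smul, smul_eq_mul, smul_eq_mul, sq, mul_assoc]
  simp only [mulVec_add, mulVec_sub, add_dotProduct, sub_dotProduct, dotProduct_add,
    dotProduct_sub, hc, hyy, hxy, dotProduct_comm y x] at h1 h2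
  set S := (B *ᵥ x) ⬝ᵥ (B *ᵥ x)
  have h3 : r * (r⁻¹ ^ 2 * S) = r⁻¹ * S := by field_simp
  have h4 : r⁻¹ * S ≤ r * (x ⬝ᵥ x) := by nlinarith
  calc S = r * (r⁻¹ * S) := by field_simp
    _ ≤ r * (r * (x ⬝ᵥ x)) := by gcongr
    _ = r ^ 2 * (x ⬝ᵥ x) := by ring

end SymmetricChain

/-! ### The number of visits of a symmetric chain -/

section Visits

open Matrix

variable {n : ℕ} {W : Matrix (Fin n) (Fin n) ℝ}

/-- The square root of the exponential weight of a visit to `j`. -/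
def tiltWeight (θ : ℝ) (j k : Fin n) : ℝ := if k = j then Real.exp (θ / 2) else 1

/-- The transition matrix tilted by the exponential weights of the visits to `j`. -/
def tiltedMatrix (W : Matrix (Fin n) (Fin n) ℝ) (θ : ℝ) (j : Fin n) : Matrix (Fin n) (Fin n) ℝ :=
  Matrix.of fun k l => tiltWeight θ j k * W k l * tiltWeight θ j l

lemma tiltWeight_pos (θ : ℝ) (j k : Fin n) : 0 < tiltWeight θ j k := by
  unfold tiltWeight
  split_ifs
  · exact Real.exp_pos _
  · exact one_pos

lemma tiltWeight_sq (θ : ℝ) (j k : Fin n) :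
    tiltWeight θ j k ^ 2 = if k = j then Real.exp θ else 1 := by
  unfold tiltWeight
  split_ifs
  · rw [← Real.exp_nat_mul]
    congr 1
    push_cast
    ring
  · norm_num

lemma sum_ite_eq_add (j : Fin n) (a c : ℝ) :
    ∑ k : Fin n, (if k = j then a else c) = a + (n - 1) * c := by
  have : ∀ k : Fin n, (if k = j then a else c) = (if k = j then a - c else 0) + c := fun k => by
    split_ifs <;> ring
  simp_rw [this]
  rw [Finset.sum_add_distrib, Finset.sum_ite_eq' Finset.univ j]
  simp
  ring

lemma tiltedMatrix_mulVec (θ : ℝ) (j : Fin n) (x : Fin n → ℝ) (k : Fin n) :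
    (tiltedMatrix W θ j *ᵥ x) k =
      tiltWeight θ j k * ∑ l, W k l * (tiltWeight θ j l * x l) := by
  simp only [mulVec, dotProduct, tiltedMatrix, of_apply, Finset.mul_sum]
  exact Finset.sum_congr rfl fun l _ => by ring

lemma tiltedMatrix_nonneg (hW : IsStochastic W) (θ : ℝ) (j k l : Fin n) :
    0 ≤ tiltedMatrix W θ j k l :=
  mul_nonneg (mul_nonneg (tiltWeight_pos _ _ _).le (hW.1 _ _)) (tiltWeight_pos _ _ _).le

lemma tiltedMatrix_pow_mulVec_nonneg (hW : IsStochastic W) (θ : ℝ) (j : Fin n) (T : ℕ) :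
    ∀ k, 0 ≤ ((tiltedMatrix W θ j ^ T) *ᵥ tiltWeight θ j) k := by
  induction T with
  | zero => intro k; simpa using (tiltWeight_pos θ j k).le
  | succ T ih =>
    intro k
    rw [pow_succ', ← mulVec_mulVec, mulVec, dotProduct]
    exact Finset.sum_nonneg fun l _ => mul_nonneg (tiltedMatrix_nonneg hW θ j k l) (ih l)

/-- The spectral bound for `W`, applied to the tilted vector, leaves a diagonal term plus a rank-one
term. Such a form is at most `r` exactly under a secular inequality, here the one of the two-state
chain with stationary probability `1 / n`. -/
lemma tiltedMatrix_quadratic_le (hn : 2 ≤ n) (hW : IsStochastic W) (hsymm : W.IsSymm) {l : ℝ}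
    (hl : lambda2 hn W hsymm ≤ l) (hl0 : 0 < l) (hl1 : l < 1) {θ : ℝ} (hθ : 0 < θ) {r : ℝ}
    (hr : r = Real.exp (θ * (n : ℝ)⁻¹ + (1 + l) / (1 - l) * θ ^ 2 / 8)) (j : Fin n)
    (x : Fin n → ℝ) : x ⬝ᵥ tiltedMatrix W θ j *ᵥ x ≤ r * (x ⬝ᵥ x) := by
  have hn0 : (0 : ℝ) < n := by exact_mod_cast (by omega : 0 < n)
  obtain ⟨h1, h2⟩ := tilted_root_bound hl0 hl1 (inv_pos.2 hn0) hθ hr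
  have hsec := secular_le_one hl0 hθ h1 h2
  have hE := Real.one_lt_exp_iff.2 hθ
  set e := tiltWeight θ j
  have hg : ∀ k, 0 < r - l * e k ^ 2 := by
    intro k
    rw [tiltWeight_sq]
    split_ifs
    · linarith
    · nlinarith
  have hq : x ⬝ᵥ tiltedMatrix W θ j *ᵥ x = (fun k => e k * x k) ⬝ᵥ W *ᵥ fun k => e k * x k := by
    simp only [dotProduct]
    refine Finset.sum_congr rfl fun k _ => ?_
    rw [tiltedMatrix_mulVec]
    simp only [mulVec, dotProduct]
    ring
  -- The weights `r - l e_k²` are the diagonal slack left by the first term, positive because `l exp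
  -- θ < r`; with them Cauchy–Schwarz produces the secular sum.
  have hcs : (∑ k, e k * x k) ^ 2 ≤
      (∑ k, (r - l * e k ^ 2) * x k ^ 2) * ∑ k, e k ^ 2 / (r - l * e k ^ 2) := by
    refine Finset.sum_sq_le_sum_mul_sum_of_sq_le_mul _ (fun k _ => ?_) (fun k _ => ?_) fun k _ => ?_
    · exact mul_nonneg (hg k).le (sq_nonneg _)
    · exact div_nonneg (sq_nonneg _) (hg k).le
    · refine le_of_eq ?_
      rw [mul_right_comm, mul_div_cancel₀ _ (hg k).ne', mul_pow]
  have hsum : (1 - l) * ((∑ k, e k ^ 2 / (r - l * e k ^ 2)) / n) ≤ 1 := by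
    have : ∑ k, e k ^ 2 / (r - l * e k ^ 2) =
        Real.exp θ / (r - l * Real.exp θ) + (n - 1) * (1 / (r - l)) := by
      rw [← sum_ite_eq_add j]
      refine Finset.sum_congr rfl fun k _ => ?_
      rw [tiltWeight_sq]
      split_ifs
      · rfl
      · rw [mul_one]
    rw [this]
    refine le_of_eq_of_le ?_ hsec
    field_simp
  have hX : 0 ≤ ∑ k, (r - l * e k ^ 2) * x k ^ 2 :=
    Finset.sum_nonneg fun k _ => mul_nonneg (hg k).le (sq_nonneg _)
  rw [hq]
  refine (hW.dotProduct_mulVec_le hn hsymm hl hl1 _).trans ?_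
  calc l * ((fun k => e k * x k) ⬝ᵥ fun k => e k * x k) + (1 - l) * ((∑ k, e k * x k) ^ 2 / n)
      ≤ l * ((fun k => e k * x k) ⬝ᵥ fun k => e k * x k) +
        (1 - l) * (((∑ k, (r - l * e k ^ 2) * x k ^ 2) * ∑ k, e k ^ 2 / (r - l * e k ^ 2)) / n) := by
        have : 0 ≤ 1 - l := by linarith
        gcongr
    _ = l * ((fun k => e k * x k) ⬝ᵥ fun k => e k * x k) +
        (∑ k, (r - l * e k ^ 2) * x k ^ 2) *
          ((1 - l) * ((∑ k, e k ^ 2 / (r - l * e k ^ 2)) / n)) := by ring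
    _ ≤ l * ((fun k => e k * x k) ⬝ᵥ fun k => e k * x k) +
        (∑ k, (r - l * e k ^ 2) * x k ^ 2) * 1 := by gcongr
    _ = r * (x ⬝ᵥ x) := by
        simp only [dotProduct, mul_one, Finset.mul_sum, ← Finset.sum_add_distrib]
        exact Finset.sum_congr rfl fun k _ => by ring

lemma visits_cons {T : ℕ} (j k : Fin n) (y : Fin (T + 1) → Fin n) :
    visits j (Fin.cons k y : Fin (T + 2) → Fin n) = (if y 0 = j then 1 else 0) + visits j y := by
  simp only [visits, Finset.card_filter, Fin.cons_succ]
  rw [Fin.sum_univ_succ]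

/-- The moment generating function of the number of visits. -/
lemma lintegral_exp_visits (hW : IsStochastic W) (θ : ℝ) (j : Fin n) :
    ∀ (T : ℕ) (k : Fin n),
      ∫⁻ y, ENNReal.ofReal (Real.exp (θ * visits j y)) ∂pathLaw (walkStep W) T k =
        ENNReal.ofReal (((tiltedMatrix W θ j ^ T) *ᵥ tiltWeight θ j) k / tiltWeight θ j k)
  | 0, k => by
    rw [lintegral_pathLaw_zero _ _ (measurable_of_finite _)]
    simp [visits, (tiltWeight_pos θ j k).ne']
  | T + 1, k => by
    -- The prefix makes the start `l` of the tail count as a visit at time `1`, with weight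
    -- `tiltWeight θ j l ^ 2`. The uncounted state at time `0` is the reason for the division by
    -- `tiltWeight θ j k`.
    have hstart : ∀ l, ∫⁻ y, ENNReal.ofReal (Real.exp (θ * visits j
          (Fin.cons k y : Fin (T + 2) → Fin n))) ∂pathLaw (walkStep W) T l =
        ENNReal.ofReal (tiltWeight θ j l * ((tiltedMatrix W θ j ^ T) *ᵥ tiltWeight θ j) l) := by
      intro l
      have hc := lintegral_pathLaw_congr (measurable_walkStep W) hW.isProbabilityMeasure_walkStep T l
        (F := fun y => ENNReal.ofReal (Real.exp (θ * visits j (Fin.cons k y : Fin (T + 2) → Fin n))))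
        (G := fun y => ENNReal.ofReal (tiltWeight θ j l ^ 2) *
          ENNReal.ofReal (Real.exp (θ * visits j y)))
        (measurable_of_finite _) (measurable_of_finite _) (fun y hy => by
          rw [← ENNReal.ofReal_mul (sq_nonneg _), tiltWeight_sq, visits_cons, hy]
          split_ifs
          · rw [← Real.exp_add]
            push_cast
            ring_nf
          · rw [one_mul, zero_add])
      rw [hc, lintegral_const_mul _ (measurable_of_finite _), lintegral_exp_visits hW θ j T l,
        ← ENNReal.ofReal_mul (sq_nonneg _)]
      congr 1
      have := (tiltWeight_pos θ j l).ne'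
      field_simp
    rw [lintegral_pathLaw_succ (measurable_walkStep W) hW.isProbabilityMeasure_walkStep _ _
      (measurable_of_finite _), lintegral_walkStep]
    simp_rw [hstart]
    rw [pow_succ', ← mulVec_mulVec, tiltedMatrix_mulVec,
      mul_div_cancel_left₀ _ (tiltWeight_pos θ j k).ne', ENNReal.ofReal_sum_of_nonneg]
    · exact Finset.sum_congr rfl fun l _ => (ENNReal.ofReal_mul (hW.1 k l)).symm
    · exact fun l _ => mul_nonneg (hW.1 k l) (mul_nonneg (tiltWeight_pos _ _ _).le
        (tiltedMatrix_pow_mulVec_nonneg hW θ j T l))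

lemma lintegral_walkLaw (W : Matrix (Fin n) (Fin n) ℝ) (π : Fin n → ℝ) (T : ℕ)
    (F : (Fin (T + 1) → Fin n) → ℝ≥0∞) :
    ∫⁻ y, F y ∂walkLaw W π T =
      ∑ k, ENNReal.ofReal (π k) * ∫⁻ y, F y ∂pathLaw (walkStep W) T k := by
  rw [walkLaw, lintegral_finsetSum_measure]
  exact Finset.sum_congr rfl fun k _ => by rw [lintegral_smul_measure, smul_eq_mul]

/-- The uniform start and unit column sums absorb the first transition, so `T + 1` steps give `n⁻¹
⟨e, A^T e⟩ ≤ r^T n⁻¹ ‖e‖²`. The last factor is the moment generating function of a Bernoulli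
variable of mean `1 / n`, again at most `r`; so no prefactor remains. -/
lemma sum_tilted_le (hn : 2 ≤ n) (hW : IsStochastic W) (hsymm : W.IsSymm) {l : ℝ}
    (hl : lambda2 hn W hsymm ≤ l) (hl0 : 0 < l) (hl1 : l < 1) {θ : ℝ} (hθ : 0 < θ) {r : ℝ}
    (hr : r = Real.exp (θ * (n : ℝ)⁻¹ + (1 + l) / (1 - l) * θ ^ 2 / 8)) (j : Fin n) (T : ℕ) :
    ∑ k, (n : ℝ)⁻¹ * (((tiltedMatrix W θ j ^ T) *ᵥ tiltWeight θ j) k / tiltWeight θ j k) ≤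
      r ^ T := by
  have hn0 : (0 : ℝ) < n := by exact_mod_cast (by omega : 0 < n)
  set e := tiltWeight θ j
  set A := tiltedMatrix W θ j with hA
  have hκ : 0 < (1 + l) / (1 - l) := div_pos (by linarith) (by linarith)
  have hr1 : 1 ≤ r := by
    rw [hr]
    exact Real.one_le_exp (by positivity)
  have hr0 : 0 < r := by linarith
  cases T with
  | zero =>
    have : ∀ k, e k / e k = 1 := fun k => div_self (tiltWeight_pos θ j k).ne'
    simp [this, hn0.ne']
  | succ T =>
    have hsA : A.IsSymm := by
      ext k l
      simp only [transpose_apply, hA, tiltedMatrix, of_apply]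
      rw [hsymm.apply]
      ring
    have hnorm : ∀ x, (A *ᵥ x) ⬝ᵥ (A *ᵥ x) ≤ r ^ 2 * (x ⬝ᵥ x) :=
      dotProduct_mulVec_self_le hsA (tiltedMatrix_nonneg hW θ j) hr0
        (tiltedMatrix_quadratic_le hn hW hsymm hl hl0 hl1 hθ hr j)
    have hpow : ∀ T, ((A ^ T) *ᵥ e) ⬝ᵥ ((A ^ T) *ᵥ e) ≤ (r ^ T) ^ 2 * (e ⬝ᵥ e) := by
      intro T
      induction T with
      | zero => simp
      | succ T ih =>
        rw [pow_succ', ← mulVec_mulVec]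
        refine (hnorm _).trans ?_
        calc r ^ 2 * _ ≤ r ^ 2 * ((r ^ T) ^ 2 * (e ⬝ᵥ e)) := by gcongr
          _ = _ := by ring
    have hee : e ⬝ᵥ e = Real.exp θ + (n - 1) := by
      have h := sum_ite_eq_add j (Real.exp θ) 1
      rw [mul_one] at h
      rw [← h]
      exact Finset.sum_congr rfl fun k _ => by rw [← tiltWeight_sq, sq]
    have hee0 : 0 ≤ e ⬝ᵥ e := Finset.sum_nonneg fun k _ => mul_self_nonneg _
    have hmgf : (n : ℝ)⁻¹ * (e ⬝ᵥ e) ≤ r := by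
      have hinv : (n : ℝ)⁻¹ ≤ 1 := inv_le_one_of_one_le₀ (by exact_mod_cast (by omega : 1 ≤ n))
      have := bernoulli_mgf_le hl0 hl1 hinv hθ hr1
        (tilted_root_bound hl0 hl1 (inv_pos.2 hn0) hθ hr).2
      rw [hee]
      refine le_of_eq_of_le ?_ this
      field_simp
    have hcs : e ⬝ᵥ ((A ^ T) *ᵥ e) ≤ r ^ T * (e ⬝ᵥ e) := by
      refine le_of_sq_le_sq ?_ (by positivity)
      have h1 : (e ⬝ᵥ ((A ^ T) *ᵥ e)) ^ 2 ≤ (e ⬝ᵥ e) * (((A ^ T) *ᵥ e) ⬝ᵥ ((A ^ T) *ᵥ e)) := by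
        have := Finset.sum_mul_sq_le_sq_mul_sq Finset.univ e ((A ^ T) *ᵥ e)
        simpa only [dotProduct, sq] using this
      refine h1.trans ?_
      calc _ ≤ (e ⬝ᵥ e) * ((r ^ T) ^ 2 * (e ⬝ᵥ e)) := by gcongr; exact hpow T
        _ = _ := by ring
    have hterm : ∀ k, (n : ℝ)⁻¹ * (((A ^ (T + 1)) *ᵥ e) k / e k) =
        (n : ℝ)⁻¹ * ∑ l, W k l * (e l * ((A ^ T) *ᵥ e) l) := by
      intro k
      rw [pow_succ', ← mulVec_mulVec, hA, tiltedMatrix_mulVec,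
        mul_div_cancel_left₀ _ (tiltWeight_pos θ j k).ne']
    have hcol : ∀ l, ∑ k, W k l = 1 := fun l => by
      rw [← hW.2 l]
      exact Finset.sum_congr rfl fun k _ => hsymm.apply l k
    simp_rw [hterm]
    rw [← Finset.mul_sum, Finset.sum_comm]
    simp_rw [← Finset.sum_mul, hcol, one_mul]
    change (n : ℝ)⁻¹ * (e ⬝ᵥ ((A ^ T) *ᵥ e)) ≤ _
    calc (n : ℝ)⁻¹ * (e ⬝ᵥ ((A ^ T) *ᵥ e)) ≤ (n : ℝ)⁻¹ * (r ^ T * (e ⬝ᵥ e)) := by gcongr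
      _ = r ^ T * ((n : ℝ)⁻¹ * (e ⬝ᵥ e)) := by ring
      _ ≤ r ^ T * r := by gcongr
      _ = r ^ (T + 1) := by ring

/-- The Chernoff bound for the number of visits to `j` of the stationary chain. -/
lemma walkLaw_visits_gt_le (hn : 2 ≤ n) (hW : IsStochastic W) (hsymm : W.IsSymm) {l : ℝ}
    (hl : lambda2 hn W hsymm ≤ l) (hl0 : 0 < l) (hl1 : l < 1) {π : Fin n → ℝ}
    (hπ : ∀ k, π k = (n : ℝ)⁻¹) (j : Fin n) (T : ℕ) {ζ : ℝ} (hζ : 0 < ζ) {N : ℕ}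
    (hN : (1 + ζ) * T / n ≤ N) :
    walkLaw W π T {y | N < visits j y} ≤
      ENNReal.ofReal (Real.exp (-((1 - l) / (1 + l) * (2 * ζ ^ 2 * T / n ^ 2)))) := by
  have hn0 : (0 : ℝ) < n := by exact_mod_cast (by omega : 0 < n)
  set κ := (1 + l) / (1 - l) with hκ
  have hκ0 : 0 < κ := div_pos (by linarith) (by linarith)
  -- The minimizer of the exponent `κ θ² / 8 - θ ζ / n` per unit of time.
  set θ := 4 * ζ * (n : ℝ)⁻¹ / κ with hθd
  have hθ : 0 < θ := by positivity
  set r := Real.exp (θ * (n : ℝ)⁻¹ + κ * θ ^ 2 / 8) with hr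
  set c := (1 + ζ) * T / n with hc
  have hmgf : ∫⁻ y, ENNReal.ofReal (Real.exp (θ * visits j y)) ∂walkLaw W π T ≤
      ENNReal.ofReal (r ^ T) := by
    rw [lintegral_walkLaw]
    simp_rw [lintegral_exp_visits hW, hπ, ← ENNReal.ofReal_mul (inv_nonneg.2 hn0.le)]
    rw [← ENNReal.ofReal_sum_of_nonneg]
    · exact ENNReal.ofReal_le_ofReal (sum_tilted_le hn hW hsymm hl hl0 hl1 hθ hr j T)
    · exact fun k _ => mul_nonneg (inv_nonneg.2 hn0.le) (div_nonneg
        (tiltedMatrix_pow_mulVec_nonneg hW θ j T k) (tiltWeight_pos θ j k).le)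
  have hmk : ENNReal.ofReal (Real.exp (θ * c)) * walkLaw W π T {y | N < visits j y} ≤
      ENNReal.ofReal (r ^ T) := by
    refine le_trans ?_ hmgf
    refine le_trans ?_ (mul_meas_ge_le_lintegral₀ (measurable_of_finite _).aemeasurable
      (ENNReal.ofReal (Real.exp (θ * c))))
    gcongr with y
    intro h
    have : (N : ℝ) ≤ visits j y := by exact_mod_cast h.le
    exact ENNReal.ofReal_le_ofReal (Real.exp_le_exp.2
      (mul_le_mul_of_nonneg_left (hN.trans this) hθ.le))
  have hfin : ENNReal.ofReal (r ^ T) = ENNReal.ofReal (Real.exp (θ * c)) *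
      ENNReal.ofReal (Real.exp (-((1 - l) / (1 + l) * (2 * ζ ^ 2 * T / n ^ 2)))) := by
    rw [← ENNReal.ofReal_mul (Real.exp_pos _).le, ← Real.exp_add, hr, ← Real.exp_nat_mul]
    congr 2
    have hinv : (1 - l) / (1 + l) = κ⁻¹ := by rw [hκ, inv_div]
    rw [hinv, hθd, hc]
    field_simp
    ring
  rw [hfin] at hmk
  exact (ENNReal.mul_le_mul_iff_right (by simp [Real.exp_pos]) ENNReal.ofReal_ne_top).1 hmk

lemma isProbabilityMeasure_walkLaw (hW : IsStochastic W) {π : Fin n → ℝ}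
    (hπ : IsStationaryDist W π) (T : ℕ) : IsProbabilityMeasure (walkLaw W π T) := by
  refine isProbabilityMeasure_of_lintegral_one ?_
  have h : ∀ k, IsProbabilityMeasure (pathLaw (walkStep W) T k) :=
    isProbabilityMeasure_pathLaw (measurable_walkStep W) hW.isProbabilityMeasure_walkStep T
  rw [lintegral_walkLaw]
  simp only [lintegral_one, measure_univ, mul_one]
  rw [← ENNReal.ofReal_sum_of_nonneg fun k _ => hπ.1 k, hπ.2.1, ENNReal.ofReal_one]

/-- Hoeffding's inequality for the number of visits to `j` of the stationary chain. -/
lemma walkLaw_real_visits_gt_le (hn : 2 ≤ n) (hW : IsStochastic W) (hsymm : W.IsSymm)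
    (hirr : IsIrreducibleChain W) {π : Fin n → ℝ} (hπ : IsStationaryDist W π) (j : Fin n) (T : ℕ)
    {ζ : ℝ} (hζ : 0 < ζ) {N : ℕ} (hN : (1 + ζ) * T / n ≤ N) {l : ℝ}
    (hl : lambda2 hn W hsymm ≤ l) (hl0 : 0 ≤ l) :
    (walkLaw W π T).real {y | N < visits j y} ≤
      Real.exp (-((1 - l) / (1 + l) * (2 * ζ ^ 2 * T / n ^ 2))) := by
  have := isProbabilityMeasure_walkLaw hW hπ T
  -- For `l ≥ 1` the right side is at least `1`.
  rcases le_or_gt 1 l with h1 | h1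
  · refine measureReal_le_one.trans (Real.one_le_exp ?_)
    have : (1 - l) / (1 + l) ≤ 0 := div_nonpos_of_nonpos_of_nonneg (by linarith) (by linarith)
    have h2 : 0 ≤ 2 * ζ ^ 2 * T / (n : ℝ) ^ 2 := by positivity
    nlinarith
  -- The Chernoff bound needs `0 < l`; the value `l = 0` is reached by letting `l'` decrease to `l`.
  · have hlim : Filter.Tendsto (fun l : ℝ =>
        Real.exp (-((1 - l) / (1 + l) * (2 * ζ ^ 2 * T / n ^ 2)))) (nhdsWithin l (Set.Ioi l))
        (nhds (Real.exp (-((1 - l) / (1 + l) * (2 * ζ ^ 2 * T / n ^ 2))))) := by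
      refine Filter.Tendsto.mono_left ?_ nhdsWithin_le_nhds
      refine ContinuousAt.tendsto (f := fun l : ℝ =>
        Real.exp (-((1 - l) / (1 + l) * (2 * ζ ^ 2 * T / n ^ 2)))) ?_
      have : 1 + l ≠ 0 := by linarith
      fun_prop (disch := assumption)
    refine ge_of_tendsto hlim ?_
    filter_upwards [Ioo_mem_nhdsGT h1] with l' hl'
    refine ENNReal.toReal_le_of_le_ofReal (Real.exp_pos _).le ?_
    exact walkLaw_visits_gt_le hn hW hsymm (hl.trans hl'.1.le) (hl0.trans_lt hl'.1) hl'.2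
      (hπ.eq_uniform hW hsymm hirr) j T hζ hN

end Visits

/-! ### The view of a user on an event of the walk -/

section Views

variable {n d : ℕ} {Z : Type*} {m : Fin n → ℕ} {p : Params n d Z}

lemma Params.Regular.lintegral_runLaw (D : Data n m Z) (π : Fin n → ℝ)
    (θ₀ : Model d) (T : ℕ) (F : (Fin (T + 1) → Fin n × Model d) → ℝ≥0∞) :
    ∫⁻ y, F y ∂runLaw p D π θ₀ T =
      ∑ k, ENNReal.ofReal (π k) * ∫⁻ y, F y ∂pathLaw (roundStep p D) T (k, θ₀) := by
  rw [runLaw, lintegral_finsetSum_measure]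
  exact Finset.sum_congr rfl fun k _ => by rw [lintegral_smul_measure, smul_eq_mul]

lemma IsStationaryDist.sum_ofReal {W : Matrix (Fin n) (Fin n) ℝ} {π : Fin n → ℝ}
    (hπ : IsStationaryDist W π) : ∑ k, ENNReal.ofReal (π k) = 1 := by
  rw [← ENNReal.ofReal_sum_of_nonneg fun k _ => hπ.1 k, hπ.2.1, ENNReal.ofReal_one]

lemma Params.Regular.isProbabilityMeasure_runLaw (hp : p.Regular m) (D : Data n m Z)
    {π : Fin n → ℝ} (hπ : IsStationaryDist p.W π) (θ₀ : Model d) (T : ℕ) :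
    IsProbabilityMeasure (runLaw p D π θ₀ T) := by
  refine isProbabilityMeasure_of_lintegral_one ?_
  have h := isProbabilityMeasure_pathLaw (hp.measurable_roundStep D)
    (hp.isProbabilityMeasure_roundStep D) T
  rw [lintegral_runLaw]
  simp only [lintegral_one, measure_univ, mul_one]
  exact hπ.sum_ofReal

/-- The users of a run with a random start form the random walk. -/
lemma Params.Regular.lintegral_runLaw_users (hp : p.Regular m) (D : Data n m Z) (π : Fin n → ℝ)
    (θ₀ : Model d) (T : ℕ) (F : (Fin (T + 1) → Fin n) → ℝ≥0∞) :
    ∫⁻ y, F (users y) ∂runLaw p D π θ₀ T = ∫⁻ u, F u ∂walkLaw p.W π T := by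
  rw [lintegral_runLaw, lintegral_walkLaw]
  simp_rw [hp.lintegral_users D T]

lemma visits_users {T : ℕ} (j : Fin n) (y : Fin (T + 1) → Fin n × Model d) :
    visits j (users y) = receipts (received j y) := by
  unfold visits receipts received users
  congr 1
  refine Finset.filter_congr fun t _ => ?_
  split_ifs with h <;> simp [h]

/-- The view of user `j` on the event that there are at most `N` receipts. -/
def truncateView {T : ℕ} (N : ℕ) (v : Fin T → Model d ⊕ Unit) : (Fin T → Model d ⊕ Unit) ⊕ Unit :=
  if receipts v ≤ N then Sum.inl v else Sum.inr ()

lemma measurable_receipts {T : ℕ} :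
    Measurable (receipts : (Fin T → Model d ⊕ Unit) → ℕ) := by
  have : (receipts : (Fin T → Model d ⊕ Unit) → ℕ) =
      fun v => ∑ t : Fin T, if (v t).isLeft then 1 else 0 := by
    funext v
    rw [receipts, Finset.card_filter]
  rw [this]
  refine Finset.measurable_sum _ fun t _ => ?_
  have : Measurable fun o : Model d ⊕ Unit => if o.isLeft then 1 else 0 :=
    measurable_fun_sum (measurable_const (a := 1)) (measurable_const (a := 0))
  exact this.comp (measurable_pi_apply t)

lemma measurable_truncateView {T : ℕ} (N : ℕ) :
    Measurable (truncateView N : (Fin T → Model d ⊕ Unit) → _) :=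
  Measurable.ite (measurable_receipts measurableSet_Iic) measurable_inl measurable_const

/-- Visits are receipts, so membership in the event is decided by the view, and the truncated view
is a function of the full one. -/
lemma viewLawOn_eq (D : Data n m Z) (π : Fin n → ℝ) (θ₀ : Model d) (T : ℕ) (j : Fin n) (N : ℕ) :
    viewLawOn p D π θ₀ T j {y | visits j y ≤ N} =
      (runLaw p D π θ₀ T).map fun y => truncateView N (received j y) := by
  unfold viewLawOn truncateView
  congr 1
  funext y
  have h : (fun t => (y t).1) ∈ {y : Fin (T + 1) → Fin n | visits j y ≤ N} ↔
      receipts (received j y) ≤ N := by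
    rw [← visits_users]
    rfl
  simp only [h]

lemma lintegral_viewLawOn (D : Data n m Z) (π : Fin n → ℝ) (θ₀ : Model d) (T : ℕ) (j : Fin n)
    (N : ℕ) {φ : (Fin T → Model d ⊕ Unit) ⊕ Unit → ℝ≥0∞} (hφ : Measurable φ) :
    ∫⁻ v, φ v ∂viewLawOn p D π θ₀ T j {y | visits j y ≤ N} =
      ∫⁻ y, φ (truncateView N (received j y)) ∂runLaw p D π θ₀ T := by
  have h : Measurable fun y : Fin (T + 1) → Fin n × Model d => truncateView N (received j y) :=
    (measurable_truncateView N).comp (measurable_received j)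
  rw [viewLawOn_eq, lintegral_map hφ h]

/-- The view on the event that `j` is visited at most `N` times is at least as private as the `N`-fold
product of the single-visit pair. -/
lemma Params.Regular.dominates_viewLawOn (hp : p.Regular m) {D D' : Data n m Z} {i j : Fin n}
    (hD : ∀ k, k ≠ i → D k = D' k) {T : ℕ} {g : ℝ → ℝ}
    (hg : IsSingle T (hitProb p.W i j) (perVisit p D D' i j) g)
    {X : Type} [MeasurableSpace X] {P Q : Measure X} (hPQ : Represents P Q g) (N : ℕ)
    {π : Fin n → ℝ} (hπ : IsStationaryDist p.W π) {θ₀ : Model d} (hθ₀ : θ₀ ∈ p.domain) :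
    Dominates (tradeoff (viewLawOn p D π θ₀ T j {y | visits j y ≤ N})
        (viewLawOn p D' π θ₀ T j {y | visits j y ≤ N}))
      (tradeoff (Measure.pi fun _ : Fin N => P) (Measure.pi fun _ : Fin N => Q)) := by
  have hP := hPQ.1
  have hQ := hPQ.2.1
  have hrun : ∀ E : Data n m Z, IsProbabilityMeasure (runLaw p E π θ₀ T) := fun E =>
    hp.isProbabilityMeasure_runLaw E hπ θ₀ T
  have hview : ∀ E : Data n m Z,
      IsFiniteMeasure (viewLawOn p E π θ₀ T j {y | visits j y ≤ N}) := fun E => by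
    unfold viewLawOn
    infer_instance
  refine dominates_of_forall_test _ _ _ _ fun φ hφ a ha => ?_
  have hΦ : IsTest fun v : Fin T → Model d ⊕ Unit => φ (truncateView N v) :=
    ⟨hφ.1.comp (measurable_truncateView N), fun v => hφ.2 _⟩
  -- Above `N` receipts the truncated view is the fixed symbol, which is exactly the constancy
  -- needed for the induction on receipts.
  have hconst : ConstAbove N fun v : Fin T → Model d ⊕ Unit => φ (truncateView N v) :=
    ⟨φ (Sum.inr ()), fun v hv => by simp only [truncateView, if_neg (not_le.2 hv)]⟩
  rw [lintegral_viewLawOn D π θ₀ T j N hφ.1, lintegral_viewLawOn D' π θ₀ T j N hφ.1,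
    lintegral_runLaw, lintegral_runLaw]
  have hk : ∀ k, ∫⁻ y, φ (truncateView N (received j y)) ∂pathLaw (roundStep p D') T (k, θ₀) ≤
      a * ∫⁻ y, φ (truncateView N (received j y)) ∂pathLaw (roundStep p D) T (k, θ₀) +
        hockeyPow P Q N a 1 := fun k => by
    have h := hp.viewInt_le hD hg hPQ N T le_rfl _ hΦ hconst (k, θ₀) hθ₀ a 1 ha ENNReal.one_ne_top
    rwa [one_mul] at h
  -- The bound is the same for every first user and the start weights sum to `1`, so a random start
  -- costs nothing.
  calc _ ≤ ∑ k, ENNReal.ofReal (π k) *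
        (a * ∫⁻ y, φ (truncateView N (received j y)) ∂pathLaw (roundStep p D) T (k, θ₀) +
          hockeyPow P Q N a 1) := by gcongr with k; exact hk k
    _ = a * ∑ k, ENNReal.ofReal (π k) *
          ∫⁻ y, φ (truncateView N (received j y)) ∂pathLaw (roundStep p D) T (k, θ₀) +
        hockeyPow P Q N a 1 := by
      simp_rw [mul_add]
      rw [Finset.sum_add_distrib, ← Finset.sum_mul, hπ.sum_ofReal, one_mul, Finset.mul_sum]
      congr 1
      exact Finset.sum_congr rfl fun k _ => by ring

/-- Passing from the view on the event that `j` is visited at most `N` times to the full view costs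
the probability of the complement. -/
lemma Params.Regular.tradeoff_viewLawOn_sub_le (hp : p.Regular m) (D D' : Data n m Z) (j : Fin n)
    {T : ℕ} (N : ℕ) {π : Fin n → ℝ} (hπ : IsStationaryDist p.W π) (θ₀ : Model d) {α : ℝ}
    (hα : 0 ≤ α) :
    tradeoff (viewLawOn p D π θ₀ T j {y | visits j y ≤ N})
        (viewLawOn p D' π θ₀ T j {y | visits j y ≤ N}) α -
      (walkLaw p.W π T).real {y | N < visits j y} ≤
    tradeoff (viewLaw p D π θ₀ T j) (viewLaw p D' π θ₀ T j) α := by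
  have hrun : ∀ E : Data n m Z, IsProbabilityMeasure (runLaw p E π θ₀ T) := fun E =>
    hp.isProbabilityMeasure_runLaw E hπ θ₀ T
  have hview : ∀ E : Data n m Z,
      IsFiniteMeasure (viewLawOn p E π θ₀ T j {y | visits j y ≤ N}) := fun E => by
    unfold viewLawOn
    infer_instance
  have hviewLaw : ∀ E : Data n m Z, IsFiniteMeasure (viewLaw p E π θ₀ T j) := fun E => by
    unfold viewLaw
    infer_instance
  have hwalk := isProbabilityMeasure_walkLaw hp.stochastic hπ T
  refine le_tradeoff_of_test _ _ hα fun φ hφ hφα => ?_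
  -- Never rejecting at the extra symbol keeps the type I error below that of `φ` and loses at most
  -- the probability of the complement in power.
  set φ' : (Fin T → Model d ⊕ Unit) ⊕ Unit → ℝ≥0∞ := Sum.elim φ 0 with hφ'd
  have hφ' : IsTest φ' := by
    refine ⟨hφ.1.sumElim measurable_const, ?_⟩
    rintro (v | _)
    · exact hφ.2 v
    · exact zero_le_one
  have hint : ∀ E : Data n m Z, ∫⁻ v, φ v ∂viewLaw p E π θ₀ T j =
      ∫⁻ y, φ (received j y) ∂runLaw p E π θ₀ T := fun E => by
    rw [viewLaw, lintegral_map hφ.1 (measurable_received j)]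
  have hle : ∀ v : Fin T → Model d ⊕ Unit, φ' (truncateView N v) ≤ φ v := fun v => by
    unfold truncateView
    split_ifs
    · exact le_rfl
    · exact zero_le
  have hge : ∀ v : Fin T → Model d ⊕ Unit,
      φ v ≤ φ' (truncateView N v) + if N < receipts v then 1 else 0 := fun v => by
    unfold truncateView
    split_ifs with h1 h2 h2
    · omega
    · rw [add_zero]; exact le_rfl
    · rw [show φ' (Sum.inr ()) = 0 from rfl, zero_add]; exact hφ.2 v
    · omega
  have hnull : (∫⁻ v, φ' v ∂viewLawOn p D π θ₀ T j {y | visits j y ≤ N}).toReal ≤ α := by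
    refine le_trans (ENNReal.toReal_mono (lintegral_test_ne_top _ hφ) ?_) hφα
    rw [hint, lintegral_viewLawOn D π θ₀ T j N hφ'.1]
    exact lintegral_mono fun y => hle _
  have hmeas : Measurable fun y : Fin (T + 1) → Fin n × Model d => φ' (truncateView N (received j y)) :=
    hφ'.1.comp ((measurable_truncateView N).comp (measurable_received j))
  have halt : (∫⁻ v, φ v ∂viewLaw p D' π θ₀ T j).toReal ≤
      (∫⁻ v, φ' v ∂viewLawOn p D' π θ₀ T j {y | visits j y ≤ N}).toReal +
        (walkLaw p.W π T).real {y | N < visits j y} := by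
    rw [Measure.real, ← ENNReal.toReal_add (lintegral_test_ne_top _ hφ') (measure_ne_top _ _)]
    refine ENNReal.toReal_mono
      (ENNReal.add_ne_top.2 ⟨lintegral_test_ne_top _ hφ', measure_ne_top _ _⟩) ?_
    rw [hint, lintegral_viewLawOn D' π θ₀ T j N hφ'.1,
      ← lintegral_indicator_one (Set.toFinite _).measurableSet, ← hp.lintegral_runLaw_users D' π θ₀,
      ← lintegral_add_left hmeas]
    refine lintegral_mono fun y => (hge _).trans (le_of_eq ?_)
    simp only [Set.indicator_apply, Set.mem_ofPred_eq, visits_users, Pi.one_apply]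
  have := tradeoff_le_of_test (viewLawOn p D π θ₀ T j {y | visits j y ≤ N})
    (viewLawOn p D' π θ₀ T j {y | visits j y ≤ N}) hφ' hnull
  linarith

end Views

end DecSGD

end

theorem theorem2 {n d : ℕ} {Z : Type*} {m : Fin n → ℕ} (hn : 2 ≤ n)
    (p : Params n d Z)
    (hW : IsStochastic p.W) (hsymm : p.W.IsSymm) (hirr : IsIrreducibleChain p.W)
    (haper : IsAperiodicChain p.W)
    (hloss : ∀ z, Differentiable ℝ (p.loss z))
    (hclosed : IsClosed p.domain) (hconvex : Convex ℝ p.domain)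
    (hη : 0 < p.η) (hσ : 0 < p.σ) (hb : 1 ≤ p.b) (hbm : ∀ k, p.b ≤ m k) (hK : 1 ≤ p.K)
    (π : Fin n → ℝ) (hπ : IsStationaryDist p.W π)
    (θ₀ : Model d) (hθ₀ : θ₀ ∈ p.domain)
    (T : ℕ) (i j : Fin n) (D D' : Data n m Z) (hD : RecordAdjacent i D D')
    (ζ : ℝ) (hζ : 0 < ζ) (N : ℕ) (hN : N = ⌈(1 + ζ) * T / n⌉₊)
    (lam δ' : ℝ) (hlam : lam = max (lambda2 hn p.W hsymm) 0)
    (hδ' : δ' = Real.exp (-((1 - lam) / (1 + lam) * (2 * ζ ^ 2 * T / n ^ 2)))) :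
    (∃ fsingle : ℝ → ℝ, IsSingle T (hitProb p.W i j) (perVisit p D D' i j) fsingle) ∧
    (∀ fsingle : ℝ → ℝ, IsSingle T (hitProb p.W i j) (perVisit p D D' i j) fsingle →
      (∃ h : ℝ → ℝ, IsTensorPow fsingle N h) ∧
      ∀ h : ℝ → ℝ, IsTensorPow fsingle N h →
        1 - δ' ≤ (walkLaw p.W π T).real {y | visits j y ≤ N} ∧
        Dominates (tradeoff (viewLawOn p D π θ₀ T j {y | visits j y ≤ N})
          (viewLawOn p D' π θ₀ T j {y | visits j y ≤ N})) h ∧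
        Dominates (tradeoff (viewLaw p D π θ₀ T j) (viewLaw p D' π θ₀ T j))
          (fun α => h α - δ')) := by
  have hp : p.Regular m := ⟨hW, hclosed, hconvex, ⟨θ₀, hθ₀⟩, hbm, hK⟩
  obtain ⟨_, _, _, hD⟩ := hD
  refine ⟨exists_isSingle (fun t => measureReal_nonneg) (hp.sum_hitProb_le_one D i j T)
    fun t => isTradeoff_perVisit p D D' i j t, fun g hg => ⟨?_, fun h hh => ?_⟩⟩
  · obtain ⟨X, mX, P, Q, hPQ⟩ := hg.1
    exact ⟨_, X, mX, P, Q, hPQ, fun α _ => rfl⟩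
  · obtain ⟨X, mX, P, Q, hPQ, hh⟩ := hh
    have hl : lambda2 hn p.W hsymm ≤ lam := hlam ▸ le_max_left _ _
    have hl0 : 0 ≤ lam := hlam ▸ le_max_right _ _
    have hNc : (1 + ζ) * T / n ≤ N := hN ▸ Nat.le_ceil _
    have htail : (walkLaw p.W π T).real {y | N < visits j y} ≤ δ' :=
      hδ' ▸ walkLaw_real_visits_gt_le hn hW hsymm hirr hπ j T hζ hNc hl hl0
    have hwalk := isProbabilityMeasure_walkLaw hW hπ T
    have hdom := hp.dominates_viewLawOn hD hg hPQ N hπ hθ₀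
    refine ⟨?_, fun α hα => (hh α hα).trans_le (hdom α hα), fun α hα => ?_⟩
    · have hc : {y : Fin (T + 1) → Fin n | visits j y ≤ N} = {y | N < visits j y}ᶜ := by
        ext y
        simp
      rw [hc, probReal_compl_eq_one_sub (Set.toFinite _).measurableSet]
      linarith
    · have h1 := hp.tradeoff_viewLawOn_sub_le D D' j (T := T) N hπ θ₀ hα.1
      have h2 := (hh α hα).trans_le (hdom α hα)
      linarith
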